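/- **Setting.** Atomic types are type variables and type constants $0,1,2,\dots$ (string positions); types are built from them with $\to$. *Lambek formulas* are built from simple atoms with $/$ and $\backslash$; *hybrid formulas* are complex atoms, Lambek formulas, and $A|B$ for hybrid formulas $A,B$. The Church type of a formula over a single constant $\sigma$ is $\sigma\to\sigma$ for Lambek formulas, a given type for a complex atom, and $\mathrm{type}(B)\to\mathrm{type}(A)$ for $A|B$. *Hybrid type-logical grammar* derives sequents $x_1^{\alpha_1}:A_1,\dots,x_m^{\alpha_m}:A_m\vdash M^{\beta}:B$ (antecedents are multisets with distinct term variables, $M$ a linear lambda term) by the following rules. * Lexicon: $x^{n+1\to n}:A\vdash M^{\alpha}:A$, where $\lambda x.M$ is a $\beta$-normal $\eta$-long linear term of Church type $(\sigma\to\sigma)\to\mathrm{type}(A)$ and $\langle x^{n+1\to n},\alpha\rangle$ is a principal pair for $M$. * Axiom: $x^{\alpha}:A\vdash M^{\alpha}:A$, where $M$ is the $\eta$-expansion of $x$ at $\mathrm{type}(A)$ and $\alpha$ is its principal type (of the form of $\mathrm{type}(A)$, with pairwise distinct variables as leaves). * $/E$: from $\Gamma\vdash M^{F\to C}:A/B$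 and $\Delta\vdash N^{E\to D}:B$ infer $s\Gamma,s\Delta\vdash(\lambda z.M(Nz))^{sE\to sC}:A$; $\backslash E$: from $\Gamma\vdash M^{F\to C}:B$ and $\Delta\vdash N^{E\to D}:B\backslash A$ infer the same. Here $s$ is a most general unifier of $F$ and $D$. * $/I$: from $\Gamma,x^{D\to C}:B\vdash M^{D\to E}:A$ infer $s\Gamma\vdash((\lambda x.M)(\lambda z.z))^{sC\to sE}:A/B$; $\backslash I$: from $\Gamma,x^{C\to D}:B\vdash M^{E\to D}:A$ infer $s\Gamma\vdash((\lambda x.M)(\lambda z.z))^{sE\to sC}:B\backslash A$. Here $D$ is a type variable and $s$ is a most general unifier of $C$ and $D$. * $|E$: from $\Gamma\vdash M^{\beta\to\alpha}:A|B$ and $\Delta\vdash N^{\gamma}:B$ infer $s\Gamma,s\Delta\vdash(MN)^{s\alpha}:A$, with $s$ a most general unifier of $\beta$ and $\gamma$; $|I$: from $\Gamma,x^{\beta}:B\vdash M^{\alpha}:A$ infer $\Gamma\vdash(\lambda x.M)^{\beta\to\alpha}:A|B$. The premisses of a two-premiss rule share neither term variables nor type variables, and introduction rules discharge hypotheses of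 the axiom rule only. *MILL1* is natural deduction with the usual rules for $\multimap$ and $\forall$, without weakening and contraction, over atoms $p(t_1,\dots,t_k)$ whose terms are variables and constants. In both systems a proof has a semantic lambda term: the hypothesis $x$ gives the variable $x$, elimination rules for $/,\backslash,|,\multimap$ give application, introduction rules give abstraction, and $\forall$ is inert. *Translation.* Let $f(a)=[a]$ for an atomic type $a$ and $f(\beta\to\alpha)=f(\alpha)f(\beta)$ (concatenation). Put $\|p\|^{[C_1,\dots,C_k]}=p(C_1,\dots,C_k)$, $\|A|B\|^{f(\beta\to\alpha)}=\|B\|^{f(\beta)}\multimap\|A\|^{f(\alpha)}$, $\|A/B\|^{[C,D]}=\forall x.\,\|B\|^{[D,x]}\multimap\|A\|^{[C,x]}$, $\|B\backslash A\|^{[C,D]}=\forall x.\,\|B\|^{[x,C]}\multimap\|A\|^{[x,D]}$. A hypothesis $x^{\alpha}:A$ from the axiom rule is translated as $\|A\|^{f(\alpha)}$; a lexical hypothesis whose term has principal type $\alpha$ is translated as the universal closure of $\|A\|^{f(\alpha)}$. The succedent $B$ of type $\beta$ is translated as the universal closure of $\|B\|^{f(\beta)}$ over its free variables that are not free in the translated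 antecedent. **Theorem.** Consider antecedents $\Gamma$, types $\beta$ and hybrid formulas $B$. Call $(\Gamma,\beta,B)$ *well-formed* if the term variables of $\Gamma$ are distinct, its lexical hypotheses satisfy the condition of the lexicon rule, all types have the form of the Church types of their formulas, every atomic type that occurs in the sequent occurs exactly twice, and every type constant that occurs is an end position of a lexical hypothesis of $\Gamma$. 1. If $(\Gamma,\beta,B)$ is well-formed, then $\Gamma\vdash M^{\beta}:B$ is derivable in hybrid type-logical grammar for some $M$ if and only if the translation of the sequent is derivable in MILL1. 2. For every hybrid proof of a sequent $\Gamma\vdash M^\beta:B$ (well-formed or not) there is a MILL1 proof of its translation with the same semantic term. 3. If $(\Gamma,\beta,B)$ is well-formed and its translation has a MILL1 proof with semantic term $t$, then for some $M$ there is a hybrid proof of $\Gamma\vdash M^\beta:B$ whose semantic term is $\beta\eta$-equivalent to $t$. 4. In particular, let $n\ge 1$, let $x_1^{1\to0}:A_1,\dots,x_n^{n\to n-1}:A_n$ be lexical hypotheses with distinct term variables, whose lexical terms have principal types $\alpha_1,\dots,\alpha_n$, and let $B$ have Church type $\sigma\to\sigma$. From a hybrid proof of $x_1^{1\to0}:A_1,\dots,x_n^{n\to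 n-1}:A_n\vdash M^{n\to0}:B$ one obtains a MILL1 proof, with the same semantic term, of $\|B\|^{[0,n]}$ from the universal closures of the formulas $\|A_i\|^{f(\alpha_i)}$; conversely, from a MILL1 proof of the latter sequent with semantic term $t$ one obtains a hybrid proof of the former, for some $M$, with a semantic term $\beta\eta$-equivalent to $t$. In every such hybrid proof $M=_{\beta\eta}\lambda z.\,x_1(\cdots(x_n\,z))$. -/

import Mathlib

universe u

namespace HTLG

/-! ### Lambda terms

One datatype serves for the string terms of hybrid type-logical grammar and for the semantic
terms of both systems.  Bound variables are (well-scoped) de Bruijn indices, free variables are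
names in `ℕ`; so terms are literally identified up to renaming of bound variables. -/

/-- Lambda terms with `k` free de Bruijn indices and with named free variables. -/
inductive Lam : ℕ → Type
  | bvar {k : ℕ} (i : Fin k) : Lam k
  | fvar {k : ℕ} (x : ℕ) : Lam k
  | app {k : ℕ} (M N : Lam k) : Lam k
  | lam {k : ℕ} (M : Lam (k + 1)) : Lam k

namespace Lam

/-- Renaming of indices. -/
def ren : {k m : ℕ} → (Fin k → Fin m) → Lam k → Lam m
  | _, _, r, bvar i => bvar (r i)
  | _, _, _, fvar x => fvar x
  | _, _, r, app M N => app (ren r M) (ren r N)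
  | _, _, r, lam M => lam (ren (Fin.cases 0 fun i => (r i).succ) M)

/-- `M` in the scope of one more binder. -/
def weaken {k : ℕ} (M : Lam k) : Lam (k + 1) := ren Fin.succ M

/-- Simultaneous capture-avoiding substitution for indices (`b`) and for names (`f`). -/
def bind : {k m : ℕ} → (Fin k → Lam m) → (ℕ → Lam m) → Lam k → Lam m
  | _, _, b, _, bvar i => b i
  | _, _, _, f, fvar x => f x
  | _, _, b, f, app M N => app (bind b f M) (bind b f N)
  | _, _, b, f, lam M =>
      lam (bind (Fin.cases (bvar 0) fun i => (b i).weaken) (fun x => (f x).weaken) M)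

/-- The body `M` of an abstraction with its bound variable replaced by `N`. -/
def inst {k : ℕ} (M : Lam (k + 1)) (N : Lam k) : Lam k := bind (Fin.cases N bvar) fvar M

/-- `lambda x M` is the term `λx. M`, where `x` is a name. -/
def lambda (x : ℕ) (M : Lam 0) : Lam 0 :=
  lam (bind Fin.elim0 (fun y => if y = x then bvar 0 else fvar y) M)

/-- `λz. M (N z)`, with `z` not free in `M`, `N`. -/
def comp (M N : Lam 0) : Lam 0 := lam (app M.weaken (app N.weaken (bvar 0)))

/-- `λz. z` -/
def idTerm : Lam 0 := lam (bvar 0)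

/-- `λz. x₁ (x₂ (… (xₙ z)))` -/
def stringTerm (xs : List ℕ) : Lam 0 := lam (xs.foldr (fun x M => app (fvar x) M) (bvar 0))

end Lam

/-- `βη`-equivalence. -/
inductive BetaEta : {k : ℕ} → Lam k → Lam k → Prop
  | beta {k : ℕ} (M : Lam (k + 1)) (N : Lam k) : BetaEta (.app (.lam M) N) (M.inst N)
  | eta {k : ℕ} (M : Lam k) : BetaEta (.lam (.app M.weaken (.bvar 0))) M
  | refl {k : ℕ} (M : Lam k) : BetaEta M M
  | symm {k : ℕ} {M N : Lam k} : BetaEta M N → BetaEta N M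
  | trans {k : ℕ} {M N P : Lam k} : BetaEta M N → BetaEta N P → BetaEta M P
  | app {k : ℕ} {M M' N N' : Lam k} :
      BetaEta M M' → BetaEta N N' → BetaEta (.app M N) (.app M' N')
  | lam {k : ℕ} {M M' : Lam (k + 1)} : BetaEta M M' → BetaEta (.lam M) (.lam M')

/-! ### Types -/

/-- String positions: the atomic types, which are also the first-order terms. -/
inductive Pos
  | var (v : ℕ)
  | const (n : ℕ)
  deriving DecidableEq

/-- Types over type variables and type constants; `arr β α` is `β → α`. -/
inductive Ty
  | atom (p : Pos)
  | arr (β α : Ty)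

/-- Church types over the single type constant `σ`. -/
inductive STy
  | σ
  | arr (b a : STy)

namespace STy

/-- The type of strings. -/
def str : STy := arr σ σ

/-- The number of leaves. -/
def length : STy → ℕ
  | σ => 1
  | arr b a => a.length + b.length

/-- The `η`-expansion of a term of a given Church type. -/
def etaExpand : STy → {k : ℕ} → Lam k → Lam k
  | σ, _, M => M
  | arr b a, _, M => .lam (etaExpand a (.app M.weaken (etaExpand b (.bvar 0))))

end STy

namespace Ty

/-- All type variables and constants replaced by `σ`. -/
def shape : Ty → STy
  | atom _ => .σ
  | arr β α => .arr β.shape α.shape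

/-- Application of a substitution of types for type variables. -/
def subst (s : ℕ → Ty) : Ty → Ty
  | atom (.var v) => s v
  | atom (.const n) => atom (.const n)
  | arr β α => arr (β.subst s) (α.subst s)

/-- The flattened list `f(α)` of the atomic types of `α`. -/
def flatten : Ty → List Pos
  | atom p => [p]
  | arr β α => α.flatten ++ β.flatten

/-- The leaves of the type are pairwise distinct type variables. -/
def IsGeneric (α : Ty) : Prop :=
  α.flatten.Nodup ∧ ∀ p ∈ α.flatten, ∃ v, p = .var v

end Ty

/-- `s` is a most general unifier of the two types. -/
def IsMGU (s : ℕ → Ty) (α β : Ty) : Prop :=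
  α.subst s = β.subst s ∧
    ∀ t : ℕ → Ty, α.subst t = β.subst t → ∃ u : ℕ → Ty, ∀ v, t v = (s v).subst u

/-- The type `m → l` of a string that starts at position `l` and ends at position `m`. -/
def spanTy (l m : ℕ) : Ty := .arr (.atom (.const m)) (.atom (.const l))

/-- Curry-style typing of linear lambda terms. -/
inductive Typing : Multiset (ℕ × Ty) → Lam 0 → Ty → Prop
  | var (x : ℕ) (α : Ty) : Typing {(x, α)} (.fvar x) α
  | app {Γ Δ : Multiset (ℕ × Ty)} {M N : Lam 0} {α β : Ty} :
      Typing Γ M (.arr α β) → Typing Δ N α →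
      (∀ p ∈ Γ, ∀ q ∈ Δ, p.1 ≠ q.1) → Typing (Γ + Δ) (.app M N) β
  | lam {Γ : Multiset (ℕ × Ty)} {M : Lam 0} {x : ℕ} {α β : Ty} :
      Typing ((x, α) ::ₘ Γ) M β → (∀ p ∈ Γ, p.1 ≠ x) →
      Typing Γ (Lam.lambda x M) (.arr α β)

/-- A principal pair `⟨Γ, α⟩` for `M`. -/
def PrincipalPair (Γ : Multiset (ℕ × Ty)) (M : Lam 0) (α : Ty) : Prop :=
  Typing Γ M α ∧ ∀ β : Ty, Typing Γ M β → ∃ s : ℕ → Ty, α.subst s = β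

mutual
/-- Linear `β`-normal `η`-long terms that consist of a variable applied to arguments. -/
inductive Neutral : Multiset (ℕ × STy) → Lam 0 → STy → Prop
  | var (x : ℕ) (a : STy) : Neutral {(x, a)} (.fvar x) a
  | app {Γ Δ : Multiset (ℕ × STy)} {M N : Lam 0} {a b : STy} :
      Neutral Γ M (.arr a b) → Long Δ N a →
      (∀ p ∈ Γ, ∀ q ∈ Δ, p.1 ≠ q.1) → Neutral (Γ + Δ) (.app M N) b
/-- Linear `β`-normal `η`-long terms of a given Church type. -/
inductive Long : Multiset (ℕ × STy) → Lam 0 → STy → Prop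
  | base {Γ : Multiset (ℕ × STy)} {M : Lam 0} : Neutral Γ M .σ → Long Γ M .σ
  | lam {Γ : Multiset (ℕ × STy)} {M : Lam 0} {x : ℕ} {a b : STy} :
      Long ((x, a) ::ₘ Γ) M b → (∀ p ∈ Γ, p.1 ≠ x) →
      Long Γ (Lam.lambda x M) (.arr a b)
end

/-! ### Formulas of hybrid type-logical grammar -/

/-- Simple atomic formulas denote strings; a complex atomic formula denotes objects of the
Church type assigned to it. -/
structure Signature : Type (u + 1) where
  /-- simple atomic formulas -/
  Simple : Type u
  /-- complex atomic formulas -/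
  Complex : Type u
  /-- Church types of the complex atomic formulas -/
  ctype : Complex → STy

/-- Lambek formulas: `slash A B` is `A / B` and `backslash B A` is `B \ A`. -/
inductive Lambek (Sg : Signature)
  | atom (p : Sg.Simple)
  | slash (A B : Lambek Sg)
  | backslash (B A : Lambek Sg)

/-- Hybrid formulas: complex atoms, Lambek formulas, and `bar A B`, which is `A | B`. -/
inductive HForm (Sg : Signature)
  | cplx (p : Sg.Complex)
  | lbk (F : Lambek Sg)
  | bar (A B : HForm Sg)

/-- The Church type of the string terms of a formula. -/
def HForm.type {Sg : Signature} : HForm Sg → STy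
  | cplx p => Sg.ctype p
  | lbk _ => .str
  | bar A B => .arr B.type A.type

/-! ### First-order multiplicative intuitionistic linear logic -/

/-- First-order terms with `k` free de Bruijn indices: variables and constants. -/
inductive Trm (k : ℕ)
  | bvar (i : Fin k)
  | pos (p : Pos)

/-- The term in the scope of one more quantifier. -/
def Trm.shift {k : ℕ} : Trm k → Trm (k + 1)
  | bvar i => bvar i.succ
  | pos p => pos p

/-- Formulas with `k` free de Bruijn indices; a predicate symbol is an atomic formula of the
hybrid grammar together with an arity.  Formulas are identified up to renaming of bound
variables; `MForm Sg 0` is the type of formulas proper. -/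
inductive MForm (Sg : Signature) : ℕ → Type _
  | atom {k : ℕ} (p : Sg.Simple ⊕ Sg.Complex) (ts : List (Trm k)) : MForm Sg k
  | imp {k : ℕ} (A B : MForm Sg k) : MForm Sg k
  | all {k : ℕ} (A : MForm Sg (k + 1)) : MForm Sg k

namespace MForm

variable {Sg : Signature}

/-- Simultaneous capture-avoiding substitution for indices (`b`) and for variables and
constants (`f`). -/
def bind : {k m : ℕ} → (Fin k → Trm m) → (Pos → Trm m) → MForm Sg k → MForm Sg m
  | _, _, b, f, atom p ts =>
      atom p (ts.map fun t => match t with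
        | .bvar i => b i
        | .pos q => f q)
  | _, _, b, f, imp A B => imp (bind b f A) (bind b f B)
  | _, _, b, f, all A =>
      all (bind (Fin.cases (.bvar 0) fun i => (b i).shift) (fun q => (f q).shift) A)

/-- `A[x := t]` for the body `A` of `∀x. A`. -/
def inst (A : MForm Sg 1) (t : Pos) : MForm Sg 0 := bind (fun _ => .pos t) .pos A

/-- `∀x. A` for a variable `x`. -/
def forallVar (x : ℕ) (A : MForm Sg 0) : MForm Sg 0 :=
  all (bind Fin.elim0 (fun q => if q = .var x then .bvar 0 else .pos q) A)

/-- The list of the free variables, with repetitions. -/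
def freeVars : {k : ℕ} → MForm Sg k → List ℕ
  | _, atom _ ts => ts.filterMap fun t => match t with
      | .pos (.var v) => some v
      | _ => none
  | _, imp A B => freeVars A ++ freeVars B
  | _, all A => freeVars A

/-- The free variables of an antecedent. -/
def ctxFreeVars (Γ : Multiset (ℕ × MForm Sg 0)) : Multiset ℕ :=
  Γ.bind fun h => (h.2.freeVars : Multiset ℕ)

/-- The universal closure `Cl(A)`. -/
def closure (A : MForm Sg 0) : MForm Sg 0 := A.freeVars.dedup.foldr forallVar A

/-- The universal closure of `A` modulo `Γ`: quantification over the free variables of `A`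
that are not free in `Γ`. -/
def closureMod (Γ : Multiset (ℕ × MForm Sg 0)) (A : MForm Sg 0) : MForm Sg 0 :=
  (A.freeVars.dedup.filter fun v => v ∉ ctxFreeVars Γ).foldr forallVar A

end MForm

/-- `MILL1 Γ A t`: there is a natural deduction proof of `Γ ⊢ A` whose semantic term is `t`.
A hypothesis consists of its name and its formula; the quantifier rules are semantically
inert. -/
inductive MILL1 {Sg : Signature} : Multiset (ℕ × MForm Sg 0) → MForm Sg 0 → Lam 0 → Prop
  | ax (x : ℕ) (A : MForm Sg 0) : MILL1 {(x, A)} A (.fvar x)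
  | impE {Γ Δ : Multiset (ℕ × MForm Sg 0)} {A B : MForm Sg 0} {t u : Lam 0} :
      MILL1 Γ (.imp A B) t → MILL1 Δ A u →
      (∀ p ∈ Γ, ∀ q ∈ Δ, p.1 ≠ q.1) → MILL1 (Γ + Δ) B (.app t u)
  | impI {Γ : Multiset (ℕ × MForm Sg 0)} {A B : MForm Sg 0} {x : ℕ} {t : Lam 0} :
      MILL1 ((x, A) ::ₘ Γ) B t → (∀ p ∈ Γ, p.1 ≠ x) →
      MILL1 Γ (.imp A B) (Lam.lambda x t)
  | allE {Γ : Multiset (ℕ × MForm Sg 0)} {A : MForm Sg 1} {t : Lam 0} (p : Pos) :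
      MILL1 Γ (.all A) t → MILL1 Γ (A.inst p) t
  | allI {Γ : Multiset (ℕ × MForm Sg 0)} {A : MForm Sg 1} {t : Lam 0} (y : ℕ) :
      MILL1 Γ (A.inst (.var y)) t → y ∉ MForm.ctxFreeVars Γ → y ∉ A.freeVars →
      MILL1 Γ (.all A) t

/-! ### Hybrid type-logical grammar -/

/-- The antecedent formulas of a hybrid sequent.

* `word x n A M α` is a hypothesis `x^{n+1 → n} : A` that stems from the lexicon, for the word
  between the string positions `n` and `n + 1`; its lexical term is `λx. M`, and `α` is the
  principal type of `M`.
* `ax x α A` is a hypothesis `x^α : A` that stems from the axiom rule. -/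
inductive Hyp (Sg : Signature)
  | word (x n : ℕ) (A : HForm Sg) (M : Lam 1) (α : Ty)
  | ax (x : ℕ) (α : Ty) (A : HForm Sg)

namespace Hyp

variable {Sg : Signature}

/-- The term variable of the hypothesis. -/
def name : Hyp Sg → ℕ
  | word x _ _ _ _ => x
  | ax x _ _ => x

/-- The type of that term variable. -/
def ty : Hyp Sg → Ty
  | word _ n _ _ _ => spanTy n (n + 1)
  | ax _ α _ => α

/-- Substitution in the type of the term variable. -/
def subst (s : ℕ → Ty) : Hyp Sg → Hyp Sg
  | word x n A M α => word x n A M α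
  | ax x α A => ax x (α.subst s) A

end Hyp

/-- Substitution in an antecedent. -/
def ctxSubst {Sg : Signature} (s : ℕ → Ty) (Γ : Multiset (Hyp Sg)) : Multiset (Hyp Sg) :=
  Γ.map (Hyp.subst s)

/-- All occurrences of atomic types in the sequent with antecedent `Γ` and with the type `β` of
the succedent. -/
def seqAtoms {Sg : Signature} (Γ : Multiset (Hyp Sg)) (β : Ty) : Multiset Pos :=
  (Γ.bind fun h => (h.ty.flatten : Multiset Pos)) + (β.flatten : Multiset Pos)

/-- The two sequents have no term variables and no type variables in common. -/
def Apart {Sg : Signature} (Γ : Multiset (Hyp Sg)) (β : Ty) (Δ : Multiset (Hyp Sg)) (γ : Ty) :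
    Prop :=
  (∀ g ∈ Γ, ∀ d ∈ Δ, g.name ≠ d.name) ∧
    ∀ v : ℕ, Pos.var v ∈ seqAtoms Γ β → Pos.var v ∉ seqAtoms Δ γ

/-- The condition on the lexicon rule `x^{n+1 → n} : A ⊢ M^α : A`: `λx. M` is a `β`-normal
`η`-long linear term of the Church type given by `A`, and `⟨x^{n+1 → n}, α⟩` is a principal pair
for `M`. -/
def IsLexical {Sg : Signature} (x n : ℕ) (A : HForm Sg) (M : Lam 1) (α : Ty) : Prop :=
  Long 0 (.lam M) (.arr .str A.type) ∧
    PrincipalPair {(x, spanTy n (n + 1))} (M.inst (.fvar x)) α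

/-- `Hybrid Γ M β B t`: there is a hybrid proof of `Γ ⊢ M^β : B` whose semantic term is `t`.
In the rules `overI` and `underI`, `D` is a type variable. -/
inductive Hybrid {Sg : Signature} :
    Multiset (Hyp Sg) → Lam 0 → Ty → HForm Sg → Lam 0 → Prop
  | lex {x n : ℕ} {A : HForm Sg} {M : Lam 1} {α₀ α : Ty} :
      IsLexical x n A M α₀ → IsLexical x n A M α →
      Hybrid {.word x n A M α₀} (M.inst (.fvar x)) α A (.fvar x)
  | ax {x : ℕ} {α : Ty} {A : HForm Sg} :
      α.shape = A.type → α.IsGeneric →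
      Hybrid {.ax x α A} (A.type.etaExpand (.fvar x)) α A (.fvar x)
  | overE {Γ Δ : Multiset (Hyp Sg)} {M N t u : Lam 0} {C D E F : Ty} {A B : Lambek Sg}
      {s : ℕ → Ty} :
      Hybrid Γ M (.arr F C) (.lbk (.slash A B)) t → Hybrid Δ N (.arr E D) (.lbk B) u →
      Apart Γ (.arr F C) Δ (.arr E D) → IsMGU s F D →
      Hybrid (ctxSubst s Γ + ctxSubst s Δ) (Lam.comp M N) (.arr (E.subst s) (C.subst s))
        (.lbk A) (.app t u)
  | underE {Γ Δ : Multiset (Hyp Sg)} {M N t u : Lam 0} {C D E F : Ty} {A B : Lambek Sg}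
      {s : ℕ → Ty} :
      Hybrid Γ M (.arr F C) (.lbk B) u → Hybrid Δ N (.arr E D) (.lbk (.backslash B A)) t →
      Apart Γ (.arr F C) Δ (.arr E D) → IsMGU s F D →
      Hybrid (ctxSubst s Γ + ctxSubst s Δ) (Lam.comp M N) (.arr (E.subst s) (C.subst s))
        (.lbk A) (.app t u)
  | overI {Γ : Multiset (Hyp Sg)} {x d : ℕ} {M t : Lam 0} {C D E : Ty} {A B : Lambek Sg}
      {s : ℕ → Ty} :
      Hybrid (.ax x (.arr D C) (.lbk B) ::ₘ Γ) M (.arr D E) (.lbk A) t →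
      (∀ g ∈ Γ, g.name ≠ x) → D = .atom (.var d) → IsMGU s C D →
      Hybrid (ctxSubst s Γ) (.app (Lam.lambda x M) Lam.idTerm)
        (.arr (C.subst s) (E.subst s)) (.lbk (.slash A B)) (Lam.lambda x t)
  | underI {Γ : Multiset (Hyp Sg)} {x d : ℕ} {M t : Lam 0} {C D E : Ty} {A B : Lambek Sg}
      {s : ℕ → Ty} :
      Hybrid (.ax x (.arr C D) (.lbk B) ::ₘ Γ) M (.arr E D) (.lbk A) t →
      (∀ g ∈ Γ, g.name ≠ x) → D = .atom (.var d) → IsMGU s C D →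
      Hybrid (ctxSubst s Γ) (.app (Lam.lambda x M) Lam.idTerm)
        (.arr (E.subst s) (C.subst s)) (.lbk (.backslash B A)) (Lam.lambda x t)
  | barE {Γ Δ : Multiset (Hyp Sg)} {M N t u : Lam 0} {α β γ : Ty} {A B : HForm Sg}
      {s : ℕ → Ty} :
      Hybrid Γ M (.arr β α) (.bar A B) t → Hybrid Δ N γ B u →
      Apart Γ (.arr β α) Δ γ → IsMGU s β γ →
      Hybrid (ctxSubst s Γ + ctxSubst s Δ) (.app M N) (α.subst s) A (.app t u)
  | barI {Γ : Multiset (Hyp Sg)} {x : ℕ} {M t : Lam 0} {α β : Ty} {A B : HForm Sg} :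
      Hybrid (.ax x β B ::ₘ Γ) M α A t → (∀ g ∈ Γ, g.name ≠ x) →
      Hybrid Γ (Lam.lambda x M) (.arr β α) (.bar A B) (Lam.lambda x t)

/-! ### The translation -/

/-- The translation `‖F‖^{[C,D]}` of Lambek formulas. -/
def Lambek.transl {Sg : Signature} : Lambek Sg → {k : ℕ} → Trm k → Trm k → MForm Sg k
  | atom p, _, C, D => .atom (.inl p) [C, D]
  | slash A B, _, C, D =>
      .all (.imp (B.transl D.shift (.bvar 0)) (A.transl C.shift (.bvar 0)))
  | backslash B A, _, C, D =>
      .all (.imp (B.transl (.bvar 0) C.shift) (A.transl (.bvar 0) D.shift))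

/-- The translation `‖A‖^L`, for a list `L` of the length `A.type.length`.  In the clause for
`A | B`, the list `f(β → α) = f(α) ++ f(β)` is split into `f(α)` and `f(β)`. -/
def HForm.transl {Sg : Signature} : HForm Sg → List Pos → MForm Sg 0
  | cplx p, L => .atom (.inr p) (L.map .pos)
  | lbk F, L => F.transl (.pos (L.getD 0 (.const 0))) (.pos (L.getD 1 (.const 0)))
  | bar A B, L =>
      .imp (B.transl (L.drop A.type.length)) (A.transl (L.take A.type.length))

/-- The translation of an antecedent formula: closed for words, open for other hypotheses. -/
def Hyp.transl {Sg : Signature} : Hyp Sg → ℕ × MForm Sg 0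
  | word x _ A _ α => (x, (A.transl α.flatten).closure)
  | ax x α A => (x, A.transl α.flatten)

/-- The translation of an antecedent. -/
def translCtx {Sg : Signature} (Γ : Multiset (Hyp Sg)) : Multiset (ℕ × MForm Sg 0) :=
  Γ.map Hyp.transl

/-- The translation of the succedent `B`, of type `β`, of a sequent with antecedent `Γ`. -/
def translGoal {Sg : Signature} (Γ : Multiset (Hyp Sg)) (β : Ty) (B : HForm Sg) : MForm Sg 0 :=
  (B.transl β.flatten).closureMod (translCtx Γ)

/-- Every atomic type that occurs in the sequent occurs exactly twice. -/
def Balanced {Sg : Signature} (Γ : Multiset (Hyp Sg)) (β : Ty) : Prop :=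
  ∀ p ∈ seqAtoms Γ β, (seqAtoms Γ β).count p = 2

/-- The (term-free parts of) sequents `x₁^{α₁} : A₁, …, xₙ^{αₙ} : Aₙ ⊢ B` with succedent type
`β` of hybrid type-logical grammar: the term variables are distinct, words come with lexical
entries, types fit their formulas, the sequent is balanced, and its type constants are string
positions of its words. -/
structure IsSequent {Sg : Signature} (Γ : Multiset (Hyp Sg)) (β : Ty) (B : HForm Sg) : Prop where
  names_nodup : (Γ.map Hyp.name).Nodup
  word_lexical : ∀ x n A M α, Hyp.word x n A M α ∈ Γ → IsLexical x n A M α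
  ax_shape : ∀ x α A, Hyp.ax x α A ∈ Γ → α.shape = A.type
  goal_shape : β.shape = B.type
  balanced : Balanced Γ β
  const_word : ∀ c, Pos.const c ∈ seqAtoms Γ β →
    ∃ x n A M α, Hyp.word x n A M α ∈ Γ ∧ (c = n ∨ c = n + 1)

/-- The antecedent `x₁^{1 → 0} : A₁, …, xₙ^{n → n-1} : Aₙ` of a sentence, where `λxᵢ. Mᵢ` is the
lexical term, with principal type `αᵢ`, of the `i`-th word. -/
def sentence {Sg : Signature} {n : ℕ} (x : Fin n → ℕ) (A : Fin n → HForm Sg)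
    (M : Fin n → Lam 1) (α : Fin n → Ty) : Multiset (Hyp Sg) :=
  Finset.univ.val.map fun i => Hyp.word (x i) i (A i) (M i) (α i)

end HTLG

open HTLG

-- From hybrid proofs to MILL1 the argument is an induction on derivations, `Hybrid.sound`. It rests
-- on two invariants of all derivable sequents (`Hybrid.regular`): types have the form of their
-- Church types, and a type variable occurs twice or not at all. By the first, most general unifiers
-- send type variables to atomic types, so they act on translations as first-order substitutions,
-- under which MILL1 is closed. By the second, the variable discharged by `/I` or `\I` occurs
-- nowhere else in the premiss and can be turned into an eigenvariable. Balance survives unification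
-- because solving `v = b` trades the one remaining occurrence of `v` for `b`
-- (`VarBalanced.map_mostGeneral`). For the lexicon rule, `Long.exists_linkedTyping` gives an η-long
-- term a typing whose atoms pair off. The principal type maps onto it, which bounds its form and
-- its counts; a polarity argument makes the counts even.
--
-- The converse uses no normalization. MILL1 is interpreted in a Kripke model (`Forces`) whose
-- worlds are hybrid antecedents, and in which an atom holds of a term if the corresponding sequent
-- is an instance of a derivable one. In the truth lemma `HForm.hybridInstance_iff`, elimination
-- rules give one direction; fresh hypotheses and introduction rules give the other, with an η-step
-- on semantic terms. Soundness in the model (`MILL1.holds`), evaluated at the hypotheses of the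
-- sequent themselves, makes the sequent an instance of a derivable one. When the sequent is
-- well-formed, the instantiation can neither merge two atoms nor send a variable to a constant, so
-- it is a renaming (`HybridInstance.hybrid`).
--
-- The string term of a sentence is found by a logical relation: types denote βη-closed sets of
-- terms, and position `c` denotes the class of the suffix of the string that begins at `c`, applied
-- to `z` (`Hybrid.realizes`, `Hybrid.betaEta_stringTerm`).

namespace HTLG

-- Substitution calculus for lambda terms

namespace Lam

theorem ren_ren {k m n : ℕ} (r' : Fin m → Fin n) (r : Fin k → Fin m) (M : Lam k) :
    ren r' (ren r M) = ren (r' ∘ r) M := by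
  induction M generalizing m n with
  | bvar i => rfl
  | fvar x => rfl
  | app M N ihM ihN => simp only [ren, ihM, ihN]
  | lam M ih =>
    simp only [ren, ih]
    congr 2
    funext i
    refine Fin.cases ?_ (fun _ => ?_) i <;> rfl

theorem ren_eq_bind {k m : ℕ} (r : Fin k → Fin m) (M : Lam k) :
    ren r M = bind (fun i => bvar (r i)) fvar M := by
  induction M generalizing m with
  | bvar i => rfl
  | fvar x => rfl
  | app M N ihM ihN => simp only [ren, bind, ihM, ihN]
  | lam M ih =>
    simp only [ren, bind, ih]
    congr 2
    funext i
    refine Fin.cases ?_ (fun _ => ?_) i <;> rfl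

theorem bind_ren {k m n : ℕ} (b : Fin m → Lam n) (f : ℕ → Lam n) (r : Fin k → Fin m)
    (M : Lam k) : bind b f (ren r M) = bind (fun i => b (r i)) f M := by
  induction M generalizing m n with
  | bvar i => rfl
  | fvar x => rfl
  | app M N ihM ihN => simp only [ren, bind, ihM, ihN]
  | lam M ih =>
    simp only [ren, bind, ih]
    congr 2
    funext i
    refine Fin.cases ?_ (fun _ => ?_) i <;> rfl

theorem ren_weaken {k m : ℕ} (r : Fin k → Fin m) (M : Lam k) :
    ren (Fin.cases 0 fun i => (r i).succ) M.weaken = (ren r M).weaken := by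
  simp only [weaken, ren_ren]
  rfl

theorem ren_bind {k m n : ℕ} (r : Fin m → Fin n) (b : Fin k → Lam m) (f : ℕ → Lam m)
    (M : Lam k) : ren r (bind b f M) = bind (fun i => ren r (b i)) (fun x => ren r (f x)) M := by
  induction M generalizing m n with
  | bvar i => rfl
  | fvar x => rfl
  | app M N ihM ihN => simp only [ren, bind, ihM, ihN]
  | lam M ih =>
    simp only [ren, bind, ih, ren_weaken]
    congr 2
    funext i
    refine Fin.cases ?_ (fun i => ?_) i
    · rfl
    · exact ren_weaken _ _

theorem bind_weaken {k m : ℕ} (b : Fin k → Lam m) (f : ℕ → Lam m) (M : Lam k) :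
    bind (Fin.cases (bvar 0) fun i => (b i).weaken) (fun x => (f x).weaken) M.weaken =
      (bind b f M).weaken := by
  simp only [weaken, bind_ren, ren_bind]
  rfl

theorem bind_bind {k m n : ℕ} (b : Fin m → Lam n) (f : ℕ → Lam n) (b' : Fin k → Lam m)
    (f' : ℕ → Lam m) (M : Lam k) :
    bind b f (bind b' f' M) = bind (fun i => bind b f (b' i)) (fun x => bind b f (f' x)) M := by
  induction M generalizing m n with
  | bvar i => rfl
  | fvar x => rfl
  | app M N ihM ihN => simp only [bind, ihM, ihN]
  | lam M ih =>
    simp only [bind, ih, bind_weaken]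
    congr 2
    funext i
    refine Fin.cases ?_ (fun i => ?_) i
    · rfl
    · exact bind_weaken _ _ _

theorem bind_bvar_fvar {k : ℕ} (M : Lam k) : bind bvar fvar M = M := by
  induction M with
  | bvar i => rfl
  | fvar x => rfl
  | app M N ihM ihN => simp only [bind, ihM, ihN]
  | lam M ih =>
    simp only [bind]
    congr 1
    refine Eq.trans ?_ ih
    congr 1
    funext i
    refine Fin.cases ?_ (fun _ => ?_) i <;> rfl

/-- The free names of a term. -/
def fv : {k : ℕ} → Lam k → Finset ℕ
  | _, bvar _ => ∅
  | _, fvar x => {x}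
  | _, app M N => fv M ∪ fv N
  | _, lam M => fv M

theorem bind_congr {k m : ℕ} {b : Fin k → Lam m} {f g : ℕ → Lam m} {M : Lam k}
    (h : ∀ x ∈ M.fv, f x = g x) : bind b f M = bind b g M := by
  induction M generalizing m with
  | bvar i => rfl
  | fvar x => exact h x (by simp [fv])
  | app M N ihM ihN =>
    simp only [bind]
    rw [ihM fun x hx => h x (by simp [fv, hx]), ihN fun x hx => h x (by simp [fv, hx])]
  | lam M ih =>
    simp only [bind]
    rw [ih fun x hx => by rw [h x hx]]

theorem fv_ren {k m : ℕ} (r : Fin k → Fin m) (M : Lam k) : (ren r M).fv = M.fv := by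
  induction M generalizing m with
  | bvar i => rfl
  | fvar x => rfl
  | app M N ihM ihN => simp only [ren, fv, ihM, ihN]
  | lam M ih => simp only [ren, fv, ih]

theorem mem_fv_bind {k m : ℕ} {b : Fin k → Lam m} {f : ℕ → Lam m} {M : Lam k} {x : ℕ}
    (h : x ∈ (bind b f M).fv) : (∃ i, x ∈ (b i).fv) ∨ ∃ y ∈ M.fv, x ∈ (f y).fv := by
  induction M generalizing m with
  | bvar i => exact .inl ⟨i, h⟩
  | fvar y => exact .inr ⟨y, by simp [fv], h⟩
  | app M N ihM ihN =>
    simp only [bind, fv, Finset.mem_union] at h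
    rcases h with h | h
    · rcases ihM h with h | ⟨y, hy, h⟩
      · exact .inl h
      · exact .inr ⟨y, by simp [fv, hy], h⟩
    · rcases ihN h with h | ⟨y, hy, h⟩
      · exact .inl h
      · exact .inr ⟨y, by simp [fv, hy], h⟩
  | lam M ih =>
    simp only [bind, fv] at h
    rcases ih h with ⟨i, hi⟩ | ⟨y, hy, h⟩
    · revert hi
      refine Fin.cases ?_ (fun i => ?_) i
      · simp [fv]
      · intro hi
        exact .inl ⟨i, by simpa [weaken, fv_ren] using hi⟩
    · exact .inr ⟨y, hy, by simpa [weaken, fv_ren] using h⟩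

/-- Simultaneous substitution for the names of a term without free indices. -/
def sub (u : ℕ → Lam 0) (M : Lam 0) : Lam 0 := bind Fin.elim0 u M

theorem sub_congr {u v : ℕ → Lam 0} {M : Lam 0} (h : ∀ x ∈ M.fv, u x = v x) :
    sub u M = sub v M := bind_congr h

theorem sub_fvar (M : Lam 0) : sub fvar M = M := by
  conv_rhs => rw [← bind_bvar_fvar M]
  exact congrArg (fun b => bind b fvar M) (funext fun i => i.elim0)

theorem sub_sub (u v : ℕ → Lam 0) (M : Lam 0) :
    sub u (sub v M) = sub (fun x => sub u (v x)) M := by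
  unfold sub
  rw [bind_bind]
  exact congrArg (fun b => bind b _ M) (funext fun i => i.elim0)

/-- The body of `lambda x M`. -/
def close (x : ℕ) (M : Lam 0) : Lam 1 :=
  bind Fin.elim0 (fun y => if y = x then bvar 0 else fvar y) M

theorem close_inst (x : ℕ) (M N : Lam 0) :
    (close x M).inst N = sub (Function.update fvar x N) M := by
  unfold close inst sub
  rw [bind_bind]
  congr 1
  · exact funext fun i => i.elim0
  · funext y
    by_cases h : y = x
    · subst h; simp [bind]
    · simp [h, bind]

theorem close_inst_self (x : ℕ) (M : Lam 0) : (close x M).inst (fvar x) = M := by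
  rw [close_inst, Function.update_eq_self_iff.2 rfl, sub_fvar]

theorem weaken_eq_bind (M : Lam 0) : M.weaken = bind Fin.elim0 fvar M := by
  rw [weaken, ren_eq_bind]
  exact congrArg (fun b => bind b _ M) (funext fun i => i.elim0)

theorem close_of_notMem {x : ℕ} {M : Lam 0} (h : x ∉ M.fv) : close x M = M.weaken := by
  rw [weaken_eq_bind]
  refine bind_congr fun y hy => ?_
  rw [if_neg]
  rintro rfl
  exact h hy

theorem lambda_app_fvar {x : ℕ} {M : Lam 0} (h : x ∉ M.fv) :
    lambda x (app M (fvar x)) = lam (app M.weaken (bvar 0)) := by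
  change lam (app (close x M) (if x = x then bvar 0 else fvar x)) = _
  rw [close_of_notMem h, if_pos rfl]

theorem weaken_inst {k : ℕ} (M N : Lam k) : M.weaken.inst N = M := by
  unfold inst weaken
  rw [bind_ren]
  exact bind_bvar_fvar M

theorem fv_lambda (x : ℕ) (M : Lam 0) : (lambda x M).fv ⊆ M.fv.erase x := by
  intro y hy
  rcases mem_fv_bind (k := 0) hy with ⟨i, -⟩ | ⟨z, hz, h⟩
  · exact i.elim0
  · by_cases hzx : z = x
    · simp [hzx, fv] at h
    · simp only [hzx, if_false, fv, Finset.mem_singleton] at h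
      subst h
      simp [hzx, hz]

end Lam

-- βη-equivalence and substitution

namespace BetaEta

open Lam

theorem bind {k m : ℕ} {M N : Lam k} (h : BetaEta M N) (b : Fin k → Lam m) (f : ℕ → Lam m) :
    BetaEta (M.bind b f) (N.bind b f) := by
  induction h generalizing m with
  | beta M N =>
    have e : (M.inst N).bind b f =
        (M.bind (Fin.cases (bvar 0) fun i => (b i).weaken) (fun x => (f x).weaken)).inst
          (N.bind b f) := by
      unfold inst
      rw [bind_bind, bind_bind]
      congr 1
      · funext i
        refine Fin.cases ?_ (fun i => ?_) i
        · rfl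
        · exact (weaken_inst _ _).symm
      · funext x
        exact (weaken_inst _ _).symm
    rw [e]
    exact .beta _ _
  | eta M =>
    simp only [Lam.bind, bind_weaken]
    exact .eta _
  | refl M => exact .refl _
  | symm _ ih => exact .symm (ih _ _)
  | trans _ _ ih₁ ih₂ => exact .trans (ih₁ _ _) (ih₂ _ _)
  | app _ _ ih₁ ih₂ => exact .app (ih₁ _ _) (ih₂ _ _)
  | lam _ ih => exact .lam (ih _ _)

theorem lambda {M N : Lam 0} (h : BetaEta M N) (x : ℕ) :
    BetaEta (Lam.lambda x M) (Lam.lambda x N) := .lam (h.bind _ _)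

/-- The β-step behind both semantic arguments: applying a substituted abstraction extends the
environment at `x`. No freshness is required, because substitution avoids capture. -/
theorem sub_lambda_app (u : ℕ → Lam 0) (x : ℕ) (M N : Lam 0) :
    BetaEta (.app (Lam.sub u (Lam.lambda x M)) N) (Lam.sub (Function.update u x N) M) := by
  have e : Lam.sub (Function.update u x N) M =
      ((close x M).bind (Fin.cases (bvar 0) fun i => (Fin.elim0 i : Lam 0).weaken)
        (fun y => (u y).weaken)).inst N := by
    unfold close Lam.sub inst
    rw [bind_bind, bind_bind]
    congr 1
    · exact funext fun i => i.elim0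
    · funext y
      by_cases h : y = x
      · subst h; simp [Lam.bind]
      · simp only [h, if_false, Lam.bind, Function.update_of_ne, ne_eq, not_false_eq_true]
        exact (weaken_inst _ _).symm
  rw [e]
  exact .beta _ _

theorem lambda_app_fvar {x : ℕ} {M : Lam 0} (h : x ∉ M.fv) :
    BetaEta (Lam.lambda x (.app M (.fvar x))) M := by
  rw [Lam.lambda_app_fvar h]
  exact .eta _

end BetaEta

-- Substitution calculus for first-order formulas

namespace Trm

/-- Simultaneous substitution in a first-order term. -/
def bind {k m : ℕ} (b : Fin k → Trm m) (f : Pos → Trm m) : Trm k → Trm m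
  | bvar i => b i
  | pos q => f q

theorem shift_bind {k m : ℕ} (b : Fin k → Trm m) (f : Pos → Trm m) (t : Trm k) :
    t.shift.bind (Fin.cases (.bvar 0) fun i => (b i).shift) (fun q => (f q).shift) =
      (t.bind b f).shift := by
  cases t <;> rfl

end Trm

namespace MForm

variable {Sg : Signature}

theorem bind_atom {k m : ℕ} (b : Fin k → Trm m) (f : Pos → Trm m) (p : Sg.Simple ⊕ Sg.Complex)
    (ts : List (Trm k)) : (atom p ts).bind b f = atom p (ts.map (Trm.bind b f)) := by
  simp only [bind]
  congr 2

theorem bind_bind {k m n : ℕ} (b : Fin m → Trm n) (f : Pos → Trm n) (b' : Fin k → Trm m)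
    (f' : Pos → Trm m) (A : MForm Sg k) :
    (A.bind b' f').bind b f =
      A.bind (fun i => (b' i).bind b f) (fun q => (f' q).bind b f) := by
  induction A generalizing m n with
  | atom p ts =>
    simp only [bind_atom, List.map_map]
    congr 2
    funext t
    cases t <;> rfl
  | imp A B ihA ihB => simp only [bind, ihA, ihB]
  | all A ih =>
    simp only [bind, ih, Trm.shift_bind]
    congr 2
    funext i
    refine Fin.cases ?_ (fun i => ?_) i
    · rfl
    · exact Trm.shift_bind _ _ _

theorem bind_bvar_pos {k : ℕ} (A : MForm Sg k) : A.bind .bvar .pos = A := by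
  induction A with
  | atom p ts =>
    rw [bind_atom]
    congr 1
    conv_rhs => rw [← List.map_id ts]
    congr 1
    funext t
    cases t <;> rfl
  | imp A B ihA ihB => simp only [bind, ihA, ihB]
  | all A ih =>
    simp only [bind]
    congr 1
    refine Eq.trans ?_ ih
    congr 1
    funext i
    refine Fin.cases ?_ (fun _ => ?_) i <;> rfl

theorem mem_freeVars_atom {k : ℕ} {p : Sg.Simple ⊕ Sg.Complex} {ts : List (Trm k)} {v : ℕ} :
    v ∈ (atom p ts).freeVars ↔ .pos (.var v) ∈ ts := by
  simp only [freeVars, List.mem_filterMap]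
  constructor
  · rintro ⟨t, ht, h⟩
    split at h
    · simp only [Option.some.injEq] at h
      exact h ▸ ht
    · cases h
  · intro h
    exact ⟨_, h, rfl⟩

theorem bind_congr {k m : ℕ} {b : Fin k → Trm m} {f g : Pos → Trm m} {A : MForm Sg k}
    (hc : ∀ c, f (.const c) = g (.const c)) (hv : ∀ v ∈ A.freeVars, f (.var v) = g (.var v)) :
    A.bind b f = A.bind b g := by
  induction A generalizing m with
  | atom p ts =>
    rw [bind_atom, bind_atom]
    congr 1
    refine List.map_congr_left fun t ht => ?_
    cases t with
    | bvar i => rfl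
    | pos q =>
      cases q with
      | var v => exact hv v (mem_freeVars_atom.2 ht)
      | const c => exact hc c
  | imp A B ihA ihB =>
    simp only [bind]
    rw [ihA hc fun v h => hv v (by simp [freeVars, h]),
      ihB hc fun v h => hv v (by simp [freeVars, h])]
  | all A ih =>
    simp only [bind]
    exact congrArg all (ih (fun c => congrArg Trm.shift (hc c))
      fun v h => congrArg Trm.shift (hv v h))

theorem mem_freeVars_bind {k m : ℕ} {b : Fin k → Trm m} {f : Pos → Trm m} {A : MForm Sg k}
    {v : ℕ} (h : v ∈ (A.bind b f).freeVars) :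
    (∃ i, b i = .pos (.var v)) ∨ (∃ c, f (.const c) = .pos (.var v)) ∨
      ∃ w ∈ A.freeVars, f (.var w) = .pos (.var v) := by
  induction A generalizing m with
  | atom p ts =>
    rw [bind_atom, mem_freeVars_atom, List.mem_map] at h
    obtain ⟨t, ht, h⟩ := h
    cases t with
    | bvar i => exact .inl ⟨i, h⟩
    | pos q =>
      cases q with
      | var w => exact .inr (.inr ⟨w, mem_freeVars_atom.2 ht, h⟩)
      | const c => exact .inr (.inl ⟨c, h⟩)
  | imp A B ihA ihB =>
    simp only [bind, freeVars, List.mem_append] at h ⊢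
    rcases h with h | h
    · rcases ihA h with h | h | ⟨w, hw, h⟩
      exacts [.inl h, .inr (.inl h), .inr (.inr ⟨w, .inl hw, h⟩)]
    · rcases ihB h with h | h | ⟨w, hw, h⟩
      exacts [.inl h, .inr (.inl h), .inr (.inr ⟨w, .inr hw, h⟩)]
  | all A ih =>
    have key : ∀ t : Trm m, t.shift = .pos (.var v) → t = .pos (.var v) := by
      rintro (i | q) h
      · cases h
      · simpa [Trm.shift] using h
    simp only [bind, freeVars] at h ⊢
    rcases ih h with ⟨i, h⟩ | ⟨c, h⟩ | ⟨w, hw, h⟩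
    · revert h
      refine Fin.cases ?_ (fun i => ?_) i
      · intro h; cases h
      · exact fun h => .inl ⟨i, key _ h⟩
    · exact .inr (.inl ⟨c, key _ h⟩)
    · exact .inr (.inr ⟨w, hw, key _ h⟩)

/-- Simultaneous substitution of positions for positions. -/
def sub {k : ℕ} (f : Pos → Pos) (A : MForm Sg k) : MForm Sg k := A.bind .bvar fun q => .pos (f q)

theorem sub_id {k : ℕ} (A : MForm Sg k) : A.sub id = A := bind_bvar_pos A

theorem sub_congr {k : ℕ} {f g : Pos → Pos} {A : MForm Sg k}
    (hc : ∀ c, f (.const c) = g (.const c)) (hv : ∀ v ∈ A.freeVars, f (.var v) = g (.var v)) :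
    A.sub f = A.sub g :=
  bind_congr (fun c => by rw [hc]) fun v h => by rw [hv v h]

theorem sub_all {k : ℕ} (f : Pos → Pos) (A : MForm Sg (k + 1)) :
    (all A).sub f = all (A.sub f) := by
  unfold sub
  simp only [bind]
  congr 2
  funext i
  refine Fin.cases ?_ (fun _ => ?_) i <;> rfl

theorem sub_inst (f : Pos → Pos) (A : MForm Sg 1) (p : Pos) :
    (A.inst p).sub f = (A.sub f).inst (f p) := by
  unfold sub inst
  rw [bind_bind, bind_bind]
  rfl

/-- The body of `forallVar x A`. -/
def close (x : ℕ) (A : MForm Sg 0) : MForm Sg 1 :=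
  A.bind Fin.elim0 fun q => if q = .var x then .bvar 0 else .pos q

/-- An instantiation is absorbed as an update of the ambient substitution, so blocks of quantifiers
can be handled without following bound variables. -/
theorem close_sub_inst (x : ℕ) (A : MForm Sg 0) (f : Pos → Pos) (p : Pos) :
    ((A.close x).sub f).inst p = A.sub (Function.update f (.var x) p) := by
  unfold close sub inst
  rw [bind_bind, bind_bind]
  congr 1
  · exact funext fun i => i.elim0
  · funext q
    by_cases h : q = .var x
    · subst h; simp [Trm.bind]
    · simp [h, Trm.bind]

theorem notMem_freeVars_close (x : ℕ) (A : MForm Sg 0) : x ∉ (A.close x).freeVars := by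
  intro h
  rcases mem_freeVars_bind h with ⟨i, -⟩ | ⟨c, h⟩ | ⟨w, -, h⟩
  · exact i.elim0
  · simp at h
  · by_cases hw : w = x <;> simp [hw] at h

theorem mem_freeVars_close {x v : ℕ} {A : MForm Sg 0} (h : v ∈ (A.close x).freeVars) :
    v ∈ A.freeVars := by
  rcases mem_freeVars_bind h with ⟨i, -⟩ | ⟨c, h⟩ | ⟨w, hw, h⟩
  · exact i.elim0
  · simp at h
  · by_cases hx : w = x
    · simp [hx] at h
    · simp [hx] at h
      exact h ▸ hw

theorem mem_freeVars_foldr {l : List ℕ} {A : MForm Sg 0} {v : ℕ}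
    (h : v ∈ (l.foldr forallVar A).freeVars) : v ∈ A.freeVars ∧ v ∉ l := by
  induction l with
  | nil => exact ⟨h, by simp⟩
  | cons x l ih =>
    have hv := ih (mem_freeVars_close (x := x) h)
    refine ⟨hv.1, ?_⟩
    rw [List.mem_cons, not_or]
    refine ⟨?_, hv.2⟩
    rintro rfl
    exact notMem_freeVars_close _ _ h

theorem freeVars_closure (A : MForm Sg 0) (v : ℕ) : v ∉ A.closure.freeVars := fun h =>
  (mem_freeVars_foldr h).2 (List.mem_dedup.2 (mem_freeVars_foldr h).1)

/-- Substitution in an antecedent. -/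
def ctxSub (f : Pos → Pos) (Γ : Multiset (ℕ × MForm Sg 0)) : Multiset (ℕ × MForm Sg 0) :=
  Γ.map fun h => (h.1, h.2.sub f)

theorem mem_ctxFreeVars {Γ : Multiset (ℕ × MForm Sg 0)} {v : ℕ} :
    v ∈ ctxFreeVars Γ ↔ ∃ h ∈ Γ, v ∈ h.2.freeVars := by
  simp [ctxFreeVars]

theorem ctxSub_congr {f g : Pos → Pos} {Γ : Multiset (ℕ × MForm Sg 0)}
    (hc : ∀ c, f (.const c) = g (.const c))
    (hv : ∀ v ∈ ctxFreeVars Γ, f (.var v) = g (.var v)) : ctxSub f Γ = ctxSub g Γ :=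
  Multiset.map_congr rfl fun h hh => by
    rw [sub_congr hc fun v h' => hv v (mem_ctxFreeVars.2 ⟨h, hh, h'⟩)]

theorem forall_ctxSub_ne {f : Pos → Pos} {Γ : Multiset (ℕ × MForm Sg 0)} {x : ℕ}
    (h : ∀ p ∈ Γ, p.1 ≠ x) : ∀ p ∈ ctxSub f Γ, p.1 ≠ x := by
  intro p hp
  obtain ⟨q, hq, rfl⟩ := Multiset.mem_map.1 hp
  exact h q hq

end MForm

-- Substitution and universal closures in MILL1

namespace MILL1

open MForm

variable {Sg : Signature} {Γ : Multiset (ℕ × MForm Sg 0)} {A : MForm Sg 0} {t : Lam 0}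

theorem sub (h : MILL1 Γ A t) (f : Pos → Pos) : MILL1 (ctxSub f Γ) (A.sub f) t := by
  induction h generalizing f with
  | ax x A => exact .ax _ _
  | impE h₁ h₂ hd ih₁ ih₂ =>
    rw [ctxSub, Multiset.map_add]
    refine .impE (ih₁ f) (ih₂ f) ?_
    intro p hp
    obtain ⟨q, hq, rfl⟩ := Multiset.mem_map.1 hp
    exact fun r hr => (forall_ctxSub_ne (fun r hr => (hd q hq r hr).symm) r hr).symm
  | impI h hx ih =>
    refine .impI ?_ (forall_ctxSub_ne hx)
    have := ih f
    rwa [ctxSub, Multiset.map_cons] at this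
  | allE p h ih =>
    have := ih f
    rw [sub_all] at this
    rw [sub_inst]
    exact .allE _ this
  | @allI Γ A t y h hΓ hA ih =>
    -- The image of `f` may contain the eigenvariable `y`; hence it is renamed to a fresh `z` first.
    obtain ⟨z, hz⟩ := Infinite.exists_notMem_finset
      ((ctxFreeVars (ctxSub f Γ)).toFinset ∪ (A.sub f).freeVars.toFinset)
    simp only [Finset.mem_union, Multiset.mem_toFinset, List.mem_toFinset, not_or] at hz
    rw [sub_all]
    refine .allI z ?_ hz.1 hz.2
    have := ih (Function.update f (.var y) (.var z))
    rw [sub_inst, Function.update_self] at this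
    rw [ctxSub_congr (g := f), sub_congr (g := f)] at this
    · exact this
    · intro c; simp
    · intro v hv
      rw [Function.update_of_ne]
      rintro ⟨⟩
      exact hA hv
    · intro c; simp
    · intro v hv
      rw [Function.update_of_ne]
      rintro ⟨⟩
      exact hΓ hv

/-- Each quantifier that is stripped updates `f` to the value of `g`; when none is left, `f` and `g`
coincide. -/
theorem foldr_elim {l : List ℕ} {f : Pos → Pos} (h : MILL1 Γ ((l.foldr forallVar A).sub f) t)
    (g : Pos → Pos) (hg : ∀ q, (∀ x ∈ l, q ≠ .var x) → f q = g q) : MILL1 Γ (A.sub g) t := by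
  induction l generalizing f with
  | nil =>
    have : f = g := funext fun q => hg q (by simp)
    exact this ▸ h
  | cons x l ih =>
    have h' : MILL1 Γ (.all (((l.foldr forallVar A).close x).sub f)) t := by
      rw [← sub_all]
      exact h
    have := MILL1.allE (g (.var x)) h'
    rw [close_sub_inst] at this
    refine ih this fun q hq => ?_
    by_cases hx : q = .var x
    · rw [hx, Function.update_self]
    · rw [Function.update_of_ne hx]
      refine hg q ?_
      rintro y hy
      rcases List.mem_cons.1 hy with rfl | hy
      · exact hx
      · exact hq y hy

theorem foldr_intro {l : List ℕ} (h : MILL1 Γ A t) (hl : ∀ x ∈ l, x ∉ ctxFreeVars Γ) :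
    MILL1 Γ (l.foldr forallVar A) t := by
  induction l with
  | nil => exact h
  | cons x l ih =>
    refine .allI x ?_ (hl x (by simp)) (notMem_freeVars_close _ _)
    have := close_sub_inst x (l.foldr forallVar A) id (.var x)
    rw [sub_id, show Function.update id (Pos.var x) (Pos.var x) = id from
      Function.update_eq_self _ _, sub_id, close] at this
    rw [this]
    exact ih fun y hy => hl y (by simp [hy])

theorem closure_elim (h : MILL1 Γ A.closure t) (g : Pos → Pos)
    (hg : ∀ c, g (.const c) = .const c) : MILL1 Γ (A.sub g) t := by
  have h' : MILL1 Γ (A.closure.sub id) t := by rwa [sub_id]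
  -- `foldr_elim` demands agreement with `id` off the quantified variables, so `g` is cut down to
  -- the free variables of `A`. This is why `g` must fix constants.
  have := foldr_elim h' (fun q => match q with
    | .const c => .const c
    | .var v => if v ∈ A.freeVars then g (.var v) else .var v) ?_
  · rwa [sub_congr (g := g)] at this
    · exact fun c => (hg c).symm
    · intro v hv
      simp [hv]
  · rintro (v | c) hq
    · have : v ∉ A.freeVars := fun hv => hq v (List.mem_dedup.2 hv) rfl
      simp [this]
    · rfl

/-- The quantified variables are not free in `Γ`, so they are generalized freely and instantiated by
themselves. From here on the closure of the succedent can be ignored. -/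
theorem closureMod_iff : MILL1 Γ (A.closureMod Γ) t ↔ MILL1 Γ A t := by
  constructor
  · intro h
    have h' : MILL1 Γ ((A.closureMod Γ).sub id) t := by rwa [sub_id]
    have := foldr_elim h' id fun _ _ => rfl
    rwa [sub_id] at this
  · intro h
    refine foldr_intro h fun x hx => ?_
    have := (List.mem_filter.1 hx).2
    simpa using this

end MILL1

-- The translation commutes with substitution

section Translation

variable {Sg : Signature}

theorem Lambek.transl_bind (F : Lambek Sg) {k m : ℕ} (b : Fin k → Trm m) (f : Pos → Trm m)
    (C D : Trm k) : (F.transl C D).bind b f = F.transl (C.bind b f) (D.bind b f) := by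
  induction F generalizing k m with
  | atom p => rw [transl, MForm.bind_atom]; rfl
  | slash A B ihA ihB =>
    simp only [transl, MForm.bind, ihA, ihB, Trm.shift_bind]
    rfl
  | backslash B A ihB ihA =>
    simp only [transl, MForm.bind, ihA, ihB, Trm.shift_bind]
    rfl

/-- The length condition keeps the default values of `getD` out of play, which `f` need not fix. -/
theorem HForm.transl_sub (A : HForm Sg) (f : Pos → Pos) (L : List Pos)
    (hL : L.length = A.type.length) : (A.transl L).sub f = A.transl (L.map f) := by
  induction A generalizing L with
  | cplx p =>
    rw [MForm.sub, transl, MForm.bind_atom, transl, List.map_map, List.map_map]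
    rfl
  | lbk F =>
    simp only [HForm.type, STy.str, STy.length] at hL
    rw [MForm.sub, transl, Lambek.transl_bind, transl]
    match L, hL with
    | [C, D], _ => rfl
  | bar A B ihA ihB =>
    simp only [HForm.type, STy.length] at hL
    simp only [MForm.sub, transl, MForm.bind] at ihA ihB ⊢
    rw [ihA _ (by simp [hL]), ihB _ (by simp [hL]), List.map_take, List.map_drop]

end Translation

-- Substitutions of atomic types

/-- Substitution of atomic types for type variables in an atomic type. -/
def Pos.subst (f : ℕ → Pos) : Pos → Pos
  | var v => f v
  | const c => const c

theorem Pos.subst_subst (f g : ℕ → Pos) (p : Pos) :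
    (p.subst f).subst g = p.subst fun v => (f v).subst g := by cases p <;> rfl

/-- A substitution of atomic types for type variables, as a substitution of types. -/
def atomSub (f : ℕ → Pos) (v : ℕ) : Ty := .atom (f v)

namespace Ty

theorem atom_subst (f : ℕ → Pos) (p : Pos) : (atom p).subst (atomSub f) = atom (p.subst f) := by
  cases p <;> rfl

theorem shape_subst (f : ℕ → Pos) (α : Ty) : (α.subst (atomSub f)).shape = α.shape := by
  induction α with
  | atom p => rw [atom_subst]; rfl
  | arr β α ihβ ihα => simp only [subst, shape, ihβ, ihα]

theorem flatten_subst (f : ℕ → Pos) (α : Ty) :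
    (α.subst (atomSub f)).flatten = α.flatten.map (Pos.subst f) := by
  induction α with
  | atom p => rw [atom_subst]; rfl
  | arr β α ihβ ihα => simp only [subst, flatten, ihβ, ihα, List.map_append]

theorem length_flatten (α : Ty) : α.flatten.length = α.shape.length := by
  induction α with
  | atom p => rfl
  | arr β α ihβ ihα => simp only [flatten, shape, STy.length, List.length_append, ihβ, ihα]

/-- The shape determines how the list of leaves is to be parsed. -/
theorem ext_flatten {α β : Ty} (hs : α.shape = β.shape) (hf : α.flatten = β.flatten) :
    α = β := by
  induction α generalizing β with
  | atom p =>
    cases β with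
    | atom q => simpa [flatten] using hf
    | arr _ _ => cases hs
  | arr α₁ α₂ ih₁ ih₂ =>
    cases β with
    | atom q => cases hs
    | arr β₁ β₂ =>
      simp only [shape, STy.arr.injEq] at hs
      obtain ⟨h₂, h₁⟩ := List.append_inj (by simpa only [flatten] using hf)
        (by rw [length_flatten, length_flatten, hs.2])
      rw [ih₁ hs.1 h₁, ih₂ hs.2 h₂]

theorem subst_subst (s u : ℕ → Ty) (α : Ty) :
    (α.subst s).subst u = α.subst fun v => (s v).subst u := by
  induction α with
  | atom p => cases p <;> rfl
  | arr β α ihβ ihα => simp only [subst, ihβ, ihα]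

theorem subst_congr {s u : ℕ → Ty} {α : Ty} (h : ∀ v, .var v ∈ α.flatten → s v = u v) :
    α.subst s = α.subst u := by
  induction α with
  | atom p =>
    cases p with
    | var v => exact h v (by simp [flatten])
    | const c => rfl
  | arr β α ihβ ihα =>
    simp only [subst]
    rw [ihβ fun v hv => h v (by simp [flatten, hv]), ihα fun v hv => h v (by simp [flatten, hv])]

theorem subst_atomSub_atomSub (f g : ℕ → Pos) (α : Ty) :
    (α.subst (atomSub f)).subst (atomSub g) = α.subst (atomSub fun v => (f v).subst g) := by
  rw [subst_subst]
  congr 1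
  funext v
  exact atom_subst _ _

theorem eq_arr_of_subst {f : ℕ → Pos} {τ β α : Ty} (h : τ.subst (atomSub f) = arr β α) :
    ∃ β₀ α₀, τ = arr β₀ α₀ ∧ β₀.subst (atomSub f) = β ∧ α₀.subst (atomSub f) = α := by
  cases τ with
  | atom p => rw [atom_subst] at h; cases h
  | arr β₀ α₀ =>
    simp only [subst, arr.injEq] at h
    exact ⟨_, _, rfl, h⟩

theorem eq_atom_of_shape {τ : Ty} (h : τ.shape = .σ) : ∃ p, τ = atom p := by
  cases τ with
  | atom p => exact ⟨p, rfl⟩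
  | arr _ _ => cases h

theorem eq_arr_of_shape {τ : Ty} {a b : STy} (h : τ.shape = .arr a b) :
    ∃ β α, τ = arr β α ∧ β.shape = a ∧ α.shape = b := by
  cases τ with
  | atom p => cases h
  | arr β α =>
    simp only [shape, STy.arr.injEq] at h
    exact ⟨_, _, rfl, h⟩

theorem eq_of_shape_str {τ : Ty} (h : τ.shape = .str) : ∃ D C, τ = arr (atom D) (atom C) := by
  obtain ⟨β, α, rfl, hβ, hα⟩ := eq_arr_of_shape h
  obtain ⟨D, rfl⟩ := eq_atom_of_shape hβ
  obtain ⟨C, rfl⟩ := eq_atom_of_shape hα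
  exact ⟨D, C, rfl⟩

/-- The first leaf of a type. -/
def firstLeaf : Ty → Pos
  | atom p => p
  | arr _ α => α.firstLeaf

end Ty

-- Unification of types of equal shape

/-- The substitution solves a list of equations between atomic types. -/
def Unifies (s : ℕ → Ty) (E : List (Pos × Pos)) : Prop :=
  ∀ e ∈ E, (Ty.atom e.1).subst s = (Ty.atom e.2).subst s

theorem unifies_cons {s : ℕ → Ty} {a b : Pos} {E : List (Pos × Pos)} :
    Unifies s ((a, b) :: E) ↔ (Ty.atom a).subst s = (Ty.atom b).subst s ∧ Unifies s E := by
  simp [Unifies]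

theorem unifies_iff {α β : Ty} (h : α.shape = β.shape) (s : ℕ → Ty) :
    α.subst s = β.subst s ↔ Unifies s (α.flatten.zip β.flatten) := by
  induction α generalizing β with
  | atom p =>
    obtain ⟨q, rfl⟩ := Ty.eq_atom_of_shape h.symm
    simp [Unifies, Ty.flatten]
  | arr α₁ α₂ ih₁ ih₂ =>
    obtain ⟨β₁, β₂, rfl, h₁, h₂⟩ := Ty.eq_arr_of_shape h.symm
    rw [Ty.flatten, Ty.flatten, List.zip_append
      (by rw [Ty.length_flatten, Ty.length_flatten, h₂])]
    simp only [Ty.subst, Ty.arr.injEq, ih₁ h₁.symm, ih₂ h₂.symm]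
    simp only [Unifies, List.mem_append]
    constructor
    · rintro ⟨h₁, h₂⟩ e (he | he)
      exacts [h₂ e he, h₁ e he]
    · exact fun h => ⟨fun e he => h e (.inr he), fun e he => h e (.inl he)⟩

/-- Replacement of one type variable by an atomic type. -/
def Pos.elim (v : ℕ) (b : Pos) : Pos → Pos := Pos.subst (Function.update Pos.var v b)

theorem Pos.elim_self (v : ℕ) (b : Pos) : Pos.elim v b (.var v) = b := by
  simp [Pos.elim, Pos.subst]

theorem Pos.elim_of_ne {v : ℕ} {b p : Pos} (h : p ≠ .var v) : Pos.elim v b p = p := by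
  cases p with
  | var w =>
    have : w ≠ v := fun e => h (by rw [e])
    simp [Pos.elim, Pos.subst, this]
  | const c => rfl

theorem Ty.subst_elim {s : ℕ → Ty} {v : ℕ} {b : Pos} (h : s v = (atom b).subst s) (p : Pos) :
    (atom (Pos.elim v b p)).subst s = (atom p).subst s := by
  by_cases hp : p = .var v
  · subst hp
    rw [Pos.elim_self, ← h]
    rfl
  · rw [Pos.elim_of_ne hp]

theorem unifies_elim {s : ℕ → Ty} {v : ℕ} {b : Pos} (h : s v = (Ty.atom b).subst s)
    {E : List (Pos × Pos)} :
    Unifies s (E.map (Prod.map (Pos.elim v b) (Pos.elim v b))) ↔ Unifies s E := by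
  simp only [Unifies, List.mem_map, forall_exists_index, and_imp, forall_apply_eq_imp_iff₂,
    Prod.map_fst, Prod.map_snd, Ty.subst_elim h]

/-- Elimination of variables, one equation at a time. Each step replaces a variable by an atom, so
the solution is atomic, although it is compared with arbitrary unifiers `t`. -/
theorem exists_mostGeneral (n : ℕ) (E : List (Pos × Pos)) (hn : E.length = n)
    (hE : ∃ s, Unifies s E) :
    ∃ f : ℕ → Pos, Unifies (atomSub f) E ∧
      ∀ t, Unifies t E → ∃ u : ℕ → Ty, ∀ v, t v = (atomSub f v).subst u := by
  induction n generalizing E with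
  | zero =>
    obtain rfl := List.length_eq_zero_iff.1 hn
    exact ⟨Pos.var, by simp [Unifies], fun t _ => ⟨t, fun v => rfl⟩⟩
  | succ n ih =>
    obtain ⟨⟨a, b⟩, E, rfl⟩ := List.exists_cons_of_length_eq_add_one hn
    simp only [List.length_cons, Nat.add_right_cancel_iff] at hn
    by_cases hab : a = b
    · subst hab
      simp only [unifies_cons, true_and] at hE ⊢
      exact ih E hn hE
    -- The case of an equation with a variable on one side, stated once for both orientations. The
    -- solution found is elimination of `v` followed by the solution of the reduced system.
    have key : ∀ (v : ℕ) (b : Pos), .var v ≠ b →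
        (∃ s, s v = (Ty.atom b).subst s ∧ Unifies s E) →
        ∃ f : ℕ → Pos, (atomSub f v = (Ty.atom b).subst (atomSub f) ∧ Unifies (atomSub f) E) ∧
          ∀ t, t v = (Ty.atom b).subst t ∧ Unifies t E →
            ∃ u : ℕ → Ty, ∀ v, t v = (atomSub f v).subst u := by
      rintro v b hvb ⟨s, hs, hsE⟩
      obtain ⟨f, hf, hmg⟩ := ih (E.map (Prod.map (Pos.elim v b) (Pos.elim v b)))
        (by simpa using hn) ⟨s, (unifies_elim hs).2 hsE⟩
      have hg : ∀ p : Pos, (Ty.atom p).subst (atomSub fun w => (Pos.elim v b (.var w)).subst f) =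
          (Ty.atom (Pos.elim v b p)).subst (atomSub f) := by
        rintro (w | c)
        · exact (Ty.atom_subst _ _).symm
        · rfl
      refine ⟨fun w => (Pos.elim v b (.var w)).subst f, ⟨?_, ?_⟩, ?_⟩
      · rw [hg, Pos.elim_of_ne hvb.symm, Ty.atom_subst]
        simp only [atomSub, Pos.elim_self]
      · intro e he
        rw [hg, hg]
        exact hf _ (List.mem_map.2 ⟨e, he, rfl⟩)
      · rintro t ⟨ht, htE⟩
        obtain ⟨u, hu⟩ := hmg t ((unifies_elim ht).2 htE)
        refine ⟨u, fun w => ?_⟩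
        have h₁ : t w = (Ty.atom (Pos.elim v b (.var w))).subst t :=
          (Ty.subst_elim ht (.var w)).symm
        have h₂ := hg (.var w)
        change atomSub _ w = _ at h₂
        rw [h₂, Ty.subst_subst, h₁]
        exact congrArg (fun s => Ty.subst s _) (funext hu)
    simp only [unifies_cons] at hE ⊢
    cases a with
    | var v => exact key v b hab hE
    | const c =>
      cases b with
      | var w =>
        simp only [eq_comm (a := (Ty.atom (.const c)).subst _)] at hE ⊢
        exact key w _ (Ne.symm hab) hE
      | const c' =>
        obtain ⟨s, hs, -⟩ := hE
        simp only [Ty.subst, Ty.atom.injEq] at hs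
        exact absurd hs hab

-- Balance is preserved by most general unifiers

/-- Every type variable that occurs, occurs exactly twice. -/
def VarBalanced (X : Multiset Pos) : Prop := ∀ v, X.count (.var v) = 0 ∨ X.count (.var v) = 2

/-- A left inverse makes the substitution injective on the atoms of `X`, so it preserves their
multiplicities. -/
theorem VarBalanced.map_of_leftInverse {X : Multiset Pos} (hX : VarBalanced X) {f u : ℕ → Pos}
    (hu : ∀ v, .var v ∈ X → .var v = (f v).subst u) : VarBalanced (X.map (Pos.subst f)) := by
  have hinv : ∀ p ∈ X, (p.subst f).subst u = p := by
    rintro (v | c) hp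
    · exact (hu v hp).symm
    · rfl
  intro w
  by_cases hw : .var w ∈ X.map (Pos.subst f)
  · obtain ⟨p, hp, hpw⟩ := Multiset.mem_map.1 hw
    rw [← hpw, Multiset.count_map_eq_count _ _ ?_ _ hp]
    · cases p with
      | var v => exact hX v
      | const c => cases hpw
    · intro p hp q hq hpq
      rw [← hinv p hp, ← hinv q hq, hpq]
  · exact .inl (Multiset.count_eq_zero.2 hw)

/-- The two sides of a list of equations. -/
def eqAtoms (E : List (Pos × Pos)) : Multiset Pos :=
  (E.map Prod.fst : Multiset Pos) + (E.map Prod.snd : Multiset Pos)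

theorem eqAtoms_cons (a b : Pos) (E : List (Pos × Pos)) :
    eqAtoms ((a, b) :: E) = a ::ₘ b ::ₘ eqAtoms E := by
  simp only [eqAtoms, List.map_cons, ← Multiset.cons_coe, Multiset.cons_add, Multiset.add_cons]
  exact Multiset.cons_swap _ _ _

theorem unifies_atomSub {f : ℕ → Pos} {E : List (Pos × Pos)} :
    Unifies (atomSub f) E ↔ ∀ e ∈ E, e.1.subst f = e.2.subst f := by
  simp only [Unifies, Ty.atom_subst, Ty.atom.injEq]

/-- Solving `v = b` uses up one occurrence of `v` and one of `b`, and puts `b` in place of the other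
`v`, so the reduced system is balanced again. Without equations, a most general solution is
invertible on the atoms that occur. -/
theorem VarBalanced.map_mostGeneral (n : ℕ) (E : List (Pos × Pos)) (hn : E.length = n)
    (X : Multiset Pos) (hX : VarBalanced (X + eqAtoms E)) (f : ℕ → Pos)
    (hf : ∀ e ∈ E, e.1.subst f = e.2.subst f)
    (hmg : ∀ t : ℕ → Pos, (∀ e ∈ E, e.1.subst t = e.2.subst t) →
      ∃ u : ℕ → Pos, ∀ v, .var v ∈ X + eqAtoms E → t v = (f v).subst u) :
    VarBalanced (X.map (Pos.subst f)) := by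
  induction n generalizing E X with
  | zero =>
    obtain rfl := List.length_eq_zero_iff.1 hn
    obtain ⟨u, hu⟩ := hmg Pos.var (by simp)
    have e : X + eqAtoms [] = X := by simp [eqAtoms]
    rw [e] at hX hu
    exact hX.map_of_leftInverse hu
  | succ n ih =>
    obtain ⟨⟨a, b⟩, E, rfl⟩ := List.exists_cons_of_length_eq_add_one hn
    simp only [List.length_cons, Nat.add_right_cancel_iff] at hn
    simp only [List.forall_mem_cons, eqAtoms_cons] at hX hf hmg
    by_cases hab : a = b
    · subst hab
      refine ih E hn X ?_ hf.2 ?_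
      · intro v
        rcases hX v with this | this <;>
          simp only [Multiset.count_add, Multiset.count_cons] at this ⊢ <;>
          split_ifs at this <;> omega
      · intro t ht
        obtain ⟨u, hu⟩ := hmg t ⟨rfl, ht⟩
        refine ⟨u, fun v hv => hu v ?_⟩
        simp only [Multiset.mem_add, Multiset.mem_cons] at hv ⊢
        tauto
    have key : ∀ (v : ℕ) (b : Pos), .var v ≠ b →
        VarBalanced (X + (.var v ::ₘ b ::ₘ eqAtoms E)) →
        f v = b.subst f →
        (∀ t : ℕ → Pos, t v = b.subst t ∧ (∀ e ∈ E, e.1.subst t = e.2.subst t) →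
          ∃ u : ℕ → Pos, ∀ w, .var w ∈ X + (.var v ::ₘ b ::ₘ eqAtoms E) →
            t w = (f w).subst u) → VarBalanced (X.map (Pos.subst f)) := by
      intro v b hvb hX hv hmg
      have hθ : ∀ p : Pos, (Pos.elim v b p).subst f = p.subst f := by
        intro p
        by_cases hp : p = .var v
        · subst hp; rw [Pos.elim_self, ← hv]; rfl
        · rw [Pos.elim_of_ne hp]
      -- One of the two occurrences of `v` is the left side of the equation, and `b` is not `v`.
      have hcount : (X + eqAtoms E).count (.var v) = 1 := by
        have := hX v
        simp only [Multiset.count_add, Multiset.count_cons, if_true, if_neg hvb] at this ⊢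
        omega
      have hmem : Pos.var v ∈ X + eqAtoms E :=
        Multiset.count_pos.1 (by rw [hcount]; exact one_pos)
      obtain ⟨Z, hZ⟩ := Multiset.exists_cons_of_mem hmem
      have hvZ : Pos.var v ∉ Z := by
        rw [hZ, Multiset.count_cons_self] at hcount
        exact Multiset.count_eq_zero.1 (by omega)
      have hZ' : X.map (Pos.elim v b) +
          eqAtoms (E.map (Prod.map (Pos.elim v b) (Pos.elim v b))) = b ::ₘ Z := by
        have e : eqAtoms (E.map (Prod.map (Pos.elim v b) (Pos.elim v b))) =
            (eqAtoms E).map (Pos.elim v b) := by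
          simp [eqAtoms, Function.comp_def]
        rw [e, ← Multiset.map_add, hZ, Multiset.map_cons, Pos.elim_self]
        congr 1
        conv_rhs => rw [← Multiset.map_id Z]
        refine Multiset.map_congr rfl fun p hp => Pos.elim_of_ne ?_
        rintro rfl
        exact hvZ hp
      have htot : X + (.var v ::ₘ b ::ₘ eqAtoms E) = .var v ::ₘ .var v ::ₘ b ::ₘ Z := by
        rw [Multiset.add_cons, Multiset.add_cons, hZ, Multiset.cons_swap b]
      rw [htot] at hX hmg
      have := ih (E.map (Prod.map (Pos.elim v b) (Pos.elim v b))) (by simpa using hn)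
        (X.map (Pos.elim v b)) ?_ ?_ ?_
      · rw [Multiset.map_map] at this
        simpa only [Function.comp_def, hθ] using this
      · rw [hZ']
        intro w
        rcases hX w with this | this <;> simp only [Multiset.count_cons] at this ⊢ <;>
          split_ifs at this ⊢ <;> omega
      · intro e he
        obtain ⟨e, he', rfl⟩ := List.mem_map.1 he
        simp only [Prod.map_fst, Prod.map_snd, hθ]
        exact hf.2 e he'
      · intro t ht
        have ht' : ∀ p : Pos, p.subst (fun w => (Pos.elim v b (.var w)).subst t) =
            (Pos.elim v b p).subst t := by
          rintro (w | c) <;> rfl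
        -- A solution `t` of the reduced system becomes one of the whole system after precomposition
        -- with the elimination. The two may differ at `v`, which no longer occurs; hence generality
        -- is required only on occurring variables.
        obtain ⟨u, hu⟩ := hmg (fun w => (Pos.elim v b (.var w)).subst t)
          ⟨by rw [ht', Pos.elim_self, Pos.elim_of_ne hvb.symm], fun e he => by
            rw [ht', ht']
            exact ht _ (List.mem_map.2 ⟨e, he, rfl⟩)⟩
        refine ⟨u, fun w hw => ?_⟩
        rw [hZ'] at hw
        have hwv : Pos.var w ≠ .var v := by
          intro h
          rw [h, Multiset.mem_cons] at hw
          exact hw.elim hvb hvZ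
        have := hu w (by simp only [Multiset.mem_cons] at hw ⊢; tauto)
        rwa [Pos.elim_of_ne hwv] at this
    cases a with
    | var v => exact key v b hab hX hf.1 hmg
    | const c =>
      cases b with
      | var w =>
        rw [Multiset.cons_swap] at hX hmg
        refine key w _ (Ne.symm hab) hX hf.1.symm fun t ht => hmg t ⟨ht.1.symm, ht.2⟩
      | const c' => exact absurd hf.1 hab

theorem exists_isMGU {α β : Ty} (h : α.shape = β.shape) {s : ℕ → Ty}
    (hs : α.subst s = β.subst s) : ∃ f : ℕ → Pos, IsMGU (atomSub f) α β := by
  obtain ⟨f, hf, hmg⟩ := exists_mostGeneral _ _ rfl ⟨s, (unifies_iff h s).1 hs⟩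
  exact ⟨f, (unifies_iff h _).2 hf, fun t ht => hmg t ((unifies_iff h t).1 ht)⟩

/-- Some most general unifier is atomic, and it factors through `s`. Since substitution never
removes an arrow, the values of `s` are atomic too. -/
theorem IsMGU.atomic {α β : Ty} {s : ℕ → Ty} (h : α.shape = β.shape) (hs : IsMGU s α β) :
    ∃ f : ℕ → Pos, s = atomSub f := by
  obtain ⟨f, hf⟩ := exists_isMGU h hs.1
  obtain ⟨u, hu⟩ := hs.2 _ hf.1
  refine ⟨fun v => (s v).firstLeaf, funext fun v => ?_⟩
  have := hu v
  simp only [atomSub]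
  cases hv : s v with
  | atom p => rfl
  | arr β α => rw [hv] at this; cases this

theorem IsMGU.factor {α β : Ty} {f g : ℕ → Pos} (hf : IsMGU (atomSub f) α β)
    (hg : α.subst (atomSub g) = β.subst (atomSub g)) : ∃ u : ℕ → Pos, ∀ v, g v = (f v).subst u := by
  obtain ⟨u, hu⟩ := hf.2 _ hg
  refine ⟨fun v => (u v).firstLeaf, fun v => ?_⟩
  have := hu v
  simp only [atomSub] at this
  cases hv : f v with
  | var w =>
    rw [hv] at this
    change Ty.atom (g v) = u w at this
    change g v = (u w).firstLeaf
    rw [← this]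
    rfl
  | const c =>
    rw [hv] at this
    simpa [Ty.subst, Pos.subst] using this

/-- The unified types `α` and `β` disappear from the conclusion of a rule; `X` stands for the atoms
that remain. -/
theorem IsMGU.varBalanced {α β : Ty} (h : α.shape = β.shape) {f : ℕ → Pos}
    (hf : IsMGU (atomSub f) α β) {X : Multiset Pos}
    (hX : VarBalanced (X + ((α.flatten : Multiset Pos) + (β.flatten : Multiset Pos)))) :
    VarBalanced (X.map (Pos.subst f)) := by
  have hl : α.flatten.length = β.flatten.length := by
    rw [Ty.length_flatten, Ty.length_flatten, h]
  have e : eqAtoms (α.flatten.zip β.flatten) = (α.flatten : Multiset Pos) + β.flatten := by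
    rw [eqAtoms, List.map_fst_zip hl.le, List.map_snd_zip hl.ge]
  refine VarBalanced.map_mostGeneral _ _ rfl X (e ▸ hX) f
    (unifies_atomSub.1 ((unifies_iff h _).1 hf.1)) fun t ht => ?_
  obtain ⟨u, hu⟩ := hf.factor ((unifies_iff h _).2 (unifies_atomSub.2 ht))
  exact ⟨u, fun v _ => hu v⟩

-- Renaming and inversion for linear typings

namespace Lam

theorem mem_fv_bind_of_mem {k m : ℕ} {b : Fin k → Lam m} {f : ℕ → Lam m} {M : Lam k} {x y : ℕ}
    (hx : x ∈ M.fv) (hy : y ∈ (f x).fv) : y ∈ (bind b f M).fv := by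
  induction M generalizing m with
  | bvar i => simp [fv] at hx
  | fvar z =>
    simp only [fv, Finset.mem_singleton] at hx
    subst hx
    exact hy
  | app M N ihM ihN =>
    simp only [bind, fv, Finset.mem_union] at hx ⊢
    exact hx.imp (fun h => ihM h hy) fun h => ihN h hy
  | lam M ih => exact ih hx (by simpa [weaken, fv_ren] using hy)

theorem mem_fv_lambda {x y : ℕ} {M : Lam 0} (hy : y ∈ M.fv) (hxy : y ≠ x) :
    y ∈ (lambda x M).fv :=
  mem_fv_bind_of_mem (k := 0) hy (by simp [hxy, fv])

theorem lambda_sub_fvar {ρ : ℕ → ℕ} {x z : ℕ} {M : Lam 0} (h : ∀ y ∈ M.fv, y ≠ x → ρ y ≠ z) :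
    lambda z (sub (fun y => fvar (Function.update ρ x z y)) M) =
      sub (fun y => fvar (ρ y)) (lambda x M) := by
  unfold lambda sub
  rw [bind_bind]
  simp only [bind]
  rw [bind_bind]
  congr 1
  refine (bind_congr fun y hy => ?_).trans
    (congrArg (fun b => bind b _ M) (funext fun i => i.elim0))
  by_cases hyx : y = x
  · subst hyx
    simp [bind]
  · simp only [bind, ne_eq, hyx, not_false_eq_true, Function.update_of_ne, if_false]
    rw [if_neg (h y hy hyx)]
    rfl

end Lam

namespace Typing

open Lam

variable {Γ : Multiset (ℕ × Ty)} {M : Lam 0} {α : Ty}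

theorem exists_mem_of_mem_fv (h : Typing Γ M α) {x : ℕ} (hx : x ∈ M.fv) : ∃ p ∈ Γ, p.1 = x := by
  induction h with
  | var y α => simpa [fv, eq_comm] using hx
  | app _ _ _ ih₁ ih₂ =>
    simp only [fv, Finset.mem_union] at hx
    rcases hx with hx | hx
    · obtain ⟨p, hp, h⟩ := ih₁ hx
      exact ⟨p, by simp [hp], h⟩
    · obtain ⟨p, hp, h⟩ := ih₂ hx
      exact ⟨p, by simp [hp], h⟩
  | lam _ _ ih =>
    have := Finset.mem_erase.1 (fv_lambda _ _ hx)
    obtain ⟨p, hp, h⟩ := ih this.2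
    rcases Multiset.mem_cons.1 hp with rfl | hp
    · exact absurd h.symm this.1
    · exact ⟨p, hp, h⟩

theorem mem_fv_of_mem (h : Typing Γ M α) {p : ℕ × Ty} (hp : p ∈ Γ) : p.1 ∈ M.fv := by
  induction h with
  | var y α =>
    rw [Multiset.mem_singleton] at hp
    simp [hp, fv]
  | app _ _ _ ih₁ ih₂ =>
    simp only [fv, Finset.mem_union]
    exact (Multiset.mem_add.1 hp).imp ih₁ ih₂
  | lam _ hx ih => exact mem_fv_lambda (ih (Multiset.mem_cons_of_mem hp)) (hx p hp)

theorem rename (h : Typing Γ M α) (ρ : ℕ → ℕ)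
    (hρ : ∀ p ∈ Γ, ∀ q ∈ Γ, ρ p.1 = ρ q.1 → p.1 = q.1) :
    Typing (Γ.map (Prod.map ρ id)) (M.sub fun y => fvar (ρ y)) α := by
  induction h generalizing ρ with
  | var x α => exact .var _ _
  | app _ _ hd ih₁ ih₂ =>
    rw [Multiset.map_add]
    refine .app (ih₁ ρ fun p hp q hq => hρ p (by simp [hp]) q (by simp [hq]))
      (ih₂ ρ fun p hp q hq => hρ p (by simp [hp]) q (by simp [hq])) ?_
    intro p hp q hq
    obtain ⟨p, hp', rfl⟩ := Multiset.mem_map.1 hp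
    obtain ⟨q, hq', rfl⟩ := Multiset.mem_map.1 hq
    exact fun e => hd p hp' q hq' (hρ p (by simp [hp']) q (by simp [hq']) e)
  | @lam Γ M x α β h hx ih =>
    -- The bound variable gets a name outside the image of the context, which keeps the updated
    -- renaming injective.
    obtain ⟨z, hz⟩ := Infinite.exists_notMem_finset (Γ.map fun p => ρ p.1).toFinset
    rw [Multiset.mem_toFinset] at hz
    have hz' : ∀ p ∈ Γ, ρ p.1 ≠ z := fun p hp e => hz (Multiset.mem_map.2 ⟨p, hp, e⟩)
    have hΓ : ∀ p ∈ Γ, Function.update ρ x z p.1 = ρ p.1 := fun p hp =>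
      Function.update_of_ne (hx p hp) _ _
    have := ih (Function.update ρ x z) ?_
    · rw [Multiset.map_cons, Multiset.map_congr (g := Prod.map ρ id) rfl
        fun p hp => by rw [Prod.map, hΓ p hp]; rfl] at this
      simp only [Prod.map, Function.update_self, id] at this
      rw [← lambda_sub_fvar]
      · refine .lam this ?_
        intro p hp
        obtain ⟨q, hq, rfl⟩ := Multiset.mem_map.1 hp
        exact hz' q hq
      · intro y hy hyx
        obtain ⟨p, hp, rfl⟩ := h.exists_mem_of_mem_fv hy
        rcases Multiset.mem_cons.1 hp with rfl | hp
        · exact absurd rfl hyx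
        · exact hz' p hp
    · intro p hp q hq e
      rcases Multiset.mem_cons.1 hp with rfl | hp <;> rcases Multiset.mem_cons.1 hq with rfl | hq
      · rfl
      · rw [hΓ q hq, Function.update_self] at e
        exact absurd e.symm (hz' q hq)
      · rw [hΓ p hp, Function.update_self] at e
        exact absurd e (hz' p hp)
      · rw [hΓ p hp, hΓ q hq] at e
        exact hρ p hp q hq e

theorem rename_one {x : ℕ} (h : Typing ((x, α) ::ₘ Γ) M β) (hx : ∀ p ∈ Γ, p.1 ≠ x) {y : ℕ}
    (hy : ∀ p ∈ Γ, p.1 ≠ y) :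
    Typing ((y, α) ::ₘ Γ) (M.sub (Function.update fvar x (fvar y))) β := by
  have := h.rename (Function.update id x y) ?_
  · rw [Multiset.map_cons, Multiset.map_congr (g := id) rfl
      fun p hp => by rw [Prod.map, Function.update_of_ne (hx p hp)]; rfl] at this
    simp only [Prod.map, Function.update_self, id, Multiset.map_id'] at this
    convert this using 2
    funext z
    by_cases hz : z = x
    · simp [hz]
    · simp [hz]
  · intro p hp q hq e
    rcases Multiset.mem_cons.1 hp with rfl | hp <;> rcases Multiset.mem_cons.1 hq with rfl | hq
    · rfl
    · rw [Function.update_of_ne (hx q hq), Function.update_self] at e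
      exact absurd e.symm (hy q hq)
    · rw [Function.update_of_ne (hx p hp), Function.update_self] at e
      exact absurd e (hy p hp)
    · rwa [Function.update_of_ne (hx q hq), Function.update_of_ne (hx p hp)] at e

/-- The derivation may have abstracted over another name than `x`; equality of the bodies and a
renaming bring it back to `x`. -/
theorem lambda_inv {x : ℕ} {τ : Ty} (h : Typing Γ (lambda x M) τ) (hx : ∀ p ∈ Γ, p.1 ≠ x) :
    ∃ α β, τ = .arr α β ∧ Typing ((x, α) ::ₘ Γ) M β := by
  generalize hP : lambda x M = P at h
  cases h with
  | var => cases hP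
  | app => cases hP
  | @lam _ M' y α β h hy =>
    refine ⟨α, β, rfl, ?_⟩
    have e : close x M = close y M' := Lam.lam.inj hP
    rw [← close_inst_self x M, e, close_inst]
    exact h.rename_one hy hx

theorem subst (h : Typing Γ M α) (s : ℕ → Ty) :
    Typing (Γ.map fun p => (p.1, p.2.subst s)) M (α.subst s) := by
  induction h with
  | var x α => exact .var _ _
  | app _ _ hd ih₁ ih₂ =>
    rw [Multiset.map_add]
    refine .app ih₁ ih₂ ?_
    intro p hp q hq
    obtain ⟨p, hp', rfl⟩ := Multiset.mem_map.1 hp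
    obtain ⟨q, hq', rfl⟩ := Multiset.mem_map.1 hq
    exact hd p hp' q hq'
  | lam _ hx ih =>
    rw [Multiset.map_cons] at ih
    refine .lam ih ?_
    intro p hp
    obtain ⟨q, hq, rfl⟩ := Multiset.mem_map.1 hp
    exact hx q hq

end Typing

-- Principal types of lexical terms

/-- The number of positive minus the number of negative occurrences of a type variable. -/
def Ty.sign (v : ℕ) : Ty → ℤ
  | atom p => if p = .var v then 1 else 0
  | arr β α => α.sign v - β.sign v

/-- Every occurrence counts `1` or `-1` in the sign, so sign and count have the same parity. -/
theorem Ty.even_sign_add_count (v : ℕ) (α : Ty) :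
    Even (α.sign v + (α.flatten.count (.var v) : ℤ)) := by
  induction α with
  | atom p =>
    by_cases h : p = .var v
    · simp [sign, flatten, h]
    · simp [sign, flatten, h]
  | arr β α ihβ ihα =>
    simp only [sign, flatten, List.count_append, Nat.cast_add]
    obtain ⟨a, ha⟩ := ihβ
    obtain ⟨b, hb⟩ := ihα
    exact ⟨b + a - β.sign v, by omega⟩

/-- By linearity each hypothesis is used exactly once, and the argument type of an application
cancels. -/
theorem Typing.sign_eq {Γ : Multiset (ℕ × Ty)} {M : Lam 0} {α : Ty} (h : Typing Γ M α) (v : ℕ) :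
    α.sign v = (Γ.map fun p => p.2.sign v).sum := by
  induction h with
  | var x α => simp
  | app _ _ _ ih₁ ih₂ =>
    rw [Multiset.map_add, Multiset.sum_add, ← ih₁, ← ih₂, Ty.sign]
    omega
  | lam _ _ ih =>
    rw [Multiset.map_cons, Multiset.sum_cons] at ih
    rw [Ty.sign, ih]
    simp

/-- The type has at least the arrows of a given Church type. -/
def Ty.Fits : Ty → STy → Prop
  | _, .σ => True
  | atom _, .arr _ _ => False
  | arr β α, .arr b a => β.Fits b ∧ α.Fits a

/-- Substitution can only add arrows. If all arrows are there beforehand, none is added and the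
leaves go to atoms. -/
theorem Ty.Fits.shape_eq {α : Ty} {a : STy} (h : α.Fits a) {s : ℕ → Ty}
    (hs : (α.subst s).shape = a) :
    α.shape = a ∧ ∀ v, .var v ∈ α.flatten → ∃ p, s v = atom p := by
  induction α generalizing a with
  | atom p =>
    cases a with
    | σ =>
      refine ⟨rfl, fun v hv => ?_⟩
      simp only [flatten, List.mem_singleton] at hv
      subst hv
      exact eq_atom_of_shape hs
    | arr _ _ => cases h
  | arr β α ihβ ihα =>
    cases a with
    | σ => cases hs
    | arr b a =>
      simp only [subst, shape, STy.arr.injEq] at hs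
      obtain ⟨h₁, h₂⟩ := ihβ h.1 hs.1
      obtain ⟨h₃, h₄⟩ := ihα h.2 hs.2
      refine ⟨by rw [shape, h₁, h₃], fun v hv => ?_⟩
      rcases List.mem_append.1 hv with hv | hv
      · exact h₄ v hv
      · exact h₂ v hv

theorem Long.exists_mem_of_mem_fv {Γ : Multiset (ℕ × STy)} {M : Lam 0} {a : STy}
    (h : Long Γ M a) : ∀ x ∈ M.fv, ∃ p ∈ Γ, p.1 = x := by
  refine Long.rec (motive_1 := fun Γ M _ _ => ∀ x ∈ M.fv, ∃ p ∈ Γ, p.1 = x)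
    (motive_2 := fun Γ M _ _ => ∀ x ∈ M.fv, ∃ p ∈ Γ, p.1 = x) ?_ ?_ ?_ ?_ h
  · intro x a y hy
    simpa [Lam.fv, eq_comm] using hy
  · intro Γ Δ M N a b _ _ _ ih₁ ih₂ x hx
    simp only [Lam.fv, Finset.mem_union] at hx
    rcases hx with hx | hx
    · obtain ⟨p, hp, h⟩ := ih₁ x hx
      exact ⟨p, by simp [hp], h⟩
    · obtain ⟨p, hp, h⟩ := ih₂ x hx
      exact ⟨p, by simp [hp], h⟩
  · exact fun _ ih => ih
  · intro Γ M x a b _ _ ih y hy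
    have := Finset.mem_erase.1 (Lam.fv_lambda _ _ hy)
    obtain ⟨p, hp, h⟩ := ih y this.2
    rcases Multiset.mem_cons.1 hp with rfl | hp
    · exact absurd h.symm this.1
    · exact ⟨p, hp, h⟩

/-- In an η-long term every arrow of the Church type is witnessed by an abstraction or an
application, so every Curry typing must have it. -/
theorem Long.fits {Γ : Multiset (ℕ × STy)} {M : Lam 0} {a : STy} (h : Long Γ M a) :
    ∀ Γ' τ, Typing Γ' M τ → τ.Fits a ∧ ∀ p ∈ Γ', ∃ c, (p.1, c) ∈ Γ ∧ p.2.Fits c := by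
  -- A bare variable can have any type. For neutral terms the result type is therefore assumed to
  -- fit, and the information travels to the head.
  refine Long.rec
    (motive_1 := fun Γ M b _ => ∀ Γ' τ, Typing Γ' M τ → τ.Fits b →
      ∀ p ∈ Γ', ∃ c, (p.1, c) ∈ Γ ∧ p.2.Fits c)
    (motive_2 := fun Γ M a _ => ∀ Γ' τ, Typing Γ' M τ →
      τ.Fits a ∧ ∀ p ∈ Γ', ∃ c, (p.1, c) ∈ Γ ∧ p.2.Fits c) ?_ ?_ ?_ ?_ h
  · intro x a Γ' τ h hτ p hp
    cases h
    obtain rfl := Multiset.mem_singleton.1 hp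
    exact ⟨a, by simp, hτ⟩
  · intro Γ Δ M N a b _ _ _ ih₁ ih₂ Γ' τ h hτ p hp
    cases h with
    | @app Γ₁ Γ₂ _ _ α _ h₁ h₂ _ =>
      obtain ⟨hα, hΔ⟩ := ih₂ _ _ h₂
      rcases Multiset.mem_add.1 hp with hp | hp
      · obtain ⟨c, hc, h⟩ := ih₁ _ _ h₁ ⟨hα, hτ⟩ p hp
        exact ⟨c, by simp [hc], h⟩
      · obtain ⟨c, hc, h⟩ := hΔ p hp
        exact ⟨c, by simp [hc], h⟩
  · intro Γ M _ ih Γ' τ h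
    have : τ.Fits .σ := by cases τ <;> trivial
    exact ⟨this, ih Γ' τ h this⟩
  · intro Γ M x a b hM hx ih Γ' τ h
    have hx' : ∀ p ∈ Γ', p.1 ≠ x := by
      intro p hp
      obtain ⟨q, hq, e⟩ := (Long.lam hM hx).exists_mem_of_mem_fv _ (h.mem_fv_of_mem hp)
      exact e ▸ hx q hq
    obtain ⟨α, β, rfl, h'⟩ := h.lambda_inv hx'
    obtain ⟨h₁, h₂⟩ := ih _ _ h'
    refine ⟨⟨?_, h₁⟩, fun p hp => ?_⟩
    · obtain ⟨c, hc, h⟩ := h₂ _ (Multiset.mem_cons_self _ _)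
      rcases Multiset.mem_cons.1 hc with e | hc
      · cases e
        exact h
      · exact absurd rfl (hx _ hc)
    · obtain ⟨c, hc, h⟩ := h₂ p (Multiset.mem_cons_of_mem hp)
      rcases Multiset.mem_cons.1 hc with e | hc
      · exact absurd (congrArg Prod.fst e) (hx' p hp)
      · exact ⟨c, hc, h⟩

/-- All occurrences of atomic types in a typing context. -/
def tyAtoms (Γ : Multiset (ℕ × Ty)) : Multiset Pos := Γ.bind fun p => (p.2.flatten : Multiset Pos)

theorem tyAtoms_add (Γ Δ : Multiset (ℕ × Ty)) : tyAtoms (Γ + Δ) = tyAtoms Γ + tyAtoms Δ :=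
  Multiset.add_bind _ _ _

theorem tyAtoms_cons (p : ℕ × Ty) (Γ : Multiset (ℕ × Ty)) :
    tyAtoms (p ::ₘ Γ) = (p.2.flatten : Multiset Pos) + tyAtoms Γ :=
  Multiset.cons_bind _ _ _

/-- A typing of `M` in a context of the form `Γ`, where the variable `x` has type `P → Q`.  The
links `Y` between leaves are type variables in the range from `K` to `K'`, and also `P` and `Q`
if `x` occurs in the context. -/
structure LinkedTyping (x : ℕ) (P Q : Pos) (K K' : ℕ) (Γ : Multiset (ℕ × STy)) (M : Lam 0)
    (τ : Ty) (Γ' : Multiset (ℕ × Ty)) (Y : Multiset Pos) : Prop where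
  le : K ≤ K'
  shape : Γ'.map (Prod.map id Ty.shape) = Γ
  special : ∀ p ∈ Γ', p.1 = x → p.2 = .arr (.atom P) (.atom Q)
  typing : Typing Γ' M τ
  nodup : Y.Nodup
  mem : ∀ p ∈ Y, (∃ v, p = .var v ∧ K ≤ v ∧ v < K') ∨ (∃ c, (x, c) ∈ Γ) ∧ (p = P ∨ p = Q)

/-- Link variables come from consecutive ranges, and the two constants belong only to the side whose
context contains `x`. -/
theorem nodup_add_of_linkedTyping {x : ℕ} {c d : ℕ} {K K₁ K₂ : ℕ}
    {Γ Δ : Multiset (ℕ × STy)} {M N : Lam 0} {τ υ : Ty} {Γ' Δ' : Multiset (ℕ × Ty)}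
    {Y Z : Multiset Pos} (h₁ : LinkedTyping x (.const c) (.const d) K K₁ Δ N υ Δ' Y)
    (h₂ : LinkedTyping x (.const c) (.const d) K₁ K₂ Γ M τ Γ' Z)
    (hd : ∀ p ∈ Γ, ∀ q ∈ Δ, p.1 ≠ q.1) : (Z + Y).Nodup := by
  refine (Multiset.Nodup.add_iff h₂.nodup h₁.nodup).2 (Multiset.disjoint_left.2 ?_)
  intro p hp hq
  rcases h₂.mem p hp with ⟨v, rfl, hv⟩ | ⟨⟨a, ha⟩, hv⟩ <;>
    rcases h₁.mem _ hq with ⟨w, hw, hw'⟩ | ⟨⟨b, hb⟩, hw⟩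
  · cases hw
    omega
  · rcases hw with hw | hw <;> cases hw
  · subst hw
    rcases hv with hv | hv <;> cases hv
  · exact hd _ ha _ hb rfl

theorem LinkedTyping.ne_of_mem {x : ℕ} {P Q : Pos} {K K' : ℕ} {Γ : Multiset (ℕ × STy)}
    {M : Lam 0} {τ : Ty} {Γ' : Multiset (ℕ × Ty)} {Y : Multiset Pos}
    (h : LinkedTyping x P Q K K' Γ M τ Γ' Y) {y : ℕ} (hy : ∀ p ∈ Γ, p.1 ≠ y) :
    ∀ p ∈ Γ', p.1 ≠ y := by
  intro p hp
  exact hy (p.1, p.2.shape) (by rw [← h.shape]; exact Multiset.mem_map.2 ⟨p, hp, rfl⟩)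

/-- Each link contributes two equal leaves, whence the total `Y + Y` with `Y` free of repetitions. A
neutral term whose head is not `x` accepts any prescribed type of the right shape; one with head `x`
is `x` itself or `x N`, with `N` of type `c` and result `d`. The second conjunct serves such an
argument `N`, whose type is prescribed. -/
theorem Long.exists_linkedTyping {Γ : Multiset (ℕ × STy)} {M : Lam 0} {a : STy} (h : Long Γ M a)
    {c d : ℕ} (hcd : c ≠ d) : ∀ x, (∀ p ∈ Γ, p.1 = x → p.2 = .str) →
      (∀ K, ∃ K' α Γ' Y, LinkedTyping x (.const c) (.const d) K K' Γ M α Γ' Y ∧ α.shape = a ∧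
        tyAtoms Γ' + (α.flatten : Multiset Pos) = Y + Y) ∧
      ((∀ p ∈ Γ, p.1 ≠ x) → a = .σ → ∀ τ : Ty, τ.shape = .σ →
        ∀ K, ∃ K' Γ' Y, LinkedTyping x (.const c) (.const d) K K' Γ M τ Γ' Y ∧
          tyAtoms Γ' = (τ.flatten : Multiset Pos) + (Y + Y)) := by
  refine Long.rec
    (motive_1 := fun Γ M b _ => ∀ x, (∀ p ∈ Γ, p.1 = x → p.2 = .str) →
      (∀ τ : Ty, τ.shape = b →
        ∀ K, ∃ K' Γ' Y, LinkedTyping x (.const c) (.const d) K K' Γ M τ Γ' Y ∧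
          tyAtoms Γ' = (τ.flatten : Multiset Pos) + (Y + Y)) ∨
      (M = .fvar x ∧ Γ = {(x, .str)} ∧ b = .str) ∨
      (b = .σ ∧ (∃ c, (x, c) ∈ Γ) ∧
        ∀ K, ∃ K' α Γ' Y, LinkedTyping x (.const c) (.const d) K K' Γ M α Γ' Y ∧ α.shape = b ∧
          tyAtoms Γ' + (α.flatten : Multiset Pos) = Y + Y))
    (motive_2 := fun Γ M a _ => ∀ x, (∀ p ∈ Γ, p.1 = x → p.2 = .str) →
      (∀ K, ∃ K' α Γ' Y, LinkedTyping x (.const c) (.const d) K K' Γ M α Γ' Y ∧ α.shape = a ∧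
        tyAtoms Γ' + (α.flatten : Multiset Pos) = Y + Y) ∧
      ((∀ p ∈ Γ, p.1 ≠ x) → a = .σ → ∀ τ : Ty, τ.shape = .σ →
        ∀ K, ∃ K' Γ' Y, LinkedTyping x (.const c) (.const d) K K' Γ M τ Γ' Y ∧
          tyAtoms Γ' = (τ.flatten : Multiset Pos) + (Y + Y))) ?_ ?_ ?_ ?_ h
  · intro y a x hx
    by_cases hyx : y = x
    · subst hyx
      have : a = .str := hx (y, a) (by simp) rfl
      subst this
      exact .inr (.inl ⟨rfl, rfl, rfl⟩)
    · refine .inl fun τ hτ K => ⟨K, {(y, τ)}, 0, ⟨le_rfl, by simp [hτ], ?_, .var _ _, by simp,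
        by simp⟩, by simp [tyAtoms]⟩
      intro p hp
      obtain rfl := Multiset.mem_singleton.1 hp
      exact fun h => absurd h hyx
  · intro Γ Δ M N a b _ _ hd ih₁ ih₂ x hx
    have hxΓ : ∀ p ∈ Γ, p.1 = x → p.2 = .str := fun p hp => hx p (by simp [hp])
    have hxΔ : ∀ p ∈ Δ, p.1 = x → p.2 = .str := fun p hp => hx p (by simp [hp])
    rcases ih₁ x hxΓ with h | ⟨rfl, rfl, hab⟩ | ⟨hab, -⟩
    · refine .inl fun τ hτ K => ?_
      obtain ⟨K₁, α, Δ', Y, hY, hα, eY⟩ := (ih₂ x hxΔ).1 K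
      obtain ⟨K₂, Γ', Z, hZ, eZ⟩ := h (.arr α τ) (by rw [Ty.shape, hα, hτ]) K₁
      refine ⟨K₂, Γ' + Δ', Z + Y, ⟨hY.le.trans hZ.le, ?_, ?_, .app hZ.typing hY.typing ?_,
        nodup_add_of_linkedTyping hY hZ hd, ?_⟩, ?_⟩
      · rw [Multiset.map_add, hZ.shape, hY.shape]
      · intro p hp
        exact (Multiset.mem_add.1 hp).elim (hZ.special p) (hY.special p)
      · intro p hp q hq
        have h₁ : (p.1, p.2.shape) ∈ Γ := by
          rw [← hZ.shape]; exact Multiset.mem_map.2 ⟨p, hp, rfl⟩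
        have h₂ : (q.1, q.2.shape) ∈ Δ := by
          rw [← hY.shape]; exact Multiset.mem_map.2 ⟨q, hq, rfl⟩
        exact hd _ h₁ _ h₂
      · intro p hp
        rcases Multiset.mem_add.1 hp with hp | hp
        · rcases hZ.mem p hp with ⟨v, rfl, hv⟩ | ⟨⟨e, he⟩, h⟩
          · exact .inl ⟨v, rfl, hY.le.trans hv.1, hv.2⟩
          · exact .inr ⟨⟨e, by simp [he]⟩, h⟩
        · rcases hY.mem p hp with ⟨v, rfl, hv⟩ | ⟨⟨e, he⟩, h⟩
          · exact .inl ⟨v, rfl, hv.1, hv.2.trans_le hZ.le⟩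
          · exact .inr ⟨⟨e, by simp [he]⟩, h⟩
      · rw [tyAtoms_add, eZ, Ty.flatten, ← Multiset.coe_add]
        calc _ = (τ.flatten : Multiset Pos) + (Z + Z) + (tyAtoms Δ' + α.flatten) := by abel
          _ = _ := by rw [eY]; abel
    · cases hab
      have hxΔ' : ∀ p ∈ Δ, p.1 ≠ x := fun p hp => (hd (x, .str) (by simp) p hp).symm
      refine .inr (.inr ⟨rfl, ⟨.str, by simp⟩, fun K => ?_⟩)
      -- The argument of `x` is forced to have type `c`. Then `c` is shared by `x` and its argument,
      -- and `d` by `x` and the result: two new links.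
      obtain ⟨K', Δ', Y, hY, eY⟩ := (ih₂ x hxΔ).2 hxΔ' rfl (.atom (.const c)) rfl K
      refine ⟨K', .atom (.const d), {(x, .arr (.atom (.const c)) (.atom (.const d)))} + Δ',
        .const c ::ₘ .const d ::ₘ Y, ⟨hY.le, ?_, ?_, .app (.var _ _) hY.typing ?_, ?_, ?_⟩, rfl, ?_⟩
      · rw [Multiset.map_add, hY.shape]
        rfl
      · intro p hp hpx
        rcases Multiset.mem_add.1 hp with hp | hp
        · obtain rfl := Multiset.mem_singleton.1 hp
          rfl
        · exact hY.special p hp hpx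
      · intro p hp q hq
        obtain rfl := Multiset.mem_singleton.1 hp
        exact (hY.ne_of_mem hxΔ' q hq).symm
      · have hnot : ∀ e, Pos.const e ∉ Y := by
          intro e he
          rcases hY.mem _ he with ⟨v, hv, -⟩ | ⟨⟨e', he'⟩, -⟩
          · cases hv
          · exact hxΔ' _ he' rfl
        simp [hnot, hY.nodup, hcd]
      · intro p hp
        simp only [Multiset.mem_cons] at hp
        rcases hp with rfl | rfl | hp
        · exact .inr ⟨⟨.str, by simp⟩, .inl rfl⟩
        · exact .inr ⟨⟨.str, by simp⟩, .inr rfl⟩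
        · rcases hY.mem p hp with h | ⟨⟨e, he⟩, h⟩
          · exact .inl h
          · exact absurd rfl (hxΔ' _ he)
      · rw [tyAtoms_add, eY]
        simp only [tyAtoms, Multiset.singleton_bind, Ty.flatten, List.singleton_append,
          ← Multiset.cons_coe, Multiset.coe_nil, ← Multiset.singleton_add]
        abel
    · cases hab
  · intro Γ M _ ih x hx
    rcases ih x hx with h | ⟨-, -, h⟩ | ⟨-, ⟨e, he⟩, h⟩
    · refine ⟨fun K => ?_, fun _ _ => h⟩
      -- The atomic type of the term is free here; the first unused variable `K` becomes the new
      -- link.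
      obtain ⟨K', Γ', Y, hY, eY⟩ := h (.atom (.var K)) rfl (K + 1)
      refine ⟨K', _, Γ', .var K ::ₘ Y, ⟨(Nat.le_succ K).trans hY.le, hY.shape, hY.special,
        hY.typing, ?_, ?_⟩, rfl, ?_⟩
      · refine Multiset.nodup_cons.2 ⟨fun hK => ?_, hY.nodup⟩
        rcases hY.mem _ hK with ⟨v, hv, hv'⟩ | ⟨-, hv | hv⟩ <;> cases hv
        omega
      · intro p hp
        rcases Multiset.mem_cons.1 hp with rfl | hp
        · exact .inl ⟨K, rfl, le_rfl, hY.le⟩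
        · rcases hY.mem p hp with ⟨v, rfl, hv⟩ | h
          · exact .inl ⟨v, rfl, by omega, hv.2⟩
          · exact .inr h
      · rw [eY]
        simp only [Ty.flatten, ← Multiset.cons_coe, Multiset.coe_nil, ← Multiset.singleton_add]
        abel
    · cases h
    · exact ⟨h, fun hx' => absurd rfl (hx' _ he)⟩
  · intro Γ M y a b _ hy ih x hx
    refine ⟨fun K => ?_, fun _ h => by cases h⟩
    -- If the bound variable happens to be called `x`, the special variable does not occur in `Γ`,
    -- and an unused name `z` takes over its role.
    have key : ∃ z, (z = x ∨ (∀ p ∈ Γ, p.1 ≠ x) ∧ ∀ p ∈ Γ, p.1 ≠ z) ∧ y ≠ z := by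
      by_cases hyx : y = x
      · subst hyx
        obtain ⟨z, hz⟩ := Infinite.exists_notMem_finset (insert y (Γ.map Prod.fst).toFinset)
        simp only [Finset.mem_insert, Multiset.mem_toFinset, not_or] at hz
        exact ⟨z, .inr ⟨hy, fun p hp e => hz.2 (Multiset.mem_map.2 ⟨p, hp, e⟩)⟩,
          fun e => hz.1 e.symm⟩
      · exact ⟨x, .inl rfl, hyx⟩
    obtain ⟨z, hz, hyz⟩ := key
    obtain ⟨K', α, Γ', Y, hY, hα, eY⟩ := (ih z (by
      intro p hp hpz
      rcases Multiset.mem_cons.1 hp with rfl | hp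
      · exact absurd hpz hyz
      · rcases hz with rfl | hz
        · exact hx p hp hpz
        · exact absurd hpz (hz.2 p hp))).1 K
    obtain ⟨⟨y', τ⟩, hp, Γ'', hΓ', hΓ''⟩ : ∃ p, Prod.map id Ty.shape p = (y, a) ∧
        ∃ Γ'', Γ' = p ::ₘ Γ'' ∧ Γ''.map (Prod.map id Ty.shape) = Γ := by
      classical
      have h := hY.shape
      obtain ⟨p, hp, h₁, h₂⟩ := (Multiset.map_eq_cons _ _ _ _).2 h
      exact ⟨p, h₁, Γ'.erase p, (Multiset.cons_erase hp).symm, h₂⟩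
    simp only [Prod.map, id, Prod.mk.injEq] at hp
    obtain ⟨rfl, rfl⟩ := hp
    subst hΓ'
    have hne : ∀ (w : ℕ), (∀ p ∈ Γ, p.1 ≠ w) → ∀ p ∈ Γ'', p.1 ≠ w := by
      intro w hw p hp
      exact hw (p.1, p.2.shape) (by rw [← hΓ'']; exact Multiset.mem_map.2 ⟨p, hp, rfl⟩)
    refine ⟨K', .arr τ α, Γ'', Y, ⟨hY.le, hΓ'', ?_, .lam hY.typing (hne _ hy), hY.nodup, ?_⟩,
      by rw [Ty.shape, hα], ?_⟩
    · intro p hp hpx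
      rcases hz with rfl | hz
      · exact hY.special p (Multiset.mem_cons_of_mem hp) hpx
      · exact absurd hpx (hne _ hz.1 p hp)
    · intro p hp
      rcases hY.mem p hp with h | ⟨⟨e, he⟩, h⟩
      · exact .inl h
      · rcases Multiset.mem_cons.1 he with he | he
        · exact absurd (congrArg Prod.fst he).symm hyz
        · rcases hz with rfl | hz
          · exact .inr ⟨⟨e, he⟩, h⟩
          · exact absurd rfl (hz.2 _ he)
    · rw [← eY, tyAtoms_cons, Ty.flatten, ← Multiset.coe_add]
      abel

/-- The linked typing is an instance of the principal one. So `α` has at most the arrows of the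
Church type, and by `Long.fits` at least those. -/
theorem IsLexical.shape_and_varBalanced {Sg : Signature} {x n : ℕ} {A : HForm Sg} {M : Lam 1}
    {α : Ty} (h : IsLexical x n A M α) :
    α.shape = A.type ∧ VarBalanced (α.flatten : Multiset Pos) := by
  obtain ⟨hL, hT, hP⟩ := h
  obtain ⟨x', M', hM', rfl⟩ : ∃ x' M', Long {(x', .str)} M' A.type ∧ M = Lam.close x' M' := by
    generalize hP : Lam.lam M = P at hL
    cases hL with
    | @lam _ M' x' _ _ h _ => exact ⟨x', M', h, Lam.lam.inj hP⟩
  rw [Lam.close_inst] at hT hP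
  obtain ⟨K', α', Γ', Y, hY, hα', eY⟩ :=
    (hM'.exists_linkedTyping (Nat.succ_ne_self n) x' (by simp)).1 0
  obtain ⟨⟨y, τ⟩, rfl, hy⟩ := Multiset.map_eq_singleton.1 hY.shape
  obtain ⟨rfl, -⟩ := Prod.mk.inj hy
  have hτ : τ = spanTy n (n + 1) := hY.special _ (Multiset.mem_singleton_self _) rfl
  subst hτ
  obtain ⟨s, hs⟩ := hP α' (hY.typing.rename_one (Γ := 0) (by simp) (by simp))
  have hT' : Typing {(y, spanTy n (n + 1))} M' α := by
    have := hT.rename_one (Γ := 0) (by simp) (y := y) (by simp)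
    rw [Lam.sub_sub, Lam.sub_congr (v := .fvar), Lam.sub_fvar] at this
    · exact this
    · intro z hz
      obtain ⟨p, hp, rfl⟩ := hM'.exists_mem_of_mem_fv z hz
      obtain rfl := Multiset.mem_singleton.1 hp
      simp [Lam.sub, Lam.bind]
  obtain ⟨hα, hsα⟩ := (hM'.fits _ _ hT').1.shape_eq (hs ▸ hα')
  refine ⟨hα, fun v => ?_⟩
  have hα'' : α'.flatten = α.flatten.map (Pos.subst fun v => (s v).firstLeaf) := by
    rw [← hs, ← Ty.flatten_subst]
    congr 1
    refine Ty.subst_congr fun v hv => ?_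
    obtain ⟨p, hp⟩ := hsα v hv
    rw [atomSub, hp]
    rfl
  -- Substitution can merge atoms but not lose occurrences, and no atom occurs more than twice in
  -- the linked typing.
  have h₁ : α.flatten.count (.var v) ≤ 2 := by
    refine (List.count_le_count_map (f := Pos.subst fun v => (s v).firstLeaf)).trans ?_
    rw [← hα'']
    have h₂ := congrArg (Multiset.count ((Pos.var v).subst fun v => (s v).firstLeaf)) eY
    have h₃ := Multiset.nodup_iff_count_le_one.1 hY.nodup
      ((Pos.var v).subst fun v => (s v).firstLeaf)
    rw [Multiset.count_add, Multiset.count_add, Multiset.coe_count] at h₂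
    omega
  -- The type of the word variable contains constants only, so `v` has sign zero in `α` and an even
  -- count.
  have h₂ := hT'.sign_eq v
  have h₃ := Ty.even_sign_add_count v α
  rw [h₂] at h₃
  simp only [Multiset.map_singleton, Multiset.sum_singleton, spanTy, Ty.sign, reduceCtorEq,
    if_false, sub_zero, zero_add] at h₃
  rw [Multiset.coe_count]
  have h₄ : Even (α.flatten.count (.var v)) := by exact_mod_cast h₃
  obtain ⟨r, hr⟩ := h₄
  omega

-- Invariants of derivable hybrid sequents

variable {Sg : Signature}

namespace Hyp

theorem ty_subst (s : ℕ → Ty) (h : Hyp Sg) : (h.subst s).ty = h.ty.subst s := by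
  cases h <;> rfl

theorem name_subst (s : ℕ → Ty) (h : Hyp Sg) : (h.subst s).name = h.name := by
  cases h <;> rfl

theorem name_transl (h : Hyp Sg) : h.transl.1 = h.name := by
  cases h <;> rfl

theorem subst_congr {s u : ℕ → Ty} {h : Hyp Sg}
    (hsu : ∀ v, .var v ∈ h.ty.flatten → s v = u v) : h.subst s = h.subst u := by
  cases h with
  | word => rfl
  | ax x α A => exact congrArg (Hyp.ax x · A) (Ty.subst_congr hsu)

theorem subst_subst (f g : ℕ → Pos) (h : Hyp Sg) :
    (h.subst (atomSub f)).subst (atomSub g) = h.subst (atomSub fun v => (f v).subst g) := by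
  cases h with
  | word => rfl
  | ax x α A => simp only [subst, Ty.subst_atomSub_atomSub]

end Hyp

/-- All occurrences of atomic types in an antecedent. -/
def ctxAtoms (Γ : Multiset (Hyp Sg)) : Multiset Pos :=
  Γ.bind fun h => (h.ty.flatten : Multiset Pos)

theorem seqAtoms_eq (Γ : Multiset (Hyp Sg)) (β : Ty) :
    seqAtoms Γ β = ctxAtoms Γ + (β.flatten : Multiset Pos) := rfl

theorem ctxAtoms_add (Γ Δ : Multiset (Hyp Sg)) : ctxAtoms (Γ + Δ) = ctxAtoms Γ + ctxAtoms Δ :=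
  Multiset.add_bind _ _ _

theorem ctxAtoms_cons (h : Hyp Sg) (Γ : Multiset (Hyp Sg)) :
    ctxAtoms (h ::ₘ Γ) = (h.ty.flatten : Multiset Pos) + ctxAtoms Γ :=
  Multiset.cons_bind _ _ _

theorem ctxAtoms_subst (f : ℕ → Pos) (Γ : Multiset (Hyp Sg)) :
    ctxAtoms (ctxSubst (atomSub f) Γ) = (ctxAtoms Γ).map (Pos.subst f) := by
  simp only [ctxAtoms, ctxSubst, Multiset.bind_map, Multiset.map_bind, Hyp.ty_subst,
    Ty.flatten_subst, Multiset.map_coe]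

theorem seqAtoms_subst (f : ℕ → Pos) (Γ : Multiset (Hyp Sg)) (β : Ty) :
    seqAtoms (ctxSubst (atomSub f) Γ) (β.subst (atomSub f)) =
      (seqAtoms Γ β).map (Pos.subst f) := by
  rw [seqAtoms_eq, seqAtoms_eq, ctxAtoms_subst, Ty.flatten_subst, Multiset.map_add,
    Multiset.map_coe]

theorem mem_ctxAtoms {Γ : Multiset (Hyp Sg)} {p : Pos} :
    p ∈ ctxAtoms Γ ↔ ∃ h ∈ Γ, p ∈ h.ty.flatten := by
  simp [ctxAtoms]

theorem ctxSubst_congr {s u : ℕ → Ty} {Γ : Multiset (Hyp Sg)}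
    (h : ∀ v, .var v ∈ ctxAtoms Γ → s v = u v) : ctxSubst s Γ = ctxSubst u Γ :=
  Multiset.map_congr rfl fun g hg => Hyp.subst_congr fun v hv => h v (mem_ctxAtoms.2 ⟨g, hg, hv⟩)

theorem ctxSubst_add (s : ℕ → Ty) (Γ Δ : Multiset (Hyp Sg)) :
    ctxSubst s (Γ + Δ) = ctxSubst s Γ + ctxSubst s Δ := Multiset.map_add _ _ _

theorem ctxSubst_cons (s : ℕ → Ty) (h : Hyp Sg) (Γ : Multiset (Hyp Sg)) :
    ctxSubst s (h ::ₘ Γ) = h.subst s ::ₘ ctxSubst s Γ := Multiset.map_cons _ _ _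

theorem ctxSubst_ctxSubst (f g : ℕ → Pos) (Γ : Multiset (Hyp Sg)) :
    ctxSubst (atomSub g) (ctxSubst (atomSub f) Γ) =
      ctxSubst (atomSub fun v => (f v).subst g) Γ := by
  simp only [ctxSubst, Multiset.map_map, Function.comp_def, Hyp.subst_subst]

theorem forall_mem_ctxSubst {s : ℕ → Ty} {Γ : Multiset (Hyp Sg)} {P : ℕ → Prop} :
    (∀ g ∈ ctxSubst s Γ, P g.name) ↔ ∀ g ∈ Γ, P g.name := by
  simp [ctxSubst, Hyp.name_subst]

theorem forall_mem_translCtx {Γ : Multiset (Hyp Sg)} {P : ℕ → Prop} :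
    (∀ g ∈ translCtx Γ, P g.1) ↔ ∀ g ∈ Γ, P g.name := by
  simp only [translCtx, Multiset.mem_map, forall_exists_index, and_imp, forall_apply_eq_imp_iff₂,
    Hyp.name_transl]

theorem VarBalanced.add {X Y : Multiset Pos} (hX : VarBalanced X) (hY : VarBalanced Y)
    (h : ∀ v, .var v ∈ X → .var v ∉ Y) : VarBalanced (X + Y) := by
  intro v
  rw [Multiset.count_add]
  by_cases hv : .var v ∈ X
  · rw [Multiset.count_eq_zero.2 (h v hv), add_zero]
    exact hX v
  · rw [Multiset.count_eq_zero.2 hv, zero_add]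
    exact hY v

/-- All hypotheses other than words have types of the form of their Church types. -/
def CtxShape (Γ : Multiset (Hyp Sg)) : Prop := ∀ x α A, Hyp.ax x α A ∈ Γ → α.shape = A.type

theorem CtxShape.subst {Γ : Multiset (Hyp Sg)} (h : CtxShape Γ) (f : ℕ → Pos) :
    CtxShape (ctxSubst (atomSub f) Γ) := by
  intro x α A hα
  obtain ⟨g, hg, e⟩ := Multiset.mem_map.1 hα
  cases g with
  | word => cases e
  | ax y β B =>
    cases e
    rw [Ty.shape_subst]
    exact h _ _ _ hg

theorem CtxShape.add {Γ Δ : Multiset (Hyp Sg)} (hΓ : CtxShape Γ) (hΔ : CtxShape Δ) :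
    CtxShape (Γ + Δ) := fun x α A h => (Multiset.mem_add.1 h).elim (hΓ x α A) (hΔ x α A)

theorem CtxShape.of_cons {g : Hyp Sg} {Γ : Multiset (Hyp Sg)} (h : CtxShape (g ::ₘ Γ)) :
    CtxShape Γ := fun x α A hα => h x α A (Multiset.mem_cons_of_mem hα)

/-- The properties shared by all derivable hybrid sequents. -/
structure Regular (Γ : Multiset (Hyp Sg)) (β : Ty) (B : HForm Sg) : Prop where
  goal : β.shape = B.type
  ctx : CtxShape Γ
  balanced : VarBalanced (seqAtoms Γ β)

/-- Common to `/E` and `\E`: premisses that share no type variables are jointly balanced, and the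
pair `F`, `D` is unified away. -/
theorem Regular.comp {Γ Δ : Multiset (Hyp Sg)} {C D E F : Ty} {A A₁ A₂ : Lambek Sg} {f : ℕ → Pos}
    (h₁ : Regular Γ (.arr F C) (.lbk A₁)) (h₂ : Regular Δ (.arr E D) (.lbk A₂))
    (ha : Apart Γ (.arr F C) Δ (.arr E D)) (hs : IsMGU (atomSub f) F D) :
    Regular (ctxSubst (atomSub f) Γ + ctxSubst (atomSub f) Δ)
      (.arr (E.subst (atomSub f)) (C.subst (atomSub f))) (.lbk A) := by
  obtain ⟨hF, hC⟩ := STy.arr.inj h₁.goal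
  obtain ⟨hE, hD⟩ := STy.arr.inj h₂.goal
  refine ⟨?_, (h₁.ctx.subst f).add (h₂.ctx.subst f), ?_⟩
  · rw [Ty.shape, Ty.shape_subst, Ty.shape_subst, hE, hC]
    rfl
  · rw [← ctxSubst_add, show (Ty.arr (E.subst (atomSub f)) (C.subst (atomSub f))) =
      (Ty.arr E C).subst (atomSub f) from rfl, seqAtoms_subst]
    refine hs.varBalanced (hF.trans hD.symm) ?_
    have := h₁.balanced.add h₂.balanced ha.2
    simp only [seqAtoms_eq, ctxAtoms_add, Ty.flatten, ← Multiset.coe_add] at this ⊢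
    convert this using 1
    abel

theorem Hybrid.regular {Γ : Multiset (Hyp Sg)} {M : Lam 0} {β : Ty} {B : HForm Sg} {t : Lam 0}
    (h : Hybrid Γ M β B t) : Regular Γ β B := by
  induction h with
  | @lex x n A M α₀ α h₀ h =>
    obtain ⟨h₁, h₂⟩ := h.shape_and_varBalanced
    refine ⟨h₁, ?_, fun v => ?_⟩
    · intro y β B hB
      cases Multiset.mem_singleton.1 hB
    · have := h₂ v
      simpa [seqAtoms_eq, ctxAtoms, Hyp.ty, spanTy, Ty.flatten] using this
  | @ax x α A h₁ h₂ =>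
    refine ⟨h₁, ?_, fun v => ?_⟩
    · intro y β B hB
      cases Multiset.mem_singleton.1 hB
      exact h₁
    · simp only [seqAtoms_eq, ctxAtoms, Multiset.singleton_bind, Hyp.ty, Multiset.count_add,
        Multiset.coe_count]
      have := List.nodup_iff_count_le_one.1 h₂.1 (.var v)
      omega
  | overE _ _ ha hs ih₁ ih₂ =>
    obtain ⟨f, rfl⟩ := hs.atomic ((STy.arr.inj ih₁.goal).1.trans (STy.arr.inj ih₂.goal).2.symm)
    exact ih₁.comp ih₂ ha hs
  | underE _ _ ha hs ih₁ ih₂ =>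
    obtain ⟨f, rfl⟩ := hs.atomic ((STy.arr.inj ih₁.goal).1.trans (STy.arr.inj ih₂.goal).2.symm)
    exact ih₁.comp ih₂ ha hs
  | @overI Γ x d M t C D E A B s _ _ hD hs ih =>
    subst hD
    have hC := (STy.arr.inj (ih.ctx _ _ _ (Multiset.mem_cons_self _ _))).2
    obtain ⟨f, rfl⟩ := hs.atomic hC
    refine ⟨?_, ih.ctx.of_cons.subst f, ?_⟩
    · rw [Ty.shape, Ty.shape_subst, Ty.shape_subst, hC, (STy.arr.inj ih.goal).2]
      rfl
    -- The premiss contributes `D`, `C`, `D`, `E`. With `C` rewritten to `D`, the conclusion keeps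
    -- one `D` and `E`, and the unified pair `C`, `D` is what disappears.
    · rw [hs.1, show Ty.arr ((Ty.atom (.var d)).subst (atomSub f)) (E.subst (atomSub f)) =
        (Ty.arr (.atom (.var d)) E).subst (atomSub f) from rfl, seqAtoms_subst]
      refine hs.varBalanced hC ?_
      have := ih.balanced
      simp only [seqAtoms_eq, ctxAtoms_cons, Hyp.ty, Ty.flatten, ← Multiset.coe_add] at this ⊢
      convert this using 1
      abel
  | @underI Γ x d M t C D E A B s _ _ hD hs ih =>
    subst hD
    have hC := (STy.arr.inj (ih.ctx _ _ _ (Multiset.mem_cons_self _ _))).1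
    obtain ⟨f, rfl⟩ := hs.atomic hC
    refine ⟨?_, ih.ctx.of_cons.subst f, ?_⟩
    · rw [Ty.shape, Ty.shape_subst, Ty.shape_subst, hC, (STy.arr.inj ih.goal).1]
      rfl
    · rw [hs.1, show Ty.arr (E.subst (atomSub f)) ((Ty.atom (.var d)).subst (atomSub f)) =
        (Ty.arr E (.atom (.var d))).subst (atomSub f) from rfl, seqAtoms_subst]
      refine hs.varBalanced hC ?_
      have := ih.balanced
      simp only [seqAtoms_eq, ctxAtoms_cons, Hyp.ty, Ty.flatten, ← Multiset.coe_add] at this ⊢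
      convert this using 1
      abel
  | @barE Γ Δ M N t u α β γ A B s _ _ ha hs ih₁ ih₂ =>
    obtain ⟨hβ, hα⟩ := STy.arr.inj ih₁.goal
    obtain ⟨f, rfl⟩ := hs.atomic (hβ.trans ih₂.goal.symm)
    refine ⟨by rw [Ty.shape_subst, hα], (ih₁.ctx.subst f).add (ih₂.ctx.subst f), ?_⟩
    rw [← ctxSubst_add, seqAtoms_subst]
    refine hs.varBalanced (hβ.trans ih₂.goal.symm) ?_
    have := ih₁.balanced.add ih₂.balanced ha.2
    simp only [seqAtoms_eq, ctxAtoms_add, Ty.flatten, ← Multiset.coe_add] at this ⊢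
    convert this using 1
    abel
  | @barI Γ x M t α β A B _ _ ih =>
    refine ⟨?_, ih.ctx.of_cons, ?_⟩
    · rw [Ty.shape, ih.goal, ih.ctx _ _ _ (Multiset.mem_cons_self _ _)]
      rfl
    · have := ih.balanced
      simp only [seqAtoms_eq, ctxAtoms_cons, Hyp.ty, Ty.flatten, ← Multiset.coe_add] at this ⊢
      convert this using 1
      abel

-- From hybrid proofs to MILL1 proofs

theorem Ty.subst_eq_atomSub {α : Ty} {s : ℕ → Ty} (h : (α.subst s).shape = α.shape) :
    α.subst s = α.subst (atomSub fun v => (s v).firstLeaf) := by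
  induction α with
  | atom p =>
    cases p with
    | var v =>
      obtain ⟨p, hp⟩ := eq_atom_of_shape h
      change s v = atom (s v).firstLeaf
      change s v = atom p at hp
      rw [hp]
      rfl
    | const c => rfl
  | arr β α ihβ ihα =>
    simp only [subst, shape, STy.arr.injEq] at h
    simp only [subst]
    rw [ihβ h.1, ihα h.2]

theorem Hyp.transl_subst {h : Hyp Sg} (hh : ∀ x α A, h = .ax x α A → α.shape = A.type)
    (f : ℕ → Pos) :
    (h.subst (atomSub f)).transl = (h.transl.1, h.transl.2.sub (Pos.subst f)) := by
  cases h with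
  | word x n A M α =>
    simp only [subst, transl]
    rw [MForm.sub_congr (g := id), MForm.sub_id]
    · exact fun c => rfl
    · exact fun v hv => absurd hv (MForm.freeVars_closure _ _)
  | ax x α A =>
    simp only [subst, transl, Ty.flatten_subst]
    rw [HForm.transl_sub]
    rw [Ty.length_flatten, hh _ _ _ rfl]

theorem translCtx_subst {Γ : Multiset (Hyp Sg)} (hΓ : CtxShape Γ) (f : ℕ → Pos) :
    translCtx (ctxSubst (atomSub f) Γ) = MForm.ctxSub (Pos.subst f) (translCtx Γ) := by
  simp only [translCtx, ctxSubst, MForm.ctxSub, Multiset.map_map, Function.comp_def]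
  refine Multiset.map_congr rfl fun h hh => Hyp.transl_subst ?_ f
  rintro x α A rfl
  exact hΓ _ _ _ hh

theorem translCtx_add (Γ Δ : Multiset (Hyp Sg)) :
    translCtx (Γ + Δ) = translCtx Γ + translCtx Δ := Multiset.map_add _ _ _

theorem translCtx_cons (h : Hyp Sg) (Γ : Multiset (Hyp Sg)) :
    translCtx (h ::ₘ Γ) = h.transl ::ₘ translCtx Γ := Multiset.map_cons _ _ _

theorem MILL1.subst_transl {Γ : Multiset (Hyp Sg)} (hΓ : CtxShape Γ) {β : Ty} {B : HForm Sg}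
    (hβ : β.shape = B.type) {t : Lam 0} (h : MILL1 (translCtx Γ) (B.transl β.flatten) t)
    (f : ℕ → Pos) :
    MILL1 (translCtx (ctxSubst (atomSub f) Γ)) (B.transl (β.subst (atomSub f)).flatten) t := by
  rw [translCtx_subst hΓ, Ty.flatten_subst, ← HForm.transl_sub]
  · exact h.sub _
  · rw [Ty.length_flatten, hβ]

/-- The body of the quantified formula `‖A / B‖^{[C,D]}`. -/
def Lambek.slashBody (A B : Lambek Sg) (C D : Pos) : MForm Sg 1 :=
  .imp (B.transl (Trm.pos D) (.bvar 0)) (A.transl (.pos C) (.bvar 0))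

/-- The body of the quantified formula `‖B \ A‖^{[C,D]}`. -/
def Lambek.backslashBody (B A : Lambek Sg) (C D : Pos) : MForm Sg 1 :=
  .imp (B.transl (.bvar 0) (Trm.pos C)) (A.transl (.bvar 0) (.pos D))

theorem Lambek.slashBody_inst (A B : Lambek Sg) (C D p : Pos) :
    (slashBody A B C D).inst p =
      .imp ((HForm.lbk B).transl [D, p]) ((HForm.lbk A).transl [C, p]) := by
  simp only [slashBody, MForm.inst, MForm.bind, Lambek.transl_bind]
  rfl

theorem Lambek.backslashBody_inst (B A : Lambek Sg) (C D p : Pos) :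
    (backslashBody B A C D).inst p =
      .imp ((HForm.lbk B).transl [p, C]) ((HForm.lbk A).transl [p, D]) := by
  simp only [backslashBody, MForm.inst, MForm.bind, Lambek.transl_bind]
  rfl

theorem forall_ne_translCtx {Γ Δ : Multiset (Hyp Sg)}
    (h : ∀ g ∈ Γ, ∀ d ∈ Δ, g.name ≠ d.name) :
    ∀ p ∈ translCtx Γ, ∀ q ∈ translCtx Δ, p.1 ≠ q.1 := by
  intro p hp q hq
  obtain ⟨g, hg, rfl⟩ := Multiset.mem_map.1 hp
  obtain ⟨d, hd, rfl⟩ := Multiset.mem_map.1 hq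
  rw [Hyp.name_transl, Hyp.name_transl]
  exact h g hg d hd

theorem forall_ne_ctxSubst {s : ℕ → Ty} {Γ Δ : Multiset (Hyp Sg)}
    (h : ∀ g ∈ Γ, ∀ d ∈ Δ, g.name ≠ d.name) :
    ∀ g ∈ ctxSubst s Γ, ∀ d ∈ ctxSubst s Δ, g.name ≠ d.name := by
  intro p hp q hq
  obtain ⟨g, hg, rfl⟩ := Multiset.mem_map.1 hp
  obtain ⟨d, hd, rfl⟩ := Multiset.mem_map.1 hq
  rw [Hyp.name_subst, Hyp.name_subst]
  exact h g hg d hd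

theorem exists_fresh_forall (Γ : Multiset (ℕ × MForm Sg 0)) (A : MForm Sg 1) :
    ∃ y, y ∉ MForm.ctxFreeVars Γ ∧ y ∉ A.freeVars := by
  obtain ⟨y, hy⟩ := Infinite.exists_notMem_finset
    ((MForm.ctxFreeVars Γ).toFinset ∪ A.freeVars.toFinset)
  simp only [Finset.mem_union, Multiset.mem_toFinset, List.mem_toFinset, not_or] at hy
  exact ⟨y, hy⟩

theorem MILL1.bar_transl_iff {Γ : Multiset (ℕ × MForm Sg 0)} {A B : HForm Sg} {α β : Ty}
    (hα : α.shape = A.type) {t : Lam 0} :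
    MILL1 Γ ((HForm.bar A B).transl (Ty.arr β α).flatten) t ↔
      MILL1 Γ (.imp (B.transl β.flatten) (A.transl α.flatten)) t := by
  have hl : α.flatten.length = A.type.length := by rw [Ty.length_flatten, hα]
  rw [HForm.transl, Ty.flatten, ← hl, List.take_left, List.drop_left]

theorem Hybrid.sound {Γ : Multiset (Hyp Sg)} {M : Lam 0} {β : Ty} {B : HForm Sg} {t : Lam 0}
    (h : Hybrid Γ M β B t) : MILL1 (translCtx Γ) (B.transl β.flatten) t := by
  induction h with
  | @lex x n A M α₀ α h₀ h =>
    -- The hypothesis and the succedent may carry different principal types; the quantifiers of the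
    -- closure are instantiated to pass from one to the other.
    obtain ⟨s, rfl⟩ := h₀.2.2 α h.2.1
    have hA := h₀.shape_and_varBalanced.1
    rw [Ty.subst_eq_atomSub (h.shape_and_varBalanced.1.trans hA.symm), Ty.flatten_subst,
      ← HForm.transl_sub _ _ _ (by rw [Ty.length_flatten, hA])]
    exact MILL1.closure_elim (.ax _ _) _ fun c => rfl
  | ax h₁ h₂ => exact .ax _ _
  | overE h₁ h₂ ha hs ih₁ ih₂ =>
    have r₁ := h₁.regular
    have r₂ := h₂.regular
    obtain ⟨F, C, e⟩ := Ty.eq_of_shape_str r₁.goal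
    obtain ⟨rfl, rfl⟩ := Ty.arr.inj e
    obtain ⟨E, D, e⟩ := Ty.eq_of_shape_str r₂.goal
    obtain ⟨rfl, rfl⟩ := Ty.arr.inj e
    obtain ⟨f, rfl⟩ := IsMGU.atomic (by rfl) hs
    have hFD := hs.1
    have i₁ := MILL1.subst_transl r₁.ctx r₁.goal ih₁ f
    have i₂ := MILL1.subst_transl r₂.ctx r₂.goal ih₂ f
    simp only [Ty.atom_subst, Ty.atom.injEq, Ty.subst, Ty.flatten, List.singleton_append]
      at hFD i₁ i₂ ⊢
    -- The quantified position is where the argument string ends; its start fits the functor since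
    -- `f` unifies `F` and `D`.
    have i₃ := MILL1.allE (A := Lambek.slashBody _ _ _ _) (E.subst f) i₁
    rw [Lambek.slashBody_inst, hFD] at i₃
    rw [translCtx_add]
    exact .impE i₃ i₂ (forall_ne_translCtx (forall_ne_ctxSubst ha.1))
  | underE h₁ h₂ ha hs ih₁ ih₂ =>
    have r₁ := h₁.regular
    have r₂ := h₂.regular
    obtain ⟨F, C, e⟩ := Ty.eq_of_shape_str r₁.goal
    obtain ⟨rfl, rfl⟩ := Ty.arr.inj e
    obtain ⟨E, D, e⟩ := Ty.eq_of_shape_str r₂.goal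
    obtain ⟨rfl, rfl⟩ := Ty.arr.inj e
    obtain ⟨f, rfl⟩ := IsMGU.atomic (by rfl) hs
    have hFD := hs.1
    have i₁ := MILL1.subst_transl r₁.ctx r₁.goal ih₁ f
    have i₂ := MILL1.subst_transl r₂.ctx r₂.goal ih₂ f
    simp only [Ty.atom_subst, Ty.atom.injEq, Ty.subst, Ty.flatten, List.singleton_append]
      at hFD i₁ i₂ ⊢
    have i₃ := MILL1.allE (A := Lambek.backslashBody _ _ _ _) (C.subst f) i₂
    rw [Lambek.backslashBody_inst, ← hFD] at i₃
    rw [translCtx_add, add_comm]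
    exact .impE i₃ i₁ (forall_ne_translCtx (forall_ne_ctxSubst fun g hg d hd =>
      (ha.1 d hd g hg).symm))
  | @overI Γ x d M t C D E A B s h hx hD hs ih =>
    subst hD
    have r := h.regular
    obtain ⟨C, rfl⟩ := Ty.eq_atom_of_shape
      (STy.arr.inj (r.ctx _ _ _ (Multiset.mem_cons_self _ _))).2
    obtain ⟨E, rfl⟩ := Ty.eq_atom_of_shape (STy.arr.inj r.goal).2
    obtain ⟨f, rfl⟩ := IsMGU.atomic (by rfl) hs
    -- `d` already occurs twice, in the discharged hypothesis and in the succedent, so it is absent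
    -- from `Γ`, `C` and `E`.
    have hbal := r.balanced d
    simp only [seqAtoms_eq, ctxAtoms_cons, Hyp.ty, Ty.flatten, List.singleton_append,
      ← Multiset.cons_coe, Multiset.coe_nil, Multiset.count_add, Multiset.count_cons,
      Multiset.count_zero, if_true] at hbal
    have hdΓ : Pos.var d ∉ ctxAtoms Γ := fun hd => by
      have := Multiset.count_pos.2 hd
      omega
    have hdC : C ≠ .var d := by
      rintro rfl
      simp only [if_true] at hbal
      omega
    have hdE : E ≠ .var d := by
      rintro rfl
      simp only [if_true] at hbal
      omega
    obtain ⟨y, hy₁, hy₂⟩ := exists_fresh_forall (translCtx (ctxSubst (atomSub f) Γ))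
      (Lambek.slashBody A B (E.subst f) (C.subst f))
    have hθ : ∀ p : Pos, p ≠ .var d → p.subst (Function.update f d (.var y)) = p.subst f := by
      rintro (v | c) hp
      · have : v ≠ d := fun e => hp (by rw [e])
        simp [Pos.subst, this]
      · rfl
    -- The unifier would identify `d` with `C`. Sending `d` to the eigenvariable `y` instead changes
    -- nothing in `Γ`, `C` and `E`.
    have i := MILL1.subst_transl r.ctx r.goal ih (Function.update f d (.var y))
    rw [ctxSubst_cons, translCtx_cons, ctxSubst_congr (u := atomSub f)] at i
    · simp only [Hyp.subst, Hyp.transl, Ty.atom_subst, Ty.subst, Ty.flatten,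
        List.singleton_append, hθ _ hdC, hθ _ hdE] at i ⊢
      simp only [atomSub, Function.update_self, Ty.flatten] at i
      refine MILL1.allI (A := Lambek.slashBody _ _ _ _) y ?_ hy₁ hy₂
      rw [Lambek.slashBody_inst]
      exact .impI i (forall_mem_translCtx (P := (· ≠ x)).2
        (forall_mem_ctxSubst (P := (· ≠ x)).2 hx))
    · intro v hv
      have : v ≠ d := fun e => hdΓ (e ▸ hv)
      simp [atomSub, this]
  | @underI Γ x d M t C D E A B s h hx hD hs ih =>
    subst hD
    have r := h.regular
    obtain ⟨C, rfl⟩ := Ty.eq_atom_of_shape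
      (STy.arr.inj (r.ctx _ _ _ (Multiset.mem_cons_self _ _))).1
    obtain ⟨E, rfl⟩ := Ty.eq_atom_of_shape (STy.arr.inj r.goal).1
    obtain ⟨f, rfl⟩ := IsMGU.atomic (by rfl) hs
    have hbal := r.balanced d
    simp only [seqAtoms_eq, ctxAtoms_cons, Hyp.ty, Ty.flatten, List.singleton_append,
      ← Multiset.cons_coe, Multiset.coe_nil, Multiset.count_add, Multiset.count_cons,
      Multiset.count_zero, if_true] at hbal
    have hdΓ : Pos.var d ∉ ctxAtoms Γ := fun hd => by
      have := Multiset.count_pos.2 hd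
      omega
    have hdC : C ≠ .var d := by
      rintro rfl
      simp only [if_true] at hbal
      omega
    have hdE : E ≠ .var d := by
      rintro rfl
      simp only [if_true] at hbal
      omega
    obtain ⟨y, hy₁, hy₂⟩ := exists_fresh_forall (translCtx (ctxSubst (atomSub f) Γ))
      (Lambek.backslashBody B A (C.subst f) (E.subst f))
    have hθ : ∀ p : Pos, p ≠ .var d → p.subst (Function.update f d (.var y)) = p.subst f := by
      rintro (v | c) hp
      · have : v ≠ d := fun e => hp (by rw [e])
        simp [Pos.subst, this]
      · rfl
    have i := MILL1.subst_transl r.ctx r.goal ih (Function.update f d (.var y))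
    rw [ctxSubst_cons, translCtx_cons, ctxSubst_congr (u := atomSub f)] at i
    · simp only [Hyp.subst, Hyp.transl, Ty.atom_subst, Ty.subst, Ty.flatten,
        List.singleton_append, hθ _ hdC, hθ _ hdE] at i ⊢
      simp only [atomSub, Function.update_self, Ty.flatten, List.singleton_append] at i
      refine MILL1.allI (A := Lambek.backslashBody _ _ _ _) y ?_ hy₁ hy₂
      rw [Lambek.backslashBody_inst]
      exact .impI i (forall_mem_translCtx (P := (· ≠ x)).2
        (forall_mem_ctxSubst (P := (· ≠ x)).2 hx))
    · intro v hv
      have : v ≠ d := fun e => hdΓ (e ▸ hv)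
      simp [atomSub, this]
  | @barE Γ Δ M N t u α β γ A B s h₁ h₂ ha hs ih₁ ih₂ =>
    have r₁ := h₁.regular
    have r₂ := h₂.regular
    obtain ⟨hβ, hα⟩ := STy.arr.inj r₁.goal
    obtain ⟨f, rfl⟩ := hs.atomic (hβ.trans r₂.goal.symm)
    have i₁ := MILL1.subst_transl r₁.ctx r₁.goal ih₁ f
    have i₂ := MILL1.subst_transl r₂.ctx r₂.goal ih₂ f
    rw [Ty.subst, MILL1.bar_transl_iff (by rw [Ty.shape_subst, hα]), hs.1] at i₁
    rw [translCtx_add]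
    exact .impE i₁ i₂ (forall_ne_translCtx (forall_ne_ctxSubst ha.1))
  | @barI Γ x M t α β A B h hx ih =>
    rw [MILL1.bar_transl_iff h.regular.goal]
    rw [translCtx_cons] at ih
    exact .impI ih (forall_mem_translCtx (P := (· ≠ x)).2 hx)

-- Renaming type variables in hybrid proofs

theorem ctxSubst_ctxSubst_ty (s u : ℕ → Ty) (Γ : Multiset (Hyp Sg)) :
    ctxSubst u (ctxSubst s Γ) = ctxSubst (fun v => (s v).subst u) Γ := by
  rw [ctxSubst, ctxSubst, Multiset.map_map]
  refine Multiset.map_congr rfl fun h _ => ?_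
  cases h with
  | word => rfl
  | ax x α A => simp only [Function.comp_apply, Hyp.subst, Ty.subst_subst]

/-- A renaming of type variables, as a substitution. -/
def renSub (ρ : ℕ → ℕ) : ℕ → Ty := atomSub fun v => .var (ρ v)

theorem Ty.subst_renSub_subst {ρ ρ' : ℕ → ℕ} (h : Function.LeftInverse ρ' ρ) (u : ℕ → Ty)
    (α : Ty) : (α.subst (renSub ρ)).subst (fun v => u (ρ' v)) = α.subst u := by
  rw [subst_subst]
  congr 1
  funext v
  exact congrArg u (h v)

theorem IsMGU.rename {s : ℕ → Ty} {α β : Ty} (h : IsMGU s α β) {ρ : ℕ → ℕ}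
    (hρ : Function.Injective ρ) : IsMGU (fun v => (s v).subst (renSub ρ)) α β := by
  refine ⟨?_, fun t ht => ?_⟩
  · rw [← Ty.subst_subst, ← Ty.subst_subst, h.1]
  · obtain ⟨u, hu⟩ := h.2 t ht
    obtain ⟨ρ', hρ'⟩ := hρ.hasLeftInverse
    exact ⟨fun v => u (ρ' v), fun v => by rw [hu v, Ty.subst_renSub_subst hρ']⟩

theorem IsLexical.rename {x n : ℕ} {A : HForm Sg} {M : Lam 1} {α : Ty} (h : IsLexical x n A M α)
    {ρ : ℕ → ℕ} (hρ : Function.Injective ρ) : IsLexical x n A M (α.subst (renSub ρ)) := by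
  refine ⟨h.1, ?_, fun β hβ => ?_⟩
  · have := h.2.1.subst (renSub ρ)
    rwa [Multiset.map_singleton] at this
  · obtain ⟨s, hs⟩ := h.2.2 β hβ
    obtain ⟨ρ', hρ'⟩ := hρ.hasLeftInverse
    exact ⟨fun v => s (ρ' v), by rw [Ty.subst_renSub_subst hρ', hs]⟩

/-- Most general unifiers are closed under injective renaming, so it suffices to change the unifier
of the last rule; only `|I`, which has none, recurs. -/
theorem Hybrid.rename {Γ : Multiset (Hyp Sg)} {M : Lam 0} {β : Ty} {B : HForm Sg} {t : Lam 0}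
    (h : Hybrid Γ M β B t) {ρ : ℕ → ℕ} (hρ : Function.Injective ρ) :
    Hybrid (ctxSubst (renSub ρ) Γ) M (β.subst (renSub ρ)) B t := by
  induction h with
  | lex h₀ h => exact .lex h₀ (h.rename hρ)
  | ax h₁ h₂ =>
    refine .ax (by rw [renSub, Ty.shape_subst, h₁]) ⟨?_, ?_⟩
    · rw [renSub, Ty.flatten_subst]
      refine h₂.1.map_on ?_
      intro p hp q hq e
      obtain ⟨v, rfl⟩ := h₂.2 p hp
      obtain ⟨w, rfl⟩ := h₂.2 q hq
      rw [hρ (Pos.var.inj e)]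
    · intro p hp
      rw [renSub, Ty.flatten_subst] at hp
      obtain ⟨q, hq, rfl⟩ := List.mem_map.1 hp
      obtain ⟨v, rfl⟩ := h₂.2 q hq
      exact ⟨ρ v, rfl⟩
  | overE h₁ h₂ ha hs =>
    rw [ctxSubst_add, ctxSubst_ctxSubst_ty, ctxSubst_ctxSubst_ty]
    simp only [Ty.subst, Ty.subst_subst]
    exact .overE h₁ h₂ ha (hs.rename hρ)
  | underE h₁ h₂ ha hs =>
    rw [ctxSubst_add, ctxSubst_ctxSubst_ty, ctxSubst_ctxSubst_ty]
    simp only [Ty.subst, Ty.subst_subst]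
    exact .underE h₁ h₂ ha (hs.rename hρ)
  | overI h hx hD hs =>
    rw [ctxSubst_ctxSubst_ty]
    simp only [Ty.subst, Ty.subst_subst]
    exact .overI h hx hD (hs.rename hρ)
  | underI h hx hD hs =>
    rw [ctxSubst_ctxSubst_ty]
    simp only [Ty.subst, Ty.subst_subst]
    exact .underI h hx hD (hs.rename hρ)
  | barE h₁ h₂ ha hs =>
    rw [ctxSubst_add, ctxSubst_ctxSubst_ty, ctxSubst_ctxSubst_ty]
    simp only [Ty.subst_subst]
    exact .barE h₁ h₂ ha (hs.rename hρ)
  | barI h hx ih =>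
    rw [ctxSubst_cons] at ih
    exact .barI ih (forall_mem_ctxSubst (P := (· ≠ _)).2 hx)

-- Instances of derivable sequents

/-- The antecedents share no term variables. -/
def CtxDisjoint (Γ Δ : Multiset (Hyp Sg)) : Prop := ∀ g ∈ Γ, ∀ d ∈ Δ, g.name ≠ d.name

/-- The sequent `Γ ⊢ B` of type `β` is an instance, under a substitution of atomic types for type
variables, of a sequent with a hybrid proof whose semantic term is `t` up to `βη`. -/
def HybridInstance (Γ : Multiset (Hyp Sg)) (β : Ty) (B : HForm Sg) (t : Lam 0) : Prop :=
  ∃ Γ₀ M β₀ t₀ f, Hybrid Γ₀ M β₀ B t₀ ∧ BetaEta t₀ t ∧ ctxSubst (atomSub f) Γ₀ = Γ ∧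
    β₀.subst (atomSub f) = β

theorem exists_var_bound (X : Multiset Pos) : ∃ K, ∀ v, .var v ∈ X → v < K := by
  induction X using Multiset.induction_on with
  | empty => exact ⟨0, by simp⟩
  | cons p X ih =>
    obtain ⟨K, hK⟩ := ih
    cases p with
    | var w =>
      refine ⟨max K (w + 1), fun v hv => ?_⟩
      rcases Multiset.mem_cons.1 hv with h | h
      · cases h
        omega
      · have := hK v h
        omega
    | const c => exact ⟨K, fun v hv => hK v (by simpa using hv)⟩

theorem Ty.exists_generic (α : Ty) (K : ℕ) : ∃ (K' : ℕ) (α₀ : Ty) (f : ℕ → Pos),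
    K ≤ K' ∧ α₀.shape = α.shape ∧
    α₀.flatten.Nodup ∧ (∀ p ∈ α₀.flatten, ∃ v, p = .var v ∧ K ≤ v ∧ v < K') ∧
    α₀.subst (atomSub f) = α := by
  induction α generalizing K with
  | atom p =>
    refine ⟨K + 1, .atom (.var K), fun _ => p, K.le_succ, rfl, by simp [flatten], ?_, rfl⟩
    intro q hq
    exact ⟨K, by simpa [flatten] using hq, le_rfl, K.lt_succ_self⟩
  | arr β α ihβ ihα =>
    obtain ⟨K₁, β₀, f₁, hK₁, hs₁, hn₁, hm₁, rfl⟩ := ihβ K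
    obtain ⟨K₂, α₀, f₂, hK₂, hs₂, hn₂, hm₂, rfl⟩ := ihα K₁
    refine ⟨K₂, arr β₀ α₀, fun v => if v < K₁ then f₁ v else f₂ v, hK₁.trans hK₂,
      by simp [shape, hs₁, hs₂], ?_, ?_, ?_⟩
    · refine List.nodup_append'.2 ⟨hn₂, hn₁, ?_⟩
      intro p hp hq
      obtain ⟨v, rfl, hv⟩ := hm₂ p hp
      obtain ⟨w, hw, hw'⟩ := hm₁ _ hq
      cases hw
      omega
    · intro p hp
      rcases List.mem_append.1 hp with hp | hp
      · obtain ⟨v, rfl, hv⟩ := hm₂ p hp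
        exact ⟨v, rfl, by omega, by omega⟩
      · obtain ⟨v, rfl, hv⟩ := hm₁ p hp
        exact ⟨v, rfl, by omega, by omega⟩
    · simp only [subst]
      congr 1
      · refine subst_congr fun v hv => ?_
        obtain ⟨w, hw, hw'⟩ := hm₁ _ hv
        cases hw
        simp [atomSub, hw'.2]
      · refine subst_congr fun v hv => ?_
        obtain ⟨w, hw, hw'⟩ := hm₂ _ hv
        cases hw
        simp [atomSub, hw'.1]

namespace HybridInstance

variable {Γ Δ : Multiset (Hyp Sg)} {t u : Lam 0}

theorem betaEta {β : Ty} {B : HForm Sg} (h : HybridInstance Γ β B t) (htu : BetaEta t u) :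
    HybridInstance Γ β B u := by
  obtain ⟨Γ₀, M, β₀, t₀, f, h, ht, h'⟩ := h
  exact ⟨Γ₀, M, β₀, t₀, f, h, ht.trans htu, h'⟩

theorem ax (x : ℕ) {α : Ty} {A : HForm Sg} (h : α.shape = A.type) :
    HybridInstance {.ax x α A} α A (.fvar x) := by
  obtain ⟨K, α₀, f, -, hs, hn, hm, rfl⟩ := α.exists_generic 0
  refine ⟨{.ax x α₀ A}, _, α₀, .fvar x, f, .ax (hs.trans h) ⟨hn, fun p hp => ?_⟩, .refl _, rfl, rfl⟩
  obtain ⟨v, hv, -⟩ := hm p hp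
  exact ⟨v, hv⟩

theorem lex {x n : ℕ} {A : HForm Sg} {M : Lam 1} {α : Ty} (h : IsLexical x n A M α)
    (f : ℕ → Pos) :
    HybridInstance {.word x n A M α} (α.subst (atomSub f)) A (.fvar x) :=
  ⟨_, _, _, _, f, .lex h h, .refl _, rfl, rfl⟩

/-- The variables of the first proof are shifted past a bound `K` for those of the second; then the
two instantiations can be glued at `K`. -/
theorem pair {β γ : Ty} {A B : HForm Sg} (h₁ : HybridInstance Γ β A t)
    (h₂ : HybridInstance Δ γ B u) (hd : CtxDisjoint Γ Δ) :
    ∃ Γ₀ M β₀ t₀ Δ₀ N γ₀ u₀ f, Hybrid Γ₀ M β₀ A t₀ ∧ Hybrid Δ₀ N γ₀ B u₀ ∧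
      Apart Γ₀ β₀ Δ₀ γ₀ ∧ BetaEta t₀ t ∧ BetaEta u₀ u ∧
      ctxSubst (atomSub f) Γ₀ = Γ ∧ β₀.subst (atomSub f) = β ∧
      ctxSubst (atomSub f) Δ₀ = Δ ∧ γ₀.subst (atomSub f) = γ := by
  obtain ⟨Γ₀, M, β₀, t₀, f₁, h₁, ht, rfl, rfl⟩ := h₁
  obtain ⟨Δ₀, N, γ₀, u₀, f₂, h₂, hu, rfl, rfl⟩ := h₂
  obtain ⟨K, hK⟩ := exists_var_bound (seqAtoms Δ₀ γ₀)
  have hf : ∀ v, (fun v => if v < K then f₂ v else f₁ (v - K)) (v + K) = f₁ v := fun v => by simp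
  have hf' : ∀ v, .var v ∈ seqAtoms Δ₀ γ₀ →
      atomSub (fun v => if v < K then f₂ v else f₁ (v - K)) v = atomSub f₂ v := fun v hv => by
    simp [atomSub, hK v hv]
  refine ⟨_, M, _, t₀, Δ₀, N, γ₀, u₀, fun v => if v < K then f₂ v else f₁ (v - K),
    h₁.rename (add_left_injective K), h₂, ⟨?_, ?_⟩, ht, hu, ?_, ?_, ?_, ?_⟩
  · intro g hg d hd'
    obtain ⟨g, hg₀, rfl⟩ := Multiset.mem_map.1 hg
    rw [Hyp.name_subst, ← Hyp.name_subst (atomSub f₁) g, ← Hyp.name_subst (atomSub f₂) d]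
    exact hd _ (Multiset.mem_map_of_mem _ hg₀) _ (Multiset.mem_map_of_mem _ hd')
  · intro v hv hv'
    rw [renSub, seqAtoms_subst] at hv
    obtain ⟨p, -, hp⟩ := Multiset.mem_map.1 hv
    cases p with
    | var w =>
      cases hp
      have := hK _ hv'
      omega
    | const c => cases hp
  · rw [renSub, ctxSubst_ctxSubst]
    simp only [Pos.subst, hf]
  · rw [renSub, Ty.subst_atomSub_atomSub]
    simp only [Pos.subst, hf]
  · exact ctxSubst_congr fun v hv => hf' v (Multiset.mem_add.2 (.inl hv))
  · exact Ty.subst_congr fun v hv => hf' v (Multiset.mem_add.2 (.inr hv))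

theorem ctxSubst_factor {f g u : ℕ → Pos} (h : ∀ v, f v = (g v).subst u)
    (Γ : Multiset (Hyp Sg)) :
    ctxSubst (atomSub u) (ctxSubst (atomSub g) Γ) = ctxSubst (atomSub f) Γ := by
  rw [ctxSubst_ctxSubst]
  simp only [← h]

theorem subst_factor {f g u : ℕ → Pos} (h : ∀ v, f v = (g v).subst u) (α : Ty) :
    (α.subst (atomSub g)).subst (atomSub u) = α.subst (atomSub f) := by
  rw [Ty.subst_atomSub_atomSub]
  simp only [← h]

/-- The common instantiation unifies the types in question, hence factors through a most general
unifier; the remaining factor exhibits the sequent as an instance of the conclusion of the rule. -/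
theorem overE {C E F : Ty} {A B : Lambek Sg}
    (h₁ : HybridInstance Γ (.arr F C) (.lbk (.slash A B)) t)
    (h₂ : HybridInstance Δ (.arr E F) (.lbk B) u) (hd : CtxDisjoint Γ Δ) :
    HybridInstance (Γ + Δ) (.arr E C) (.lbk A) (.app t u) := by
  obtain ⟨Γ₀, M, β₀, t₀, Δ₀, N, γ₀, u₀, f, i₁, i₂, ha, ht, hu, rfl, e₁, rfl, e₂⟩ := h₁.pair h₂ hd
  obtain ⟨F₀, C₀, rfl, eF, rfl⟩ := Ty.eq_arr_of_subst e₁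
  obtain ⟨E₀, D₀, rfl, rfl, eD⟩ := Ty.eq_arr_of_subst e₂
  obtain ⟨g, hg⟩ := exists_isMGU ((STy.arr.inj i₁.regular.goal).1.trans
    (STy.arr.inj i₂.regular.goal).2.symm) (eF.trans eD.symm)
  obtain ⟨w, hw⟩ := hg.factor (eF.trans eD.symm)
  refine ⟨_, _, _, _, w, .overE i₁ i₂ ha hg, .app ht hu, ?_, ?_⟩
  · rw [ctxSubst_add, ctxSubst_factor hw, ctxSubst_factor hw]
  · rw [Ty.subst, subst_factor hw, subst_factor hw]

theorem underE {C E F : Ty} {A B : Lambek Sg}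
    (h₁ : HybridInstance Γ (.arr F C) (.lbk B) u)
    (h₂ : HybridInstance Δ (.arr E F) (.lbk (.backslash B A)) t) (hd : CtxDisjoint Γ Δ) :
    HybridInstance (Γ + Δ) (.arr E C) (.lbk A) (.app t u) := by
  obtain ⟨Γ₀, M, β₀, t₀, Δ₀, N, γ₀, u₀, f, i₁, i₂, ha, ht, hu, rfl, e₁, rfl, e₂⟩ := h₁.pair h₂ hd
  obtain ⟨F₀, C₀, rfl, eF, rfl⟩ := Ty.eq_arr_of_subst e₁
  obtain ⟨E₀, D₀, rfl, rfl, eD⟩ := Ty.eq_arr_of_subst e₂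
  obtain ⟨g, hg⟩ := exists_isMGU ((STy.arr.inj i₁.regular.goal).1.trans
    (STy.arr.inj i₂.regular.goal).2.symm) (eF.trans eD.symm)
  obtain ⟨w, hw⟩ := hg.factor (eF.trans eD.symm)
  refine ⟨_, _, _, _, w, .underE i₁ i₂ ha hg, .app hu ht, ?_, ?_⟩
  · rw [ctxSubst_add, ctxSubst_factor hw, ctxSubst_factor hw]
  · rw [Ty.subst, subst_factor hw, subst_factor hw]

theorem barE {α β : Ty} {A B : HForm Sg} (h₁ : HybridInstance Γ (.arr β α) (.bar A B) t)
    (h₂ : HybridInstance Δ β B u) (hd : CtxDisjoint Γ Δ) :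
    HybridInstance (Γ + Δ) α A (.app t u) := by
  obtain ⟨Γ₀, M, β₀, t₀, Δ₀, N, γ₀, u₀, f, i₁, i₂, ha, ht, hu, rfl, e₁, rfl, e₂⟩ := h₁.pair h₂ hd
  obtain ⟨β₁, α₁, rfl, rfl, rfl⟩ := Ty.eq_arr_of_subst e₁
  obtain ⟨g, hg⟩ := exists_isMGU ((STy.arr.inj i₁.regular.goal).1.trans i₂.regular.goal.symm)
    e₂.symm
  obtain ⟨w, hw⟩ := hg.factor e₂.symm
  refine ⟨_, _, _, _, w, .barE i₁ i₂ ha hg, .app ht hu, ?_, ?_⟩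
  · rw [ctxSubst_add, ctxSubst_factor hw, ctxSubst_factor hw]
  · rw [subst_factor hw]

theorem exists_cons_of_ctxSubst {s : ℕ → Ty} {Γ₀ : Multiset (Hyp Sg)} {x : ℕ} {τ : Ty}
    {B : HForm Sg} (h : ctxSubst s Γ₀ = .ax x τ B ::ₘ Γ) :
    ∃ τ₀ Γ₁, Γ₀ = .ax x τ₀ B ::ₘ Γ₁ ∧ τ₀.subst s = τ ∧ ctxSubst s Γ₁ = Γ := by
  classical
  obtain ⟨g, hg, e₁, e₂⟩ := (Multiset.map_eq_cons _ _ _ _).2 h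
  cases g with
  | word => cases e₁
  | ax y τ₀ B₀ =>
    cases e₁
    exact ⟨τ₀, _, (Multiset.cons_erase hg).symm, rfl, e₂⟩

theorem barI {x : ℕ} {α β : Ty} {A B : HForm Sg}
    (h : HybridInstance (.ax x β B ::ₘ Γ) α A t) (hx : ∀ g ∈ Γ, g.name ≠ x) :
    HybridInstance Γ (.arr β α) (.bar A B) (Lam.lambda x t) := by
  obtain ⟨Γ₀, M, α₀, t₀, f, h, ht, e, rfl⟩ := h
  obtain ⟨β₀, Γ₀, rfl, rfl, rfl⟩ := exists_cons_of_ctxSubst e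
  exact ⟨Γ₀, _, _, _, f, .barI h (forall_mem_ctxSubst (P := (· ≠ x)).1 hx), ht.lambda x, rfl, rfl⟩

theorem exists_atom_of_subst {f : ℕ → Pos} {τ : Ty} {p : Pos}
    (h : τ.subst (atomSub f) = .atom p) : ∃ q, τ = .atom q ∧ q.subst f = p := by
  cases τ with
  | atom q =>
    rw [Ty.atom_subst] at h
    exact ⟨q, rfl, Ty.atom.inj h⟩
  | arr _ _ => cases h

theorem exists_var_of_subst {f : ℕ → Pos} {q : Pos} {d : ℕ} (h : q.subst f = .var d) :
    ∃ v, q = .var v ∧ f v = .var d := by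
  cases q with
  | var v => exact ⟨v, rfl, h⟩
  | const c => cases h

/-- In a balanced sequent, a type variable `d` all of whose instances stem from two given
occurrences occurs exactly there; the substitution may then be changed at `d`. -/
theorem exists_mgu_discharge {f : ℕ → Pos} {Γ₀ : Multiset (Hyp Sg)} {c e : Pos} {d d₀ d₁ : ℕ}
    (hbal : VarBalanced (.var d₀ ::ₘ .var d₁ ::ₘ c ::ₘ e ::ₘ ctxAtoms Γ₀))
    (hd₀ : f d₀ = .var d) (hd : .var d ∉ ctxAtoms (ctxSubst (atomSub f) Γ₀))
    (hc : c.subst f ≠ .var d) (he : e.subst f ≠ .var d) :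
    d₁ = d₀ ∧ ∃ g w, IsMGU (atomSub g) (.atom c) (.atom (.var d₀)) ∧
      ctxSubst (atomSub w) (ctxSubst (atomSub g) Γ₀) = ctxSubst (atomSub f) Γ₀ ∧
      (c.subst g).subst w = c.subst f ∧ (e.subst g).subst w = e.subst f := by
  have hc' : c ≠ .var d₀ := by
    rintro rfl
    exact hc hd₀
  have he' : e ≠ .var d₀ := by
    rintro rfl
    exact he hd₀
  have hΓ : .var d₀ ∉ ctxAtoms Γ₀ := by
    intro h
    refine hd ?_
    rw [ctxAtoms_subst, ← hd₀]
    exact Multiset.mem_map.2 ⟨_, h, rfl⟩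
  have hd₁ : d₁ = d₀ := by
    have := hbal d₀
    simp only [Multiset.count_cons, Multiset.count_eq_zero.2 hΓ, if_true, if_neg hc'.symm,
      if_neg he'.symm] at this
    by_contra hne
    rw [if_neg fun e => hne (Pos.var.inj e).symm] at this
    omega
  -- Giving `d₀` the value of `c` makes `f` a unifier. The change is invisible in the conclusion,
  -- where `d₀` does not occur before unification.
  have hf : ∀ p : Pos, p ≠ .var d₀ → p.subst (Function.update f d₀ (c.subst f)) = p.subst f := by
    rintro (v | c) hp
    · have : v ≠ d₀ := fun e => hp (by rw [e])
      simp [Pos.subst, this]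
    · rfl
  have hunif : (Ty.atom c).subst (atomSub (Function.update f d₀ (c.subst f))) =
      (Ty.atom (.var d₀)).subst (atomSub (Function.update f d₀ (c.subst f))) := by
    rw [Ty.atom_subst, Ty.atom_subst, hf _ hc', Pos.subst, Function.update_self]
  obtain ⟨g, hg⟩ := exists_isMGU (by rfl) hunif
  obtain ⟨w, hw⟩ := hg.factor hunif
  refine ⟨hd₁, g, w, hg, ?_, ?_, ?_⟩
  · rw [ctxSubst_factor hw]
    refine ctxSubst_congr fun v hv => ?_
    have : v ≠ d₀ := fun e => hΓ (e ▸ hv)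
    simp [atomSub, this]
  · rw [Pos.subst_subst, ← funext hw, hf _ hc']
  · rw [Pos.subst_subst, ← funext hw, hf _ he']

/-- The conditions on `d` are the eigenvariable condition of the matching `∀`-introduction. -/
theorem overI {x d : ℕ} {C E : Pos} {A B : Lambek Sg}
    (h : HybridInstance (.ax x (.arr (.atom (.var d)) (.atom C)) (.lbk B) ::ₘ Γ)
      (.arr (.atom (.var d)) (.atom E)) (.lbk A) t) (hx : ∀ g ∈ Γ, g.name ≠ x)
    (hd : .var d ∉ ctxAtoms Γ) (hC : C ≠ .var d) (hE : E ≠ .var d) :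
    HybridInstance Γ (.arr (.atom C) (.atom E)) (.lbk (.slash A B)) (Lam.lambda x t) := by
  obtain ⟨Γ₀, M, β₀, t₀, f, h, ht, e, e'⟩ := h
  obtain ⟨τ₀, Γ₀, rfl, e₀, rfl⟩ := exists_cons_of_ctxSubst e
  obtain ⟨D₀, C₀, rfl, e₁, e₂⟩ := Ty.eq_arr_of_subst e₀
  obtain ⟨D₁, E₀, rfl, e₃, e₄⟩ := Ty.eq_arr_of_subst e'
  obtain ⟨q, rfl, hq⟩ := exists_atom_of_subst e₁
  obtain ⟨c, rfl, rfl⟩ := exists_atom_of_subst e₂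
  obtain ⟨r, rfl, hr⟩ := exists_atom_of_subst e₃
  obtain ⟨b, rfl, rfl⟩ := exists_atom_of_subst e₄
  obtain ⟨d₀, rfl, hd₀⟩ := exists_var_of_subst hq
  obtain ⟨d₁, rfl, hd₁⟩ := exists_var_of_subst hr
  have hbal : VarBalanced (.var d₀ ::ₘ .var d₁ ::ₘ c ::ₘ b ::ₘ ctxAtoms Γ₀) := by
    have := h.regular.balanced
    simp only [seqAtoms_eq, ctxAtoms_cons, Hyp.ty, Ty.flatten, List.singleton_append,
      ← Multiset.cons_coe, Multiset.coe_nil] at this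
    convert this using 1
    simp only [← Multiset.singleton_add]
    abel
  obtain ⟨rfl, g, w, hg, h₁, h₂, h₃⟩ := exists_mgu_discharge hbal hd₀ hd hC hE
  refine ⟨_, _, _, _, w, .overI h (forall_mem_ctxSubst (P := (· ≠ x)).1 hx) rfl hg, ht.lambda x,
    h₁, ?_⟩
  simp only [Ty.subst, Ty.atom_subst, h₂, h₃]

theorem underI {x d : ℕ} {C E : Pos} {A B : Lambek Sg}
    (h : HybridInstance (.ax x (.arr (.atom C) (.atom (.var d))) (.lbk B) ::ₘ Γ)
      (.arr (.atom E) (.atom (.var d))) (.lbk A) t) (hx : ∀ g ∈ Γ, g.name ≠ x)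
    (hd : .var d ∉ ctxAtoms Γ) (hC : C ≠ .var d) (hE : E ≠ .var d) :
    HybridInstance Γ (.arr (.atom E) (.atom C)) (.lbk (.backslash B A)) (Lam.lambda x t) := by
  obtain ⟨Γ₀, M, β₀, t₀, f, h, ht, e, e'⟩ := h
  obtain ⟨τ₀, Γ₀, rfl, e₀, rfl⟩ := exists_cons_of_ctxSubst e
  obtain ⟨C₀, D₀, rfl, e₂, e₁⟩ := Ty.eq_arr_of_subst e₀
  obtain ⟨E₀, D₁, rfl, e₄, e₃⟩ := Ty.eq_arr_of_subst e'
  obtain ⟨q, rfl, hq⟩ := exists_atom_of_subst e₁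
  obtain ⟨c, rfl, rfl⟩ := exists_atom_of_subst e₂
  obtain ⟨r, rfl, hr⟩ := exists_atom_of_subst e₃
  obtain ⟨b, rfl, rfl⟩ := exists_atom_of_subst e₄
  obtain ⟨d₀, rfl, hd₀⟩ := exists_var_of_subst hq
  obtain ⟨d₁, rfl, hd₁⟩ := exists_var_of_subst hr
  have hbal : VarBalanced (.var d₀ ::ₘ .var d₁ ::ₘ c ::ₘ b ::ₘ ctxAtoms Γ₀) := by
    have := h.regular.balanced
    simp only [seqAtoms_eq, ctxAtoms_cons, Hyp.ty, Ty.flatten, List.singleton_append,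
      ← Multiset.cons_coe, Multiset.coe_nil] at this
    convert this using 1
    simp only [← Multiset.singleton_add]
    abel
  obtain ⟨rfl, g, w, hg, h₁, h₂, h₃⟩ := exists_mgu_discharge hbal hd₀ hd hC hE
  refine ⟨_, _, _, _, w, .underI h (forall_mem_ctxSubst (P := (· ≠ x)).1 hx) rfl hg, ht.lambda x,
    h₁, ?_⟩
  simp only [Ty.subst, Ty.atom_subst, h₂, h₃]

theorem three_le_count_map {X : Multiset Pos} {p q : Pos} (hp : X.count p = 2) (hq : q ∈ X)
    (hpq : q ≠ p) {F : Pos → Pos} (hF : F q = F p) : 3 ≤ (X.map F).count (F p) := by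
  obtain ⟨Y, rfl⟩ := Multiset.exists_cons_of_mem (Multiset.count_pos.1 (by omega : 0 < X.count p))
  rw [Multiset.count_cons_self] at hp
  obtain ⟨Z, rfl⟩ := Multiset.exists_cons_of_mem (Multiset.count_pos.1 (by omega : 0 < Y.count p))
  have hqZ : q ∈ Z := by simpa [hpq] using hq
  obtain ⟨W, rfl⟩ := Multiset.exists_cons_of_mem hqZ
  simp only [Multiset.map_cons, hF, Multiset.count_cons_self]
  omega

/-- Every variable of the derived sequent occurs twice there, and every atom of the instance twice
as well, so no variable can be merged with another atom. -/
theorem hybrid {β : Ty} {B : HForm Sg} (h : HybridInstance Γ β B t) (hs : IsSequent Γ β B) :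
    ∃ M t', BetaEta t' t ∧ Hybrid Γ M β B t' := by
  obtain ⟨Γ₀, M, β₀, t₀, f, h, ht, rfl, rfl⟩ := h
  have hX := h.regular.balanced
  have hb := hs.balanced
  have hcw := hs.const_word
  rw [Balanced, seqAtoms_subst] at hb
  rw [seqAtoms_subst] at hcw
  generalize hX₀ : seqAtoms Γ₀ β₀ = X at hX hb hcw
  have hcount : ∀ v, .var v ∈ X → X.count (.var v) = 2 := fun v hv =>
    (hX v).resolve_left (Multiset.count_pos.2 hv).ne'
  have hsep : ∀ v, .var v ∈ X → ∀ q ∈ X, q ≠ .var v → q.subst f ≠ f v := by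
    intro v hv q hq hqv e
    have h₁ := three_le_count_map (hcount v hv) hq hqv (F := Pos.subst f) e
    have h₂ := hb _ (Multiset.mem_map_of_mem (Pos.subst f) hv)
    omega
  have hvar : ∀ v, .var v ∈ X → ∃ w, f v = .var w := by
    intro v hv
    cases hfv : f v with
    | var w => exact ⟨w, rfl⟩
    | const c =>
      have hc : Pos.const c ∈ X.map (Pos.subst f) := Multiset.mem_map.2 ⟨_, hv, hfv⟩
      obtain ⟨x, n, A, M, α, hw, hcn⟩ := hcw c hc
      obtain ⟨g, hg, e⟩ := Multiset.mem_map.1 hw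
      -- Substitution does not touch words, so an end position `c` of a word occurs before
      -- instantiation, and a variable sent to `c` would be merged with it.
      have hcX : Pos.const c ∈ X := by
        rw [← hX₀, seqAtoms_eq]
        refine Multiset.mem_add.2 (.inl (mem_ctxAtoms.2 ⟨g, hg, ?_⟩))
        cases g with
        | ax => cases e
        | word =>
          cases e
          rcases hcn with rfl | rfl <;> simp [Hyp.ty, spanTy, Ty.flatten]
      exact absurd hfv.symm (hsep v hv _ hcX (by simp))
  obtain ⟨K, hK⟩ := exists_var_bound (X.map (Pos.subst f))
  choose! w hw using hvar
  classical
  -- Variables that do not occur are shifted beyond the image of the others, which makes the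
  -- renaming injective everywhere.
  let ρ : ℕ → ℕ := fun v => if .var v ∈ X then w v else v + K
  have hwK : ∀ v, .var v ∈ X → w v < K := fun v hv =>
    hK _ (Multiset.mem_map.2 ⟨_, hv, hw v hv⟩)
  have hρ : Function.Injective ρ := by
    intro v v' e
    by_cases hv : Pos.var v ∈ X <;> by_cases hv' : Pos.var v' ∈ X <;>
      simp only [ρ, hv, hv', if_true, if_false] at e
    · by_contra hne
      refine hsep v hv _ hv' (fun e => hne (Pos.var.inj e).symm) ?_
      rw [Pos.subst, hw v hv, hw v' hv', e]
    · have := hwK v hv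
      omega
    · have := hwK v' hv'
      omega
    · omega
  have hρf : ∀ v, .var v ∈ X → renSub ρ v = atomSub f v := by
    intro v hv
    simp [renSub, atomSub, ρ, hv, hw v hv]
  refine ⟨M, t₀, ht, ?_⟩
  have := h.rename hρ
  rwa [ctxSubst_congr (u := atomSub f), Ty.subst_congr (u := atomSub f)] at this
  · exact fun v hv => hρf v (by rw [← hX₀]; exact Multiset.mem_add.2 (.inr hv))
  · exact fun v hv => hρf v (by rw [← hX₀]; exact Multiset.mem_add.2 (.inl hv))

end HybridInstance

-- The Kripke model and its truth lemma

/-- The atomic hybrid formula of a predicate symbol. -/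
def atomForm : Sg.Simple ⊕ Sg.Complex → HForm Sg
  | .inl p => .lbk (.atom p)
  | .inr p => .cplx p

/-- The value of a first-order term. -/
def Trm.eval {k : ℕ} (b : Fin k → Pos) : Trm k → Pos
  | bvar i => b i
  | pos q => q

/-- A Kripke model of first-order linear logic.  Its worlds are antecedents of hybrid sequents,
and atomic formulas hold of the semantic terms of (instances of) hybrid proofs. -/
def Forces : {k : ℕ} → MForm Sg k → (Fin k → Pos) → Multiset (Hyp Sg) → Lam 0 → Prop
  | _, .atom p ts, b, Γ, t => ∃ β : Ty, β.shape = (atomForm p).type ∧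
      β.flatten = ts.map (Trm.eval b) ∧ HybridInstance Γ β (atomForm p) t
  | _, .imp A B, b, Γ, t => ∀ Δ u, CtxDisjoint Γ Δ → Forces A b Δ u →
      Forces B b (Γ + Δ) (.app t u)
  | _, .all A, b, Γ, t => ∀ p : Pos, Forces A (Fin.cases p b) Γ t

namespace Forces

variable {Γ : Multiset (Hyp Sg)} {t u : Lam 0}

theorem betaEta {k : ℕ} {A : MForm Sg k} {b : Fin k → Pos} (h : Forces A b Γ t)
    (htu : BetaEta t u) : Forces A b Γ u := by
  induction A generalizing Γ t u with
  | atom p ts =>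
    obtain ⟨β, h₁, h₂, h₃⟩ := h
    exact ⟨β, h₁, h₂, h₃.betaEta htu⟩
  | imp A B _ ihB => exact fun Δ w hd hA => ihB (h Δ w hd hA) (.app htu (.refl _))
  | all A ih => exact fun p => ih (h p) htu

theorem bind_iff {k m : ℕ} (A : MForm Sg k) (b' : Fin k → Trm m) (b : Fin m → Pos) :
    Forces (A.bind b' .pos) b Γ t ↔ Forces A (fun i => (b' i).eval b) Γ t := by
  induction A generalizing m Γ t with
  | atom p ts =>
    have e : (ts.map (Trm.bind b' .pos)).map (Trm.eval b) =
        ts.map (Trm.eval fun i => (b' i).eval b) := by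
      rw [List.map_map]
      refine List.map_congr_left fun t _ => ?_
      cases t <;> rfl
    rw [MForm.bind_atom]
    simp only [Forces, e]
  | imp A B ihA ihB => exact forall₃_congr fun Δ u _ => imp_congr (ihA _ _) (ihB _ _)
  | all A ih =>
    refine forall_congr' fun p => (ih _ _).trans ?_
    refine iff_of_eq (congrArg (fun b => Forces _ b Γ t) (funext fun i => ?_))
    refine Fin.cases rfl (fun i => ?_) i
    simp only [Fin.cases_succ]
    cases b' i <;> rfl

/-- Forcing of formulas without free indices. -/
abbrev holds (A : MForm Sg 0) (Γ : Multiset (Hyp Sg)) (t : Lam 0) : Prop :=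
  Forces A Fin.elim0 Γ t

theorem all_iff {A : MForm Sg 1} : holds (.all A) Γ t ↔ ∀ p, holds (A.inst p) Γ t := by
  refine forall_congr' fun p => ?_
  rw [holds, MForm.inst, bind_iff]
  refine iff_of_eq (congrArg (fun b => Forces _ b Γ t) (funext fun i => ?_))
  exact Fin.cases rfl (fun i => i.elim0) i

theorem of_foldr {l : List ℕ} {A : MForm Sg 0} {f : Pos → Pos}
    (h : ∀ g : Pos → Pos, (∀ q, (∀ x ∈ l, q ≠ .var x) → f q = g q) → holds (A.sub g) Γ t) :
    holds ((l.foldr MForm.forallVar A).sub f) Γ t := by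
  induction l generalizing f with
  | nil => exact h f fun _ _ => rfl
  | cons x l ih =>
    change holds (MForm.sub f (.all ((l.foldr MForm.forallVar A).close x))) Γ t
    rw [MForm.sub_all, all_iff]
    intro p
    rw [MForm.close_sub_inst]
    refine ih fun g hg => h g fun q hq => ?_
    rw [← hg q fun y hy => hq y (List.mem_cons_of_mem _ hy),
      Function.update_of_ne (hq x List.mem_cons_self)]

/-- Quantifiers range over all positions and constants stay fixed, so a closure is forced as soon as
all instances by substitutions for variables are. -/
theorem of_closure {A : MForm Sg 0}
    (h : ∀ f : ℕ → Pos, holds (A.sub (Pos.subst f)) Γ t) : holds A.closure Γ t := by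
  rw [← MForm.sub_id A.closure]
  refine of_foldr fun g hg => ?_
  have : g = Pos.subst fun v => g (.var v) := by
    funext q
    cases q with
    | var v => rfl
    | const c => exact (hg _ (by simp)).symm
  rw [this]
  exact h _

end Forces

open Forces

theorem CtxDisjoint.symm {Γ Δ : Multiset (Hyp Sg)} (h : CtxDisjoint Γ Δ) : CtxDisjoint Δ Γ :=
  fun d hd g hg => (h g hg d hd).symm

/-- Soundness of MILL1 in the model. Each hypothesis `x` is interpreted by a world `Δ x` and a term
`u x`; splitting the antecedent becomes a sum of disjoint worlds. -/
theorem MILL1.holds {Γ : Multiset (ℕ × MForm Sg 0)} {A : MForm Sg 0} {t : Lam 0}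
    (h : MILL1 Γ A t) (f : Pos → Pos) (Δ : ℕ → Multiset (Hyp Sg)) (u : ℕ → Lam 0)
    (hd : ∀ p ∈ Γ, ∀ q ∈ Γ, p.1 ≠ q.1 → CtxDisjoint (Δ p.1) (Δ q.1))
    (hu : ∀ p ∈ Γ, Forces.holds (p.2.sub f) (Δ p.1) (u p.1)) :
    Forces.holds (A.sub f) (Γ.bind fun p => Δ p.1) (t.sub u) := by
  induction h generalizing f Δ u with
  | ax x A =>
    rw [Multiset.singleton_bind]
    exact hu _ (Multiset.mem_singleton_self _)
  | @impE Γ₁ Γ₂ A B t₁ t₂ h₁ h₂ hn ih₁ ih₂ =>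
    rw [Multiset.add_bind]
    refine ih₁ f Δ u (fun p hp q hq => hd p (by simp [hp]) q (by simp [hq]))
      (fun p hp => hu p (by simp [hp])) _ _ ?_
      (ih₂ f Δ u (fun p hp q hq => hd p (by simp [hp]) q (by simp [hq]))
        fun p hp => hu p (by simp [hp]))
    intro g hg d hd'
    obtain ⟨p, hp, hg⟩ := Multiset.mem_bind.1 hg
    obtain ⟨q, hq, hd'⟩ := Multiset.mem_bind.1 hd'
    exact hd p (by simp [hp]) q (by simp [hq]) (hn p hp q hq) g hg d hd'
  | @impI Γ A B x t h hx ih =>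
    intro Δ' w hd' hw
    have hΔ : ∀ p ∈ Γ, Function.update Δ x Δ' p.1 = Δ p.1 := fun p hp =>
      Function.update_of_ne (hx p hp) _ _
    have hdΓ : ∀ p ∈ Γ, CtxDisjoint (Δ p.1) Δ' := fun p hp g hg d hd =>
      hd' g (Multiset.mem_bind.2 ⟨p, hp, hg⟩) d hd
    have := ih f (Function.update Δ x Δ') (Function.update u x w) ?_ ?_
    · rw [Multiset.cons_bind, Multiset.bind_congr hΔ, Function.update_self, add_comm] at this
      exact this.betaEta (BetaEta.sub_lambda_app u x t w).symm
    · intro p hp q hq hpq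
      rcases Multiset.mem_cons.1 hp with rfl | hp <;> rcases Multiset.mem_cons.1 hq with rfl | hq
      · exact absurd rfl hpq
      · rw [Function.update_self, hΔ q hq]
        exact (hdΓ q hq).symm
      · rw [Function.update_self, hΔ p hp]
        exact hdΓ p hp
      · rw [hΔ p hp, hΔ q hq]
        exact hd p hp q hq hpq
    · intro p hp
      rcases Multiset.mem_cons.1 hp with rfl | hp
      · rw [Function.update_self, Function.update_self]
        exact hw
      · rw [hΔ p hp, Function.update_of_ne (hx p hp)]
        exact hu p hp
  | allE p h ih =>
    have := ih f Δ u hd hu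
    rw [MForm.sub_all, all_iff] at this
    rw [MForm.sub_inst]
    exact this _
  | @allI Γ A t y h hΓ hA ih =>
    rw [MForm.sub_all, all_iff]
    intro p
    have := ih (Function.update f (.var y) p) Δ u hd ?_
    · rw [MForm.sub_inst, Function.update_self, MForm.sub_congr (g := f)] at this
      · exact this
      · intro c; simp
      · intro v hv
        rw [Function.update_of_ne]
        rintro ⟨⟩
        exact hA hv
    · intro q hq
      rw [MForm.sub_congr (g := f)]
      · exact hu q hq
      · intro c; simp
      · intro v hv
        rw [Function.update_of_ne]
        rintro ⟨⟩
        exact hΓ (MForm.mem_ctxFreeVars.2 ⟨q, hq, hv⟩)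

theorem exists_fresh_pos (Γ : Multiset (Hyp Sg)) (C D : Pos) :
    ∃ y, .var y ∉ ctxAtoms Γ ∧ C ≠ .var y ∧ D ≠ .var y := by
  obtain ⟨K, hK⟩ := exists_var_bound (C ::ₘ D ::ₘ ctxAtoms Γ)
  refine ⟨K, fun h => ?_, fun h => ?_, fun h => ?_⟩ <;>
  exact lt_irrefl K (hK K (by simp [h]))

theorem exists_fresh_name (Γ : Multiset (Hyp Sg)) (t : Lam 0) :
    ∃ x, (∀ g ∈ Γ, g.name ≠ x) ∧ x ∉ t.fv := by
  obtain ⟨x, hx⟩ := Infinite.exists_notMem_finset ((Γ.map Hyp.name).toFinset ∪ t.fv)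
  simp only [Finset.mem_union, Multiset.mem_toFinset, not_or] at hx
  exact ⟨x, fun g hg e => hx.1 (Multiset.mem_map.2 ⟨g, hg, e⟩), hx.2⟩

theorem ctxDisjoint_singleton {Γ : Multiset (Hyp Sg)} {x : ℕ} {α : Ty} {A : HForm Sg}
    (hx : ∀ g ∈ Γ, g.name ≠ x) : CtxDisjoint Γ {.ax x α A} := by
  intro g hg d hd
  obtain rfl := Multiset.mem_singleton.1 hd
  exact hx g hg

/-- Both directions are proved together: the elimination rule turns derivability into forcing.
Conversely a fresh hypothesis at a fresh position is forced, by the direction just named for the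
argument, and is then discharged. This yields the η-expansion of `t`. -/
theorem Lambek.hybridInstance_iff (F : Lambek Sg) (C D : Pos) (Γ : Multiset (Hyp Sg))
    (t : Lam 0) : HybridInstance Γ (.arr (.atom D) (.atom C)) (.lbk F) t ↔
      holds ((HForm.lbk F).transl [C, D]) Γ t := by
  induction F generalizing C D Γ t with
  | atom p =>
    constructor
    · exact fun h => ⟨_, rfl, rfl, h⟩
    · rintro ⟨β, h₁, h₂, h₃⟩
      obtain ⟨D', C', rfl⟩ := Ty.eq_of_shape_str h₁
      simp only [Ty.flatten, List.map_cons, List.map_nil, Trm.eval, List.singleton_append,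
        List.cons.injEq, and_true, List.getD_cons_zero, List.getD_cons_succ] at h₂
      obtain ⟨rfl, rfl⟩ := h₂
      exact h₃
  | slash A B ihA ihB =>
    change _ ↔ holds (.all (slashBody A B C D)) Γ t
    simp only [all_iff, slashBody_inst]
    constructor
    · intro h p Δ u hd hB
      exact (ihA _ _ _ _).1 (h.overE ((ihB _ _ _ _).2 hB) hd)
    · intro h
      obtain ⟨y, hy, hC, hD⟩ := exists_fresh_pos Γ C D
      obtain ⟨x, hx, hxt⟩ := exists_fresh_name Γ t
      have := (ihA _ _ _ _).2 (h (.var y) _ _ (ctxDisjoint_singleton hx)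
        ((ihB _ _ _ _).1 (HybridInstance.ax x (α := .arr (.atom (.var y)) (.atom D)) rfl)))
      rw [add_comm, Multiset.singleton_add] at this
      exact (this.overI hx hy hD hC).betaEta (BetaEta.lambda_app_fvar hxt)
  | backslash B A ihB ihA =>
    change _ ↔ holds (.all (backslashBody B A C D)) Γ t
    simp only [all_iff, backslashBody_inst]
    constructor
    · intro h p Δ u hd hB
      rw [add_comm]
      exact (ihA _ _ _ _).1 (((ihB _ _ _ _).2 hB).underE h hd.symm)
    · intro h
      obtain ⟨y, hy, hC, hD⟩ := exists_fresh_pos Γ C D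
      obtain ⟨x, hx, hxt⟩ := exists_fresh_name Γ t
      have := (ihA _ _ _ _).2 (h (.var y) _ _ (ctxDisjoint_singleton hx)
        ((ihB _ _ _ _).1 (HybridInstance.ax x (α := .arr (.atom C) (.atom (.var y))) rfl)))
      rw [add_comm, Multiset.singleton_add] at this
      exact (this.underI hx hy hC hD).betaEta (BetaEta.lambda_app_fvar hxt)

theorem HForm.hybridInstance_iff (A : HForm Sg) {β : Ty} (hβ : β.shape = A.type)
    (Γ : Multiset (Hyp Sg)) (t : Lam 0) :
    HybridInstance Γ β A t ↔ holds (A.transl β.flatten) Γ t := by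
  induction A generalizing β Γ t with
  | cplx p =>
    have e : (β.flatten.map Trm.pos).map (Trm.eval Fin.elim0) = β.flatten := by
      rw [List.map_map]
      exact List.map_id _
    constructor
    · exact fun h => ⟨β, hβ, e.symm, h⟩
    · rintro ⟨γ, h₁, h₂, h₃⟩
      rwa [Ty.ext_flatten (hβ.trans h₁.symm) (e.symm.trans h₂.symm)]
  | lbk F =>
    obtain ⟨D, C, rfl⟩ := Ty.eq_of_shape_str hβ
    exact F.hybridInstance_iff C D Γ t
  | bar A B ihA ihB =>
    obtain ⟨γ, α, rfl, hγ, hα⟩ := Ty.eq_arr_of_shape hβ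
    have hl : α.flatten.length = A.type.length := by rw [Ty.length_flatten, hα]
    rw [transl, Ty.flatten, ← hl, List.take_left, List.drop_left]
    constructor
    · intro h Δ u hd hB
      exact (ihA hα _ _).1 (h.barE ((ihB hγ _ _).2 hB) hd)
    · intro h
      obtain ⟨x, hx, hxt⟩ := exists_fresh_name Γ t
      have := (ihA hα _ _).2 (h _ _ (ctxDisjoint_singleton hx)
        ((ihB hγ _ _).1 (HybridInstance.ax x hγ)))
      rw [add_comm, Multiset.singleton_add] at this
      exact (this.barI hx).betaEta (BetaEta.lambda_app_fvar hxt)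

theorem MILL1.hybridInstance {Γ : Multiset (Hyp Sg)} {β : Ty} {B : HForm Sg} {t : Lam 0}
    (hs : IsSequent Γ β B) (h : MILL1 (translCtx Γ) (B.transl β.flatten) t) :
    HybridInstance Γ β B t := by
  have hinj := Multiset.inj_on_of_nodup_map hs.names_nodup
  obtain ⟨h₀, hh₀⟩ : ∃ h₀ : ℕ → Hyp Sg, ∀ g ∈ Γ, h₀ g.name = g := by
    classical
    -- The default value is irrelevant: only names of `Γ` are looked up.
    refine ⟨fun x => if h : ∃ g ∈ Γ, g.name = x then h.choose else .ax 0 β B, fun g hg => ?_⟩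
    have hex : ∃ g' ∈ Γ, g'.name = g.name := ⟨g, hg, rfl⟩
    simp only [dif_pos hex]
    exact hinj _ hex.choose_spec.1 _ hg hex.choose_spec.2
  have key := h.holds id (fun x => {h₀ x}) .fvar ?_ ?_
  · rw [MForm.sub_id, Lam.sub_fvar, translCtx, Multiset.bind_map, Multiset.bind_singleton] at key
    rw [HForm.hybridInstance_iff _ hs.goal_shape]
    convert key using 1
    conv_lhs => rw [← Multiset.map_id Γ]
    refine Multiset.map_congr rfl fun g hg => ?_
    rw [Hyp.name_transl, hh₀ g hg]
    rfl
  · intro p hp q hq hpq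
    obtain ⟨g, hg, rfl⟩ := Multiset.mem_map.1 hp
    obtain ⟨d, hd, rfl⟩ := Multiset.mem_map.1 hq
    rw [Hyp.name_transl, Hyp.name_transl] at hpq ⊢
    rw [hh₀ g hg, hh₀ d hd]
    intro g' hg' d' hd'
    rw [Multiset.mem_singleton.1 hg', Multiset.mem_singleton.1 hd']
    exact hpq
  · intro p hp
    obtain ⟨g, hg, rfl⟩ := Multiset.mem_map.1 hp
    rw [Hyp.name_transl, hh₀ g hg, MForm.sub_id]
    cases g with
    | ax x α A =>
      have hα := hs.ax_shape _ _ _ hg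
      exact (A.hybridInstance_iff hα _ _).1 (.ax x hα)
    | word x n A M α =>
      have hl := hs.word_lexical _ _ _ _ _ hg
      have hα := hl.shape_and_varBalanced.1
      -- A word is translated as a closure, so all instances of its principal type must be forced;
      -- each is an instance of the lexicon rule.
      refine Forces.of_closure fun f => ?_
      rw [HForm.transl_sub _ _ _ (by rw [Ty.length_flatten, hα]), ← Ty.flatten_subst]
      exact (A.hybridInstance_iff (by rw [Ty.shape_subst, hα]) _ _).1 (.lex hl f)

theorem MILL1.complete {Γ : Multiset (Hyp Sg)} {β : Ty} {B : HForm Sg} {t : Lam 0}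
    (hs : IsSequent Γ β B) (h : MILL1 (translCtx Γ) (B.transl β.flatten) t) :
    ∃ M t', BetaEta t' t ∧ Hybrid Γ M β B t' :=
  (h.hybridInstance hs).hybrid hs

-- A logical relation for string terms

/-- The set of terms denoted by a type, for a valuation `ρ` of the atomic types. -/
def Ty.Realizes (ρ : Pos → Lam 0 → Prop) : Ty → Lam 0 → Prop
  | atom p, M => ρ p M
  | arr β α, M => ∀ N, β.Realizes ρ N → α.Realizes ρ (.app M N)

/-- Valuations that respect `βη`-equivalence. -/
def BetaEtaClosed (ρ : Pos → Lam 0 → Prop) : Prop :=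
  ∀ p M N, BetaEta M N → ρ p M → ρ p N

theorem Ty.Realizes.betaEta {ρ : Pos → Lam 0 → Prop} (hρ : BetaEtaClosed ρ) {α : Ty} {M N : Lam 0}
    (h : α.Realizes ρ M) (hMN : BetaEta M N) : α.Realizes ρ N := by
  induction α generalizing M N with
  | atom p => exact hρ p M N hMN h
  | arr β α _ ih => exact fun P hP => ih (h P hP) (.app hMN (.refl _))

/-- The valuation of atomic types after a substitution. -/
def substValuation (s : ℕ → Ty) (ρ : Pos → Lam 0 → Prop) : Pos → Lam 0 → Prop :=
  fun p => ((Ty.atom p).subst s).Realizes ρ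

theorem BetaEtaClosed.subst {ρ : Pos → Lam 0 → Prop} (hρ : BetaEtaClosed ρ) (s : ℕ → Ty) :
    BetaEtaClosed (substValuation s ρ) := fun _ _ _ hMN h => h.betaEta hρ hMN

/-- Moves the unifier of a rule into the valuation, at which the induction hypotheses are then
applied. -/
theorem Ty.realizes_subst {s : ℕ → Ty} {ρ : Pos → Lam 0 → Prop} (α : Ty) :
    (α.subst s).Realizes ρ = α.Realizes (substValuation s ρ) := by
  induction α with
  | atom p => rfl
  | arr β α ihβ ihα =>
    funext M
    simp only [subst, Realizes, ihβ, ihα]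

theorem Typing.realizes {Γ : Multiset (ℕ × Ty)} {M : Lam 0} {α : Ty} (h : Typing Γ M α)
    {ρ : Pos → Lam 0 → Prop} (hρ : BetaEtaClosed ρ) (u : ℕ → Lam 0)
    (hu : ∀ p ∈ Γ, p.2.Realizes ρ (u p.1)) : α.Realizes ρ (M.sub u) := by
  induction h generalizing u with
  | var x α => exact hu _ (Multiset.mem_singleton_self _)
  | app _ _ _ ih₁ ih₂ =>
    exact ih₁ u (fun p hp => hu p (by simp [hp])) _ (ih₂ u fun p hp => hu p (by simp [hp]))
  | @lam Γ M x α β _ hx ih =>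
    intro N hN
    refine (ih (Function.update u x N) fun p hp => ?_).betaEta hρ
      (BetaEta.sub_lambda_app u x M N).symm
    rcases Multiset.mem_cons.1 hp with rfl | hp
    · rwa [Function.update_self]
    · rw [Function.update_of_ne (hx p hp)]
      exact hu p hp

theorem BetaEta.etaExpand (a : STy) {k : ℕ} (M : Lam k) : BetaEta (a.etaExpand M) M := by
  induction a generalizing k with
  | σ => exact .refl _
  | arr b a ihb iha => exact .trans (.lam (.trans (iha _) (.app (.refl _) (ihb _)))) (.eta M)

theorem BetaEta.sub_comp_app (u : ℕ → Lam 0) (M N P : Lam 0) :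
    BetaEta (.app ((Lam.comp M N).sub u) P) (.app (M.sub u) (.app (N.sub u) P)) := by
  have e : (Lam.comp M N).sub u =
      .lam (.app (M.sub u).weaken (.app (N.sub u).weaken (.bvar 0))) := by
    simp only [Lam.comp, Lam.sub, Lam.bind, Lam.bind_weaken]
    rfl
  rw [e]
  refine .trans (.beta _ _) ?_
  change BetaEta (.app ((M.sub u).weaken.inst P) (.app ((N.sub u).weaken.inst P) P)) _
  rw [Lam.weaken_inst, Lam.weaken_inst]
  exact .refl _

/-- The antecedent is realized by the terms substituted for its variables. -/
def CtxRealizes (ρ : Pos → Lam 0 → Prop) (Γ : Multiset (Hyp Sg)) (u : ℕ → Lam 0) : Prop :=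
  ∀ h ∈ Γ, h.ty.Realizes ρ (u h.name)

theorem CtxRealizes.of_subst {ρ : Pos → Lam 0 → Prop} {s : ℕ → Ty} {Γ : Multiset (Hyp Sg)}
    {u : ℕ → Lam 0} (h : CtxRealizes ρ (ctxSubst s Γ) u) :
    CtxRealizes (substValuation s ρ) Γ u := by
  intro g hg
  have := h _ (Multiset.mem_map_of_mem _ hg)
  rwa [Hyp.ty_subst, Ty.realizes_subst, Hyp.name_subst] at this

theorem CtxRealizes.cons_update {ρ : Pos → Lam 0 → Prop} {Γ : Multiset (Hyp Sg)} {u : ℕ → Lam 0}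
    (h : CtxRealizes ρ Γ u) {x : ℕ} (hx : ∀ g ∈ Γ, g.name ≠ x) {α : Ty} {A : HForm Sg} {N : Lam 0}
    (hN : α.Realizes ρ N) : CtxRealizes ρ (.ax x α A ::ₘ Γ) (Function.update u x N) := by
  intro g hg
  rcases Multiset.mem_cons.1 hg with rfl | hg
  · simpa [Hyp.name, Hyp.ty] using hN
  · rw [Function.update_of_ne (hx g hg)]
    exact h g hg

theorem realizes_idTerm {ρ : Pos → Lam 0 → Prop} (hρ : BetaEtaClosed ρ) {C D : Ty}
    (h : D.Realizes ρ = C.Realizes ρ) : (Ty.arr D C).Realizes ρ Lam.idTerm :=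
  fun N hN => (h ▸ hN : C.Realizes ρ N).betaEta hρ (BetaEta.beta (.bvar 0) N).symm

/-- The fundamental lemma of the logical relation. Unified types denote the same set, so strings
compose in `/E` and `\E`, and the identity can stand for the hypothesis discharged by `/I` and `\I`.
-/
theorem Hybrid.realizes {Γ : Multiset (Hyp Sg)} {M : Lam 0} {β : Ty} {B : HForm Sg} {t : Lam 0}
    (h : Hybrid Γ M β B t) {ρ : Pos → Lam 0 → Prop} (hρ : BetaEtaClosed ρ) (u : ℕ → Lam 0)
    (hu : CtxRealizes ρ Γ u) : β.Realizes ρ (M.sub u) := by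
  induction h generalizing ρ u with
  | lex h₀ h =>
    refine h.2.1.realizes hρ u fun p hp => ?_
    obtain rfl := Multiset.mem_singleton.1 hp
    exact hu _ (Multiset.mem_singleton_self _)
  | ax h₁ h₂ =>
    refine Ty.Realizes.betaEta hρ (hu _ (Multiset.mem_singleton_self _)) (.symm ?_)
    exact (BetaEta.etaExpand _ _).bind _ _
  | @overE Γ Δ M N t u' C D E F A B s h₁ h₂ ha hs ih₁ ih₂ =>
    have i₁ := ih₁ (hρ.subst s) u
      (CtxRealizes.of_subst fun h hh => hu h (Multiset.mem_add.2 (.inl hh)))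
    have i₂ := ih₂ (hρ.subst s) u
      (CtxRealizes.of_subst fun h hh => hu h (Multiset.mem_add.2 (.inr hh)))
    have e : F.Realizes (substValuation s ρ) = D.Realizes (substValuation s ρ) := by
      rw [← Ty.realizes_subst, ← Ty.realizes_subst, hs.1]
    intro P hP
    rw [Ty.realizes_subst] at hP ⊢
    exact (i₁ _ (e ▸ i₂ P hP)).betaEta (hρ.subst s) (BetaEta.sub_comp_app u M N P).symm
  | @underE Γ Δ M N t u' C D E F A B s h₁ h₂ ha hs ih₁ ih₂ =>
    have i₁ := ih₁ (hρ.subst s) u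
      (CtxRealizes.of_subst fun h hh => hu h (Multiset.mem_add.2 (.inl hh)))
    have i₂ := ih₂ (hρ.subst s) u
      (CtxRealizes.of_subst fun h hh => hu h (Multiset.mem_add.2 (.inr hh)))
    have e : F.Realizes (substValuation s ρ) = D.Realizes (substValuation s ρ) := by
      rw [← Ty.realizes_subst, ← Ty.realizes_subst, hs.1]
    intro P hP
    rw [Ty.realizes_subst] at hP ⊢
    exact (i₁ _ (e ▸ i₂ P hP)).betaEta (hρ.subst s) (BetaEta.sub_comp_app u M N P).symm
  | @overI Γ x d M t C D E A B s h hx hD hs ih =>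
    have e : D.Realizes (substValuation s ρ) = C.Realizes (substValuation s ρ) := by
      rw [← Ty.realizes_subst, ← Ty.realizes_subst, hs.1]
    have i := ih (hρ.subst s) _
      (CtxRealizes.cons_update (.of_subst hu) hx (realizes_idTerm (hρ.subst s) e))
    rw [show Ty.arr (C.subst s) (E.subst s) = (Ty.arr C E).subst s from rfl, Ty.realizes_subst]
    refine Ty.Realizes.betaEta (hρ.subst s) ?_ (BetaEta.sub_lambda_app u x M Lam.idTerm).symm
    exact fun P hP => i P (e ▸ hP)
  | @underI Γ x d M t C D E A B s h hx hD hs ih =>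
    have e : C.Realizes (substValuation s ρ) = D.Realizes (substValuation s ρ) := by
      rw [← Ty.realizes_subst, ← Ty.realizes_subst, hs.1]
    have i := ih (hρ.subst s) _
      (CtxRealizes.cons_update (.of_subst hu) hx (realizes_idTerm (hρ.subst s) e))
    rw [show Ty.arr (E.subst s) (C.subst s) = (Ty.arr E C).subst s from rfl, Ty.realizes_subst]
    refine Ty.Realizes.betaEta (hρ.subst s) ?_ (BetaEta.sub_lambda_app u x M Lam.idTerm).symm
    exact fun P hP => e ▸ i P hP
  | @barE Γ Δ M N t u' α β γ A B s h₁ h₂ ha hs ih₁ ih₂ =>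
    have i₁ := ih₁ (hρ.subst s) u
      (CtxRealizes.of_subst fun h hh => hu h (Multiset.mem_add.2 (.inl hh)))
    have i₂ := ih₂ (hρ.subst s) u
      (CtxRealizes.of_subst fun h hh => hu h (Multiset.mem_add.2 (.inr hh)))
    rw [← Ty.realizes_subst, ← hs.1, Ty.realizes_subst] at i₂
    rw [Ty.realizes_subst]
    exact i₁ _ i₂
  | @barI Γ x M t α β A B h hx ih =>
    intro N hN
    exact (ih hρ _ (hu.cons_update hx hN)).betaEta hρ (BetaEta.sub_lambda_app u x M N).symm

theorem lambda_foldr {xs : List ℕ} {z : ℕ} (hz : z ∉ xs) :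
    Lam.lambda z (xs.foldr (fun y M => .app (.fvar y) M) (.fvar z)) = Lam.stringTerm xs := by
  unfold Lam.lambda Lam.stringTerm
  congr 1
  induction xs with
  | nil => simp [Lam.bind]
  | cons y xs ih =>
    simp only [List.mem_cons, not_or] at hz
    simp only [List.foldr_cons, Lam.bind, ih hz.2, if_neg (Ne.symm hz.1)]

theorem Hybrid.betaEta_stringTerm {n : ℕ} {x : Fin n → ℕ} {A : Fin n → HForm Sg}
    {N : Fin n → Lam 1} {α : Fin n → Ty} {M : Lam 0} {B : HForm Sg} {t : Lam 0}
    (h : Hybrid (sentence x A N α) M (spanTy 0 n) B t) :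
    BetaEta M (Lam.stringTerm (List.ofFn x)) := by
  obtain ⟨z, hz⟩ := Infinite.exists_notMem_finset (M.fv ∪ (List.ofFn x).toFinset)
  simp only [Finset.mem_union, List.mem_toFinset, not_or] at hz
  -- `w c` is the suffix of the string from position `c`, applied to `z`. A word maps `w (i + 1)` to
  -- `w i`; type variables are realized by all terms.
  let w : ℕ → Lam 0 := fun c =>
    ((List.ofFn x).drop c).foldr (fun y M => .app (.fvar y) M) (.fvar z)
  let ρ : Pos → Lam 0 → Prop := fun p M => ∀ c, p = .const c → BetaEta M (w c)
  have hρ : BetaEtaClosed ρ := fun p M N hMN hM c hc => hMN.symm.trans (hM c hc)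
  have key := h.realizes hρ .fvar ?_ (.fvar z) ?_
  · have h₀ : BetaEta (.app M (.fvar z)) (w 0) := by
      have := key 0 rfl
      rwa [Lam.sub_fvar] at this
    rw [← lambda_foldr hz.2]
    -- `M` applied to `z` is the whole string over `z`; as `z` is not free in `M`, abstraction and η
    -- give `M`.
    exact (BetaEta.lambda_app_fvar hz.1).symm.trans (h₀.lambda z)
  · intro g hg
    obtain ⟨i, -, rfl⟩ := Multiset.mem_map.1 hg
    intro P hP c hc
    cases hc
    have hi : (i : ℕ) < (List.ofFn x).length := by simp
    have e : w i = .app (.fvar (x i)) (w (i + 1)) := by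
      simp only [w]
      rw [List.drop_eq_getElem_cons hi, List.foldr_cons, List.getElem_ofFn]
    rw [e]
    exact .app (.refl _) (hP _ rfl)
  · intro c hc
    cases hc
    have : w n = .fvar z := by
      simp only [w]
      rw [List.drop_eq_nil_of_le (by simp)]
      rfl
    rw [this]
    exact .refl _

-- Sentences are well-formed sequents

theorem mem_seqAtoms_sentence {n : ℕ} {x : Fin n → ℕ} {A : Fin n → HForm Sg}
    {N : Fin n → Lam 1} {α : Fin n → Ty} {p : Pos}
    (h : p ∈ seqAtoms (sentence x A N α) (spanTy 0 n)) : ∃ c ≤ n, p = .const c := by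
  rcases Multiset.mem_add.1 h with h | h
  · obtain ⟨g, hg, h⟩ := mem_ctxAtoms.1 h
    obtain ⟨i, -, rfl⟩ := Multiset.mem_map.1 hg
    simp only [Hyp.ty, spanTy, Ty.flatten, List.singleton_append, List.mem_cons,
      List.not_mem_nil, or_false] at h
    rcases h with rfl | rfl
    · exact ⟨i, i.2.le, rfl⟩
    · exact ⟨i + 1, i.2, rfl⟩
  · simp only [spanTy, Ty.flatten, List.singleton_append, Multiset.mem_coe, List.mem_cons,
      List.not_mem_nil, or_false] at h
    rcases h with rfl | rfl
    · exact ⟨0, n.zero_le, rfl⟩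
    · exact ⟨n, le_rfl, rfl⟩

/-- An inner position ends one word and starts the next; `0` and `n` each meet one word and the
succedent. -/
theorem count_seqAtoms_sentence {n : ℕ} (hn : 0 < n) {x : Fin n → ℕ} {A : Fin n → HForm Sg}
    {N : Fin n → Lam 1} {α : Fin n → Ty} {c : ℕ} (hc : c ≤ n) :
    (seqAtoms (sentence x A N α) (spanTy 0 n)).count (.const c) = 2 := by
  rw [seqAtoms, Multiset.count_add, sentence, Multiset.bind_map, Multiset.count_bind]
  simp only [Hyp.ty, spanTy, Ty.flatten, List.singleton_append, ← Multiset.cons_coe,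
    Multiset.coe_nil, Multiset.count_cons, Multiset.count_zero, zero_add, Pos.const.injEq]
  change (∑ i : Fin n, ((if c = (i : ℕ) + 1 then 1 else 0) + if c = (i : ℕ) then 1 else 0)) + _ = 2
  rw [Fin.sum_univ_eq_sum_range
    (fun i => (if c = i + 1 then 1 else 0) + if c = i then 1 else 0), Finset.sum_add_distrib,
    Finset.sum_ite_eq]
  cases c with
  | zero =>
    simp [hn, hn.ne]
  | succ c =>
    simp only [Nat.add_right_cancel_iff, Finset.sum_ite_eq, Finset.mem_range]
    rw [if_pos (by omega : c < n), if_neg (Nat.succ_ne_zero c)]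
    rcases hc.lt_or_eq with h | h
    · rw [if_pos h, if_neg h.ne]
    · rw [if_neg h.not_lt, if_pos h]
      rfl

theorem isSequent_sentence {n : ℕ} {x : Fin n → ℕ} {A : Fin n → HForm Sg} {N : Fin n → Lam 1}
    {α : Fin n → Ty} {B : HForm Sg} (hn : 0 < n) (hx : Function.Injective x)
    (hl : ∀ i, IsLexical (x i) i (A i) (N i) (α i)) (hB : B.type = STy.str) :
    IsSequent (sentence x A N α) (spanTy 0 n) B where
  names_nodup := by
    rw [sentence, Multiset.map_map]
    exact Finset.univ.nodup.map hx
  word_lexical := by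
    intro y m C M β h
    obtain ⟨i, -, e⟩ := Multiset.mem_map.1 h
    cases e
    exact hl i
  ax_shape := by
    intro y β C h
    obtain ⟨i, -, e⟩ := Multiset.mem_map.1 h
    cases e
  goal_shape := hB.symm
  balanced := by
    intro p hp
    obtain ⟨c, hc, rfl⟩ := mem_seqAtoms_sentence hp
    exact count_seqAtoms_sentence hn hc
  const_word := by
    intro c hc
    obtain ⟨c', hc', e⟩ := mem_seqAtoms_sentence hc
    cases e
    have hmem : ∀ i : Fin n, Hyp.word (x i) i (A i) (N i) (α i) ∈ sentence x A N α := fun i =>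
      Multiset.mem_map.2 ⟨i, Finset.mem_univ_val _, rfl⟩
    rcases hc'.lt_or_eq with h | rfl
    · exact ⟨_, _, _, _, _, hmem ⟨c, h⟩, .inl rfl⟩
    -- The final position is the right end of the last word, which exists because the sentence is
    -- not empty.
    · exact ⟨_, _, _, _, _, hmem ⟨c - 1, by omega⟩, .inr (by simp only; omega)⟩

end HTLG

-- Assembly of the theorem

theorem mainTheorem1 (Sg : Signature) :
    -- derivability of a hybrid sequent and of its translation coincide
    (∀ (Γ : Multiset (Hyp Sg)) (β : Ty) (B : HForm Sg), IsSequent Γ β B →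
      ((∃ M t, Hybrid Γ M β B t) ↔ ∃ t, MILL1 (translCtx Γ) (translGoal Γ β B) t)) ∧
    -- a hybrid proof yields a proof of the translation with the same semantic term
    (∀ (Γ : Multiset (Hyp Sg)) (M : Lam 0) (β : Ty) (B : HForm Sg) (t : Lam 0),
      Hybrid Γ M β B t → MILL1 (translCtx Γ) (translGoal Γ β B) t) ∧
    -- a proof of the translation yields a hybrid proof with the same semantic term
    (∀ (Γ : Multiset (Hyp Sg)) (β : Ty) (B : HForm Sg) (t : Lam 0), IsSequent Γ β B →
      MILL1 (translCtx Γ) (translGoal Γ β B) t →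
        ∃ M t', BetaEta t' t ∧ Hybrid Γ M β B t') ∧
    -- the case of sentences
    (∀ (n : ℕ) (x : Fin n → ℕ) (A : Fin n → HForm Sg) (N : Fin n → Lam 1) (α : Fin n → Ty)
      (B : HForm Sg), 0 < n → Function.Injective x →
      (∀ i, IsLexical (x i) i (A i) (N i) (α i)) → B.type = STy.str →
      (∀ M t, Hybrid (sentence x A N α) M (spanTy 0 n) B t →
        BetaEta M (Lam.stringTerm (List.ofFn x)) ∧
        MILL1 (translCtx (sentence x A N α)) (B.transl [.const 0, .const n]) t) ∧
      (∀ t, MILL1 (translCtx (sentence x A N α)) (B.transl [.const 0, .const n]) t →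
        ∃ M t', BetaEta M (Lam.stringTerm (List.ofFn x)) ∧ BetaEta t' t ∧
          Hybrid (sentence x A N α) M (spanTy 0 n) B t')) := by
  have sound : ∀ (Γ : Multiset (Hyp Sg)) (M : Lam 0) (β : Ty) (B : HForm Sg) (t : Lam 0),
      Hybrid Γ M β B t → MILL1 (translCtx Γ) (translGoal Γ β B) t :=
    fun Γ M β B t h => MILL1.closureMod_iff.2 h.sound
  have complete : ∀ (Γ : Multiset (Hyp Sg)) (β : Ty) (B : HForm Sg) (t : Lam 0),
      IsSequent Γ β B → MILL1 (translCtx Γ) (translGoal Γ β B) t →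
        ∃ M t', BetaEta t' t ∧ Hybrid Γ M β B t' :=
    fun Γ β B t hs h => MILL1.complete hs (MILL1.closureMod_iff.1 h)
  refine ⟨fun Γ β B hs => ⟨?_, ?_⟩, sound, complete, ?_⟩
  · rintro ⟨M, t, h⟩
    exact ⟨t, sound _ _ _ _ _ h⟩
  · rintro ⟨t, h⟩
    obtain ⟨M, t', -, h'⟩ := complete _ _ _ _ hs h
    exact ⟨M, t', h'⟩
  · intro n x A N α B hn hx hl hB
    refine ⟨fun M t h => ⟨h.betaEta_stringTerm, h.sound⟩, fun t h => ?_⟩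
    -- `(spanTy 0 n).flatten` computes to `[.const 0, .const n]`, so the unclosed succedent is
    -- already the required formula.
    obtain ⟨M, t', ht, h'⟩ := MILL1.complete (β := spanTy 0 n)
      (isSequent_sentence hn hx hl hB) h
    exact ⟨M, t', h'.betaEta_stringTerm, ht, h'⟩
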